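/- Let $n\ge 0$ and let $\mathbb R^{n+2}_1$ be Minkowski space with inner product $\langle x,y\rangle=-x_0y_0+x_1y_1+\dots+x_{n+1}y_{n+1}$. Let $O^+$ be the group of orthochronous Lorentz transformations of $\mathbb R^{n+2}_1$ and $\mathfrak o\subset\mathrm{End}(\mathbb R^{n+2}_1)$ the Lie algebra of skew endomorphisms; taking linear spans identifies $O^+$ and $\mathfrak o$ with the projective Lorentz group and its Lie algebra. Write $(v\wedge w)(x)=\langle v,x\rangle w-\langle w,x\rangle v$, and $[v,w]$ for the linear span of $v,w$. **Setting.** Let $\Delta$ be a compact Riemann surface diffeomorphic to a closed disc, realised by a global holomorphic coordinate as a compact subset of $\mathbb C$, and let $s$ be an interior point of $\Delta$. Let $\mathfrak p:U\to\Delta\setminus\{s\}$ be the universal cover, realised as $U=\{w\in\mathbb C: s+e^w\in\Delta\setminus\{s\}\}$, $\mathfrak p(w)=s+e^w$, with polar coordinates $r=e^{\operatorname{Re}w}$, $\phi=\operatorname{Im}w$. The branched universal cover is $U\cup\{s\}$, in which a set $A$ is open iff $A\cap U$ is open in $U$ and, in case $s\in A$, there is $\varepsilon>0$ such that $A$ contains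 all points of $U$ with $r<\varepsilon$. Limits "$\to s$" refer to this topology. For an $\mathfrak o$-valued 1-form $\omega$ and a base point $p$, $\Gamma_p(\omega):q\mapsto\Gamma_p^{\,q}(\omega)$ denotes the $O^+$-valued primitive, i.e. $d\Gamma_p(\omega)=\Gamma_p(\omega)\,\omega$ and $\Gamma_p^{\,p}(\omega)=\mathrm{id}$; $\Gamma^{\,p}(\omega)$ is the map $q\mapsto\Gamma_q^{\,p}(\omega)$. The monodromy at $P\in\Delta\setminus\{s\}$ of an $\mathfrak o$-valued 1-form $\omega$ on $\Delta\setminus\{s\}$ with $d+\omega$ flat is $\mathcal M_P(\omega)=\Gamma_0^{2\pi}(\gamma^*\omega)$, where $\gamma:[0,2\pi]\to\Delta\setminus\{s\}$ is any $C^1$ loop based at $P$ with winding number $-1$ around $s$. A *pure pole form* on $\Delta\setminus\{s\}$ is a 1-form $\xi=\operatorname{Re}\big((\xi^{\mathrm{Re}}+i\,\xi^{\mathrm{Im}})\alpha\big)$ with $\xi^{\mathrm{Re}}=v\wedge w$, $\xi^{\mathrm{Im}}=x\wedge y$, $[x,y]\subseteq[v,w]^\perp$, where $\alpha$ is a holomorphic,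 nowhere zero 1-form on $\Delta\setminus\{s\}$ with a pole of first order at $s$ and $\operatorname{Res}_s\alpha=-1$, for which there is a holomorphic coordinate $z$ on all of $\Delta$ with $z(s)=0$ and $\alpha=-dz/z$. It is *Minkowski* if $[v,w]$ has signature $(1,1)$, *spacelike* if $\langle\cdot,\cdot\rangle$ is positive definite on $[v,w]$, and *degenerate* if $\langle\cdot,\cdot\rangle$ is degenerate on $[v,w]$. It is *of the first kind* if it is spacelike, or degenerate, or Minkowski with positive eigenvalue $\zeta$ of $v\wedge w$ satisfying $\zeta<1$. A *pole form* is a smooth $\mathfrak o$-valued 1-form $\psi$ on $\Delta\setminus\{s\}$ such that $d+\psi$ is flat and $\psi$ differs by a bounded form from some pure pole form. **Proposition.** Let $\psi$ be a pole form on $\Delta\setminus\{s\}$ and $\xi$ a pure pole form of the first kind such that $\psi-\xi$ is bounded. Write $\boldsymbol\psi=\mathfrak p^*\psi$, $\boldsymbol\xi=\mathfrak p^*\xi$, and for $p\in U$ let $$\boldsymbol\psi_p:=\Gamma_p(\boldsymbol\xi)\,\boldsymbol\psi\,\Gamma^{\,p}(\boldsymbol\xi)-\boldsymbol\xi .$$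 Then the primitives on $U$ of $\boldsymbol\psi$, $\boldsymbol\xi$ and all $\boldsymbol\psi_p$, and the primitives on $[0,2\pi]$ of $\gamma^*\psi$ and $\gamma^*\xi$ for all loops $\gamma$ as above, exist and are unique, for every base point; for all $p,\tilde p\in U$, $$\Gamma_p(\boldsymbol\psi)=\Gamma_p(\boldsymbol\psi_p)\,\Gamma_p(\boldsymbol\xi),\qquad \Gamma_{\tilde p}(\boldsymbol\psi_{\tilde p})=\Gamma_{\tilde p}^{\,p}(\boldsymbol\psi)\,\Gamma_p(\boldsymbol\psi_p)\,\Gamma_p^{\,\tilde p}(\boldsymbol\xi);$$ and there is a map $U\to O^+$, $p\mapsto\Gamma_p^{\,s}(\boldsymbol\psi_p)$, with the following properties. 1. For every $\mathcal C\subset U$ on which $\phi$ is bounded and for which $\mathcal C\cup\{s\}$ is compact with limit point $s$, and for every $p\in U$, $$\lim_{\mathcal C\ni q\to s}\Gamma_p^{\,q}(\boldsymbol\psi_p)=\Gamma_p^{\,s}(\boldsymbol\psi_p).$$ Moreover, if $\xi$ is degenerate or spacelike, then $\lim_{p\to s}\Gamma_p^{\,s}(\boldsymbol\psi_p)=\mathrm{id}$.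 2. For every $P\in\Delta\setminus\{s\}$ one has $\mathcal M_P(\xi)=\mathcal M(\xi):=e^{-2\pi\xi^{\mathrm{Im}}}$, and for every $p\in U$ with $\mathfrak p(p)=P$, $$\mathcal M_P(\psi)=\Gamma_p^{\,s}(\boldsymbol\psi_p)\,\mathcal M(\xi)\,\big(\Gamma_p^{\,s}(\boldsymbol\psi_p)\big)^{-1}.$$ -/

import Mathlib

open Set Filter Topology
open scoped ContDiff

noncomputable section

namespace PoleForm

/-! ### Minkowski space, the Lorentz group and its Lie algebra -/

/-- The vector space underlying the Minkowski space of dimension `n + 2`. (Its norm only serves as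
an auxiliary norm: boundedness and limits do not depend on it, the dimension being finite.) -/
abbrev Mink (n : ℕ) := Fin (n + 2) → ℝ

/-- The endomorphisms of Minkowski space, with the operator norm. -/
abbrev MEnd (n : ℕ) := Mink n →L[ℝ] Mink n

/-- The Minkowski inner product `-x₀ y₀ + x₁ y₁ + ⋯ + xₙ₊₁ yₙ₊₁`. -/
def mink {n : ℕ} (x y : Mink n) : ℝ := -(x 0 * y 0) + ∑ i : Fin (n + 1), x i.succ * y i.succ

lemma mink_add {n : ℕ} (v x y : Mink n) : mink v (x + y) = mink v x + mink v y := by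
  simp only [mink, Pi.add_apply, mul_add, Finset.sum_add_distrib]
  ring

lemma mink_smul {n : ℕ} (v : Mink n) (c : ℝ) (x : Mink n) : mink v (c • x) = c * mink v x := by
  simp only [mink, Pi.smul_apply, smul_eq_mul, mul_add, Finset.mul_sum]
  congr 1
  · ring
  · exact Finset.sum_congr rfl fun i _ => by ring

/-- The endomorphism `v ∧ w : x ↦ ⟨v, x⟩ w - ⟨w, x⟩ v`. -/
def wedge {n : ℕ} (v w : Mink n) : MEnd n :=
  LinearMap.toContinuousLinearMap
    { toFun := fun x => mink v x • w - mink w x • v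
      map_add' := fun x y => by
        simp only [mink_add, add_smul]
        abel
      map_smul' := fun c x => by
        simp only [mink_smul, mul_smul, RingHom.id_apply, smul_sub] }

/-- The group `O⁺` of orthochronous Lorentz transformations. Taking linear spans identifies it with
the projective Lorentz group (every class in `O / {±1}` has exactly one orthochronous
representative). -/
def orthochronous (n : ℕ) : Set (MEnd n) :=
  {A | (∀ x y, mink (A x) (A y) = mink x y) ∧
    0 < A (Pi.single 0 1) 0}

/-- The Lie algebra `𝔬` of endomorphisms that are skew for the Minkowski inner product; it is
identified with the Lie algebra of the projective Lorentz group by `A ↦ A + ℝ id`. -/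
def lorentzAlgebra (n : ℕ) : Set (MEnd n) :=
  {A | ∀ x y, mink (A x) y + mink x (A y) = 0}

/-- The span of `v, w` has signature `(1, 1)`. -/
def SpanMinkowski {n : ℕ} (v w : Mink n) : Prop :=
  (∃ u ∈ Submodule.span ℝ {v, w}, mink u u < 0) ∧ ∃ u ∈ Submodule.span ℝ {v, w}, 0 < mink u u

/-- The inner product is positive definite on the span of `v, w`. -/
def SpanSpacelike {n : ℕ} (v w : Mink n) : Prop :=
  ∀ u ∈ Submodule.span ℝ {v, w}, u ≠ 0 → 0 < mink u u

/-- The inner product is degenerate on the span of `v, w`. -/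
def SpanDegenerate {n : ℕ} (v w : Mink n) : Prop :=
  ∃ u ∈ Submodule.span ℝ {v, w}, u ≠ 0 ∧ ∀ u' ∈ Submodule.span ℝ {v, w}, mink u u' = 0

/-- The condition on `v, w` for a pure pole form with `ξ^Re = v ∧ w` to be of the first kind. -/
def FirstKind {n : ℕ} (v w : Mink n) : Prop :=
  (SpanMinkowski v w ∧
    ∀ ζ : ℝ, 0 < ζ → Module.End.HasEigenvalue (wedge v w : Mink n →ₗ[ℝ] Mink n) ζ → ζ < 1) ∨
  SpanSpacelike v w ∨ SpanDegenerate v w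

/-! ### One-forms and their primitives -/

/-- Endomorphism-valued one-forms on (subsets of) a real normed space `X`. -/
abbrev Form (n : ℕ) (X : Type) [NormedAddCommGroup X] [NormedSpace ℝ X] := X → X →L[ℝ] MEnd n

section Primitives

variable {n : ℕ} {X : Type} [NormedAddCommGroup X] [NormedSpace ℝ X]

/-- `Γ` is a primitive of `θ` on `U` normalized at `p`: an `O⁺`-valued map with `dΓ = Γ θ` and
`Γ(p) = id`. -/
structure IsPrimitive (U : Set X) (θ : Form n X) (p : X) (Γ : X → MEnd n) : Prop where
  mem : ∀ q ∈ U, Γ q ∈ orthochronous n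
  deriv : ∀ q ∈ U,
    HasFDerivWithinAt Γ ((ContinuousLinearMap.mul ℝ (MEnd n) (Γ q)).comp (θ q)) U q
  base : Γ p = 1

/-- For every base point in `U`, there is exactly one primitive of `θ` on `U` normalized there. -/
def HasUniquePrimitives (U : Set X) (θ : Form n X) : Prop :=
  ∀ p ∈ U, ∃ Γ, IsPrimitive U θ p Γ ∧ ∀ Γ', IsPrimitive U θ p Γ' → EqOn Γ' Γ U

open Classical in
/-- `prim U θ p q` is `Γ_p^q(θ)`, the value at `q` of the primitive of `θ` on `U` normalized at `p`
(and `id` if there is no primitive). -/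
def prim (U : Set X) (θ : Form n X) (p q : X) : MEnd n :=
  if h : ∃ Γ, IsPrimitive U θ p Γ then Classical.choose h q else 1

/-- The connection `d + θ` is flat on `U`: `dθ(h, k) + [θ(h), θ(k)] = 0`. (For smooth `θ`, it
is enough to ask for this in the interior.) -/
def IsFlat (U : Set X) (θ : Form n X) : Prop :=
  ∀ Z ∈ interior U, ∀ h k : X,
    fderiv ℝ θ Z h k - fderiv ℝ θ Z k h + (θ Z h * θ Z k - θ Z k * θ Z h) = 0

end Primitives

/-! ### Discs, punctured discs and covers -/

/-- `Δ ⊆ ℂ` is diffeomorphic (as a surface with boundary) to the closed unit disc. -/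
def IsClosedDisc (Δ : Set ℂ) : Prop :=
  ∃ f g : ℂ → ℂ, ContDiffOn ℝ ∞ f (Metric.closedBall 0 1) ∧ ContDiffOn ℝ ∞ g Δ ∧
    MapsTo f (Metric.closedBall 0 1) Δ ∧ MapsTo g Δ (Metric.closedBall 0 1) ∧
    LeftInvOn g f (Metric.closedBall 0 1) ∧ RightInvOn g f Δ

/-- The covering map `𝔭 : w ↦ s + e^w`. The real and imaginary parts of `w` are `ln r` and `φ`,
where `(r, φ)` are the polar coordinates centred at `s`. -/
def covMap (s : ℂ) (w : ℂ) : ℂ := s + Complex.exp w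

/-- The universal cover of `Δ \ {s}`, realised as the preimage of `Δ \ {s}` under `w ↦ s + e^w`. -/
def cover (Δ : Set ℂ) (s : ℂ) : Set ℂ := {w | covMap s w ∈ Δ \ {s}}

/-- The branched universal cover: the universal cover together with the point `s`, which is
`none` here. -/
def BranchedCover (Δ : Set ℂ) (s : ℂ) := Option (cover Δ s)

/-- The inclusion of the universal cover into the branched universal cover. -/
def toBranched {Δ : Set ℂ} {s : ℂ} (w : cover Δ s) : BranchedCover Δ s := some w

/-- The point `s` of the branched universal cover. -/
def branchPoint (Δ : Set ℂ) (s : ℂ) : BranchedCover Δ s := none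

/-- `A` is open if its part in the universal cover is open and if, when `s` belongs to `A`, all
points of sufficiently small radius `r = |e^w|` belong to `A`. Equivalently, the second condition
says that `A` has open image under `(r, φ) ↦ r e^{i arctan φ}`, `s ↦ 0`, near `s`. -/
instance (Δ : Set ℂ) (s : ℂ) : TopologicalSpace (BranchedCover Δ s) where
  IsOpen A := IsOpen (toBranched ⁻¹' A) ∧ (branchPoint Δ s ∈ A →
    ∃ ε > 0, ∀ w : cover Δ s, ‖Complex.exp (w : ℂ)‖ < ε → toBranched w ∈ A)
  isOpen_univ := ⟨isOpen_univ, fun _ => ⟨1, one_pos, fun _ _ => mem_univ _⟩⟩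
  isOpen_inter := by
    rintro A B ⟨hA, hA'⟩ ⟨hB, hB'⟩
    refine ⟨hA.inter hB, fun h => ?_⟩
    obtain ⟨a, ha, ha'⟩ := hA' h.1
    obtain ⟨b, hb, hb'⟩ := hB' h.2
    exact ⟨min a b, lt_min ha hb, fun w hw =>
      ⟨ha' w (hw.trans_le (min_le_left _ _)), hb' w (hw.trans_le (min_le_right _ _))⟩⟩
  isOpen_sUnion := by
    intro S hS
    refine ⟨?_, ?_⟩
    · rw [preimage_sUnion]
      exact isOpen_biUnion fun A hA => (hS A hA).1
    · rintro ⟨A, hA, h⟩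
      obtain ⟨a, ha, ha'⟩ := (hS A hA).2 h
      exact ⟨a, ha, fun w hw => ⟨A, hA, ha' w hw⟩⟩

/-- The filter on the universal cover that describes `q → s` in the branched universal cover. -/
def toS (Δ : Set ℂ) (s : ℂ) : Filter (cover Δ s) := comap toBranched (𝓝 (branchPoint Δ s))

/-- The subsets `C` of the universal cover along which limits at `s` are taken: `C ∪ {s}` is
compact in the branched universal cover, `s` is a limit point of `C`, and the polar angle is bounded
on `C`. -/
structure IsApproach {Δ : Set ℂ} {s : ℂ} (C : Set (cover Δ s)) : Prop where
  compact : IsCompact (insert (branchPoint Δ s) (toBranched '' C))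
  limitPoint : branchPoint Δ s ∈ closure (toBranched '' C)
  angle : ∃ K : ℝ, ∀ w ∈ C, |(w : ℂ).im| ≤ K

/-- The pullback of a one-form under the covering map. -/
def pullCover {n : ℕ} (s : ℂ) (θ : Form n ℂ) : Form n ℂ :=
  fun w => (θ (covMap s w)).comp (fderiv ℝ (covMap s) w)

/-- The pullback of a one-form under a curve defined on `[0, 2π]`. -/
def pullCurve {n : ℕ} (γ : ℝ → ℂ) (θ : Form n ℂ) : Form n ℝ :=
  fun t => (θ (γ t)).comp (fderivWithin ℝ γ (Icc 0 (2 * Real.pi)) t)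

/-- `γ : [0, 2π] → Δ \ {s}` is a continuously differentiable loop with base point `P` and winding
number `-1` around `s`. -/
structure IsMonodromyLoop (Δ : Set ℂ) (s P : ℂ) (γ : ℝ → ℂ) : Prop where
  contDiff : ContDiffOn ℝ 1 γ (Icc 0 (2 * Real.pi))
  mapsTo : MapsTo γ (Icc 0 (2 * Real.pi)) (Δ \ {s})
  start : γ 0 = P
  finish : γ (2 * Real.pi) = P
  winding : (2 * Real.pi * Complex.I)⁻¹ *
    ∫ t in (0 : ℝ)..(2 * Real.pi), derivWithin γ (Icc 0 (2 * Real.pi)) t / (γ t - s) = -1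

/-- The monodromy `Γ_0^{2π}(γ^* θ)` of `θ` along the loop `γ`. -/
def monodromy {n : ℕ} (θ : Form n ℂ) (γ : ℝ → ℂ) : MEnd n :=
  prim (Icc 0 (2 * Real.pi)) (pullCurve γ θ) 0 (2 * Real.pi)

/-! ### Pole forms -/

/-- `α = a dZ` is a holomorphic, nowhere zero one-form on `Δ \ {s}` with a pole of first order
and residue `-1` at `s`, and there is a coordinate `z` on all of `Δ` adapted to `α`, that is,
`z` is holomorphic (up to the boundary), injective, has nowhere zero derivative, and satisfies
`z(s) = 0` and `α = -dz / z`. -/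
structure IsPoleDifferential (Δ : Set ℂ) (s : ℂ) (a : ℂ → ℂ) : Prop where
  holomorphic : ContDiffOn ℂ ∞ a (Δ \ {s})
  ne_zero : ∀ Z ∈ Δ \ {s}, a Z ≠ 0
  residue : Tendsto (fun Z => (Z - s) * a Z) (𝓝[≠] s) (𝓝 (-1))
  adapted : ∃ z : ℂ → ℂ, ContDiffOn ℂ ∞ z Δ ∧ InjOn z Δ ∧ z s = 0 ∧
    (∀ Z ∈ Δ, derivWithin z Δ Z ≠ 0) ∧ ∀ Z ∈ Δ \ {s}, a Z = -(derivWithin z Δ Z / z Z)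

/-- `ξ` is the pure pole form `Re((ξ^Re + i ξ^Im) α)` on `Δ \ {s}` with `ξ^Re = v ∧ w` and
`ξ^Im = x ∧ y`, where the span of `x, y` is orthogonal to that of `v, w`. -/
structure IsPurePoleForm {n : ℕ} (Δ : Set ℂ) (s : ℂ) (v w x y : Mink n) (ξ : Form n ℂ) :
    Prop where
  orthogonal : ∀ u ∈ Submodule.span ℝ {x, y}, ∀ u' ∈ Submodule.span ℝ {v, w}, mink u u' = 0
  form : ∃ a : ℂ → ℂ, IsPoleDifferential Δ s a ∧ ∀ Z ∈ Δ \ {s}, ∀ h : ℂ,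
    ξ Z h = (a Z * h).re • wedge v w - (a Z * h).im • wedge x y

/-- `θ` is bounded on `Δ \ {s}`. -/
def IsBoundedForm {n : ℕ} (Δ : Set ℂ) (s : ℂ) (θ : Form n ℂ) : Prop :=
  ∃ B : ℝ, ∀ Z ∈ Δ \ {s}, ‖θ Z‖ ≤ B

/-- `ψ` is a pole form on `Δ \ {s}`: a smooth Lie algebra valued one-form such that `d + ψ` is flat
and `ψ` differs from some pure pole form by a bounded form. -/
structure IsPoleForm {n : ℕ} (Δ : Set ℂ) (s : ℂ) (ψ : Form n ℂ) : Prop where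
  smooth : ContDiffOn ℝ ∞ ψ (Δ \ {s})
  mem : ∀ Z ∈ Δ \ {s}, ∀ h : ℂ, ψ Z h ∈ lorentzAlgebra n
  flat : IsFlat (Δ \ {s}) ψ
  bounded : ∃ (v w x y : Mink n) (ξ : Form n ℂ),
    IsPurePoleForm Δ s v w x y ξ ∧ IsBoundedForm Δ s (ψ - ξ)

/-- The gauge transform `Γ_p(ξ) ψ Γ^p(ξ) - ξ` on the universal cover, where `ψ` and `ξ` stand for
the pullbacks to the universal cover. -/
def gaugeTransform {n : ℕ} (Δ : Set ℂ) (s : ℂ) (ξ ψ : Form n ℂ) (p : ℂ) : Form n ℂ := fun q =>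
  ((ContinuousLinearMap.mul ℝ (MEnd n) (prim (cover Δ s) (pullCover s ξ) p q)).comp
    ((ContinuousLinearMap.mul ℝ (MEnd n)).flip (prim (cover Δ s) (pullCover s ξ) q p))).comp
      (pullCover s ψ q) - pullCover s ξ q

end PoleForm

end

open PoleForm

/-!
Write `A = v ∧ w` and `B = x ∧ y`. By orthogonality `A` and `B` commute, in fact `A B = B A = 0`.
On the universal cover `-α` has a primitive `μ`, a logarithm of the adapted coordinate, and the
primitives of `ξ` are `exp (-re c A) exp (im c B)` with `c = μ q - μ p` (`IsPoleLog.prim_eq`).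
Near the puncture, `μ q - q` is bounded, and `μ` has the quasi-period `-2πi` of the deck
transformation; this gives `M(ξ) = exp (-2π B)`.

*Existence of primitives.* The universal cover is parametrized by a closed half-plane
(`nonempty_coverParam`), and a flat `C¹` form on a convex set has primitives, obtained by solving
the equation along segments (`exists_primitive_of_flat`). Uniqueness, and the fact that primitives
are Lorentz transformations, follow as `G G'*` is constant for any two solutions `G, G'`, where
`*` is the adjoint for the Minkowski inner product; orthochronicity follows by connectedness. The
product `Γ_p(ψ) Γ^p(ξ)` solves the equation of the gauge transform `ψ_p`, which gives the
factorization and the change of base points.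

*The limits.* As `ξ` commutes with its primitives, `ψ_p` is the conjugate of the bounded form `ψ -
ξ` by `Γ_p(ξ)`. On the Lie algebra, `D = ad A` satisfies `D³ = -c D`, where `c` is the Gram
determinant of `v, w` (`ad_wedge_pow_three`). Hence `exp (t D)` is a combination of `1, D, D²`
with trigonometric, polynomial or hyperbolic coefficients, and it grows at most like `exp (κ |t|)`
with `κ < 1` if `c > -1`, which the first kind condition ensures (`neg_one_lt_gram`,
`exists_exp_conj_le`). The pullback of a bounded form to the universal cover is `O(e^{re q})`, so
that `ψ_p = O(e^{(1 - κ) re q})` on horizontal strips. By a Grönwall estimate, its primitive has a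
limit `L p` at the puncture (`exists_strip_limit`). As the bound for `ψ_p` on the horizontal ray
from `p` is `O(e^{κ re p + (1 - κ) re q})`, the distance of `L p` to the identity is `O(e^{re p})`
(`exists_gauge_limit`).

*The monodromy.* A loop of winding number `-1` lifts to a curve from `p` to `p - 2πi`, so that the
monodromies are `Γ_p^{p - 2πi}`. By invariance under the deck transformation, `Γ_p^{q - 2πi}(ψ_p)
M(ξ) = M(ψ) Γ_p^q(ψ_p)`; the limit `q → s` is `L p M(ξ) = M(ψ) L p`.
-/


noncomputable section

namespace PoleForm

/-! ### The Minkowski adjoint -/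

section Algebra

variable {n : ℕ}

lemma mink_comm (x y : Mink n) : mink x y = mink y x := by
  simp only [mink, mul_comm]

lemma mink_add_left (x y v : Mink n) : mink (x + y) v = mink x v + mink y v := by
  rw [mink_comm, mink_add, mink_comm v x, mink_comm v y]

lemma mink_smul_left (c : ℝ) (x v : Mink n) : mink (c • x) v = c * mink x v := by
  rw [mink_comm, mink_smul, mink_comm]

lemma mink_sub (v x y : Mink n) : mink v (x - y) = mink v x - mink v y := by
  have := mink_add v (x - y) y
  rw [sub_add_cancel] at this
  linarith

lemma mink_sub_left (x y v : Mink n) : mink (x - y) v = mink x v - mink y v := by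
  rw [mink_comm, mink_sub, mink_comm v x, mink_comm v y]

lemma mink_neg (v x : Mink n) : mink v (-x) = -mink v x := by
  simpa using mink_smul v (-1) x

lemma mink_sum_left {ι : Type*} (t : Finset ι) (f : ι → Mink n) (v : Mink n) :
    mink (∑ i ∈ t, f i) v = ∑ i ∈ t, mink (f i) v := by
  classical
  induction t using Finset.induction_on with
  | empty => simp [mink]
  | insert i t hi ih => rw [Finset.sum_insert hi, Finset.sum_insert hi, mink_add_left, ih]

/-- The diagonal entries `-1, 1, …, 1` of the Minkowski inner product. -/
def sgn (i : Fin (n + 2)) : ℝ := if i = 0 then -1 else 1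

lemma sgn_mul_self (i : Fin (n + 2)) : sgn i * sgn i = 1 := by
  unfold sgn; split_ifs <;> norm_num

lemma mink_eq_sum (x y : Mink n) : mink x y = ∑ i, sgn i * (x i * y i) := by
  rw [Fin.sum_univ_succ]
  simp [mink, sgn, Fin.succ_ne_zero]

lemma mink_single (i : Fin (n + 2)) (y : Mink n) : mink (Pi.single i 1) y = sgn i * y i := by
  rw [mink_eq_sum, Finset.sum_eq_single i]
  · simp
  · intro j _ hj
    simp [hj]
  · simp

lemma eq_of_forall_mink {y z : Mink n} (h : ∀ x, mink x y = mink x z) : y = z := by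
  funext i
  have := h (Pi.single i 1)
  rw [mink_single, mink_single] at this
  have h2 := congrArg (fun r => sgn i * r) this
  simpa [← mul_assoc, sgn_mul_self] using h2

lemma wedge_apply (v w x : Mink n) : wedge v w x = mink v x • w - mink w x • v := rfl

/-- The adjoint of an endomorphism with respect to the Minkowski inner product, as a linear
operation on endomorphisms. -/
def madj : MEnd n →L[ℝ] MEnd n :=
  LinearMap.toContinuousLinearMap
    { toFun := fun A => LinearMap.toContinuousLinearMap
        { toFun := fun y i => sgn i * mink (A (Pi.single i 1)) y
          map_add' := fun y z => by
            funext i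
            simp only [mink_add, mul_add, Pi.add_apply]
          map_smul' := fun c y => by
            funext i
            simp only [mink_smul, Pi.smul_apply, smul_eq_mul, RingHom.id_apply]
            ring }
      map_add' := fun A A' => by
        ext y i
        simp [mink_add_left, mul_add]
      map_smul' := fun c A => by
        ext y i
        simp only [LinearMap.coe_toContinuousLinearMap', LinearMap.coe_mk, AddHom.coe_mk,
          FunLike.coe_smul, Pi.smul_apply, mink_smul_left, smul_eq_mul,
          RingHom.id_apply]
        ring }

lemma madj_apply (A : MEnd n) (y : Mink n) (i : Fin (n + 2)) :
    madj A y i = sgn i * mink (A (Pi.single i 1)) y := rfl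

lemma mink_madj (A : MEnd n) (x y : Mink n) : mink x (madj A y) = mink (A x) y := by
  have hx : x = ∑ i, x i • (Pi.single i 1 : Mink n) := by
    simpa using (pi_eq_sum_univ' x)
  conv_rhs => rw [hx, map_sum, mink_sum_left]
  rw [mink_eq_sum]
  refine Finset.sum_congr rfl fun i _ => ?_
  rw [madj_apply, map_smul, mink_smul_left]
  linear_combination (x i * mink (A (Pi.single i 1)) y) * sgn_mul_self i

lemma madj_eq_iff {A A' : MEnd n} : madj A = A' ↔ ∀ x y, mink (A x) y = mink x (A' y) := by
  refine ⟨fun h x y => by rw [← h, mink_madj], fun h => ?_⟩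
  ext1 y
  exact eq_of_forall_mink fun x => by rw [mink_madj, h]

lemma madj_mul (A A' : MEnd n) : madj (A * A') = madj A' * madj A :=
  madj_eq_iff.2 fun x y => by
    simp only [mul_apply_eq_comp, mink_madj]

lemma madj_one : madj (1 : MEnd n) = 1 := madj_eq_iff.2 fun _ _ => rfl

lemma mem_lorentzAlgebra_iff {A : MEnd n} : A ∈ lorentzAlgebra n ↔ madj A = -A := by
  rw [madj_eq_iff]
  refine forall₂_congr fun x y => ?_
  rw [neg_apply, mink_neg, ← add_eq_zero_iff_eq_neg]

lemma preserves_iff {A : MEnd n} :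
    (∀ x y, mink (A x) (A y) = mink x y) ↔ madj A * A = 1 := by
  constructor
  · intro h
    ext1 y
    exact eq_of_forall_mink fun x => by
      rw [mul_apply_eq_comp, mink_madj, h]; rfl
  · intro h x y
    rw [← mink_madj, ← mul_apply_eq_comp, h]; rfl

lemma mul_eq_one_symm {A A' : MEnd n} (h : A * A' = 1) : A' * A = 1 := by
  have h1 : (A : Mink n →ₗ[ℝ] Mink n) * (A' : Mink n →ₗ[ℝ] Mink n) = 1 := by
    ext1 i
    ext1
    simpa using congrArg (fun T : MEnd n => T (Pi.single i 1)) h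
  have h2 := mul_eq_one_comm.1 h1
  ext1 y
  simpa using congrArg (fun T : Mink n →ₗ[ℝ] Mink n => T y) h2

/-- For a Lorentz transformation, the time component of the image of the time axis is at least one
in absolute value. -/
lemma one_le_sq_of_preserves {A : MEnd n} (h : madj A * A = 1) :
    1 ≤ (A (Pi.single 0 1) 0) ^ 2 := by
  have h1 := preserves_iff.2 h (Pi.single 0 1) (Pi.single 0 1)
  rw [mink_single] at h1
  simp only [mink, sgn, if_true, Pi.single_eq_same] at h1
  have : 0 ≤ ∑ i : Fin (n + 1), A (Pi.single 0 1) i.succ * A (Pi.single 0 1) i.succ :=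
    Finset.sum_nonneg fun i _ => mul_self_nonneg _
  nlinarith

lemma isClosed_orthochronous : IsClosed (orthochronous n) := by
  have : orthochronous n =
      {A | madj A * A = 1} ∩ {A : MEnd n | 1 ≤ A (Pi.single 0 1) 0} := by
    ext A
    simp only [orthochronous, mem_ofPred_eq, preserves_iff, mem_inter_iff]
    refine and_congr_right fun h => ⟨fun h0 => ?_, fun h0 => by linarith⟩
    have := one_le_sq_of_preserves h
    nlinarith
  rw [this]
  refine (isClosed_eq (by fun_prop) continuous_const).inter (isClosed_le continuous_const ?_)
  exact (continuous_apply 0).comp (by fun_prop)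

lemma madj_wedge (v w : Mink n) : madj (wedge v w) = -wedge v w :=
  madj_eq_iff.2 fun x y => by
    rw [neg_apply, wedge_apply, wedge_apply, mink_sub_left, mink_neg, mink_sub]
    simp only [mink_smul_left, mink_comm x]
    ring

/-- If `x, y` are orthogonal to `v, w`, then `(v ∧ w) (x ∧ y) = 0`. -/
lemma wedge_mul_wedge {v w x y : Mink n} (hvx : mink v x = 0) (hvy : mink v y = 0)
    (hwx : mink w x = 0) (hwy : mink w y = 0) : wedge v w * wedge x y = 0 := by
  ext1 u
  simp [wedge_apply, mink_sub, mink_smul, hvx, hvy, hwx, hwy]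

/-! ### Growth of the adjoint action of a simple bivector -/

/-- The Gram determinant of `v, w`. -/
def gram (v w : Mink n) : ℝ := mink v v * mink w w - mink v w ^ 2

lemma wedge_pow_three (v w : Mink n) :
    wedge v w * wedge v w * wedge v w = -gram v w • wedge v w := by
  ext1 u
  simp only [mul_apply_eq_comp, wedge_apply, mink_sub, mink_smul,
    smul_apply, gram, mink_comm w v]
  module

/-- For skew `X`, the endomorphism `(v ∧ w) X (v ∧ w)` is a multiple of `v ∧ w`. This is what keeps
the growth of the adjoint action of `exp (t v ∧ w)` on the Lie algebra down to `exp |ζ t|`, although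
it is `exp |2 ζ t|` on general endomorphisms. -/
lemma wedge_mul_skew_mul_wedge (v w : Mink n) {X : MEnd n} (hX : madj X = -X) :
    wedge v w * X * wedge v w = mink v (X w) • wedge v w := by
  have hs : ∀ a b, mink a (X b) = -mink b (X a) := fun a b => by
    have := madj_eq_iff.1 hX b a
    rw [neg_apply, mink_neg] at this
    rw [mink_comm, this]
  have h0 : ∀ a, mink a (X a) = 0 := fun a => by linarith [hs a a]
  ext1 u
  simp only [mul_apply_eq_comp, wedge_apply, map_sub, map_smul,
    smul_apply, h0, hs w v]
  module

/-- On the Lie algebra, `D = ad (v ∧ w)` satisfies `D³ = -c D`, where `c` is the Gram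
determinant. -/
lemma ad_wedge_pow_three (v w : Mink n) {X : MEnd n} (hX : madj X = -X) :
    let A := wedge v w
    let D := fun Y : MEnd n => A * Y - Y * A
    D (D (D X)) = -gram v w • D X := by
  intro A D
  have h3 : A * A * A = -gram v w • A := wedge_pow_three v w
  have h2 : A * X * A = mink v (X w) • A := wedge_mul_skew_mul_wedge v w hX
  have e : D (D (D X)) = A * A * A * X - X * (A * A * A) - 3 • (A * (A * X * A))
      + 3 • ((A * X * A) * A) := by
    simp only [D, mul_sub, sub_mul, ← mul_assoc]
    abel
  rw [e, h3, h2]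
  simp only [D, smul_mul_assoc, mul_smul_comm, smul_sub]
  abel

end Algebra

section Growth

variable {n : ℕ}

lemma gram_smul_add_self (v w : Mink n) (a b : ℝ) :
    mink (a • v + b • w) (a • v + b • w)
      = a ^ 2 * mink v v + 2 * a * b * mink v w + b ^ 2 * mink w w := by
  simp only [mink_add, mink_add_left, mink_smul, mink_smul_left, mink_comm w v]
  ring

/-- If the Gram determinant is `-ζ²` with `ζ > 0`, then `ζ` is an eigenvalue of `v ∧ w`. -/
lemma hasEigenvalue_wedge {v w : Mink n} {ζ : ℝ} (hζ : 0 < ζ) (h : gram v w = -ζ ^ 2) :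
    Module.End.HasEigenvalue (wedge v w : Mink n →ₗ[ℝ] Mink n) ζ := by
  have hg : mink v v * mink w w - mink v w ^ 2 = -ζ ^ 2 := h
  -- on the span of `v, w`, `(v ∧ w)² = ζ²`, so that `(v ∧ w) u + ζ u` is an eigenvector if nonzero
  have key : ∀ u, wedge v w (wedge v w u) = ζ ^ 2 • u → wedge v w u + ζ • u ≠ 0 →
      Module.End.HasEigenvalue (wedge v w : Mink n →ₗ[ℝ] Mink n) ζ := fun u hu hne => by
    refine Module.End.hasEigenvalue_of_hasEigenvector (x := wedge v w u + ζ • u) ⟨?_, hne⟩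
    rw [Module.End.mem_eigenspace_iff]
    simp only [ContinuousLinearMap.coe_coe, map_add, map_smul, hu]
    module
  have hv : wedge v w (wedge v w v) = ζ ^ 2 • v := by
    rw [show ζ ^ 2 = -(mink v v * mink w w - mink v w ^ 2) by linarith]
    simp only [wedge_apply, mink_sub, mink_smul, mink_comm w v]
    module
  have hw : wedge v w (wedge v w w) = ζ ^ 2 • w := by
    rw [show ζ ^ 2 = -(mink v v * mink w w - mink v w ^ 2) by linarith]
    simp only [wedge_apply, mink_sub, mink_smul, mink_comm w v]
    module
  by_cases h1 : wedge v w v + ζ • v = 0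
  · refine key w hw fun h2 => ?_
    have e1 := congrArg (mink w) h1
    have e2 := congrArg (mink v) h2
    have z : ∀ u : Mink n, mink u 0 = 0 := fun u => by simpa using mink_smul u 0 0
    simp only [wedge_apply, mink_add, mink_sub, mink_smul, mink_comm w v, z] at e1 e2
    have e3 : ζ * (mink v w - ζ) = 0 := by linarith
    have e4 : ζ * (mink v w + ζ) = 0 := by linarith
    have e5 := (mul_eq_zero.1 e3).resolve_left hζ.ne'
    have e6 := (mul_eq_zero.1 e4).resolve_left hζ.ne'
    linarith
  · exact key v hv h1

/-- For a pure pole form of the first kind, the Gram determinant of `v, w` exceeds `-1`. -/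
lemma neg_one_lt_gram {v w : Mink n} (h : FirstKind v w) : -1 < gram v w := by
  rcases h with ⟨-, h⟩ | h | ⟨u, hu, hu0, h⟩
  · by_contra! hg
    have hs : 0 ≤ -gram v w := by linarith
    have h1 : 1 ≤ Real.sqrt (-gram v w) := Real.one_le_sqrt.2 (by linarith)
    refine (h _ (by linarith) (hasEigenvalue_wedge (by linarith) ?_)).not_ge h1
    rw [Real.sq_sqrt hs, neg_neg]
  · have hps : ∀ a b : ℝ,
        0 ≤ a ^ 2 * mink v v + 2 * a * b * mink v w + b ^ 2 * mink w w := fun a b => by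
      rw [← gram_smul_add_self]
      by_cases h0 : a • v + b • w = 0
      · rw [h0]; simp [mink]
      · exact (h _ (Submodule.mem_span_pair.2 ⟨a, b, rfl⟩) h0).le
    have h1 := hps (-mink v w) (mink v v)
    have h2 := hps (mink w w) (-mink v w)
    have h3 := hps 1 0
    have h4 := hps 0 1
    have h5 := hps 1 1
    have h6 := hps 1 (-1)
    have hgr : gram v w = mink v v * mink w w - mink v w ^ 2 := rfl
    have h7 : 0 ≤ mink v v * gram v w := by rw [hgr]; linarith
    have h8 : 0 ≤ mink w w * gram v w := by rw [hgr]; linarith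
    by_contra! hneg
    have h9 : mink v v ≤ 0 := by nlinarith
    have h10 : mink w w ≤ 0 := by nlinarith
    have h11 : mink v w = 0 := by linarith
    have : mink v v = 0 := by linarith
    rw [hgr, h11, this] at hneg
    norm_num at hneg
  · obtain ⟨a, b, rfl⟩ := Submodule.mem_span_pair.1 hu
    have h1 := h v (Submodule.mem_span_pair.2 ⟨1, 0, by simp⟩)
    have h2 := h w (Submodule.mem_span_pair.2 ⟨0, 1, by simp⟩)
    simp only [mink_add_left, mink_smul_left, mink_comm w v] at h1 h2
    have e1 : a * gram v w = 0 := by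
      unfold gram; linear_combination mink w w * h1 - mink v w * h2
    have e2 : b * gram v w = 0 := by
      unfold gram; linear_combination mink v v * h2 - mink v w * h1
    by_cases ha : a = 0
    · by_cases hb : b = 0
      · simp [ha, hb] at hu0
      · rw [(mul_eq_zero.1 e2).resolve_left hb]; norm_num
    · rw [(mul_eq_zero.1 e1).resolve_left ha]; norm_num

section Exp

variable {𝔸 : Type*} [NormedRing 𝔸] [NormedAlgebra ℝ 𝔸] [CompleteSpace 𝔸]

open NormedSpace

lemma exp_add_of_commute_real {A B : 𝔸} (h : Commute A B) : exp (A + B) = exp A * exp B := by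
  let _ : NormedAlgebra ℚ 𝔸 := NormedAlgebra.restrictScalars ℚ ℝ 𝔸
  exact exp_add_of_commute h

lemma exp_mul_exp_neg_real (A : 𝔸) : exp A * exp (-A) = 1 := by
  rw [← exp_add_of_commute_real (Commute.neg_right (Commute.refl A)), add_neg_cancel, exp_zero]

/-- The adjoint action of `exp (t A)` on an element `X` with `ad_A³ X = -c ad_A X`. -/
lemma exp_conj_eq {A X : 𝔸} {c : ℝ}
    (h3 : A * (A * (A * X - X * A) - (A * X - X * A) * A)
        - (A * (A * X - X * A) - (A * X - X * A) * A) * A = -c • (A * X - X * A))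
    {f₁ f₂ : ℝ → ℝ} (h₁ : ∀ t, HasDerivAt f₁ (1 - c * f₂ t) t) (h₂ : ∀ t, HasDerivAt f₂ (f₁ t) t)
    (h₁0 : f₁ 0 = 0) (h₂0 : f₂ 0 = 0) (t : ℝ) :
    exp (t • A) * X * exp (-(t • A))
      = X + f₁ t • (A * X - X * A)
        + f₂ t • (A * (A * X - X * A) - (A * X - X * A) * A) := by
  set Y := A * X - X * A with hY
  set Z := A * Y - Y * A with hZ
  set R : ℝ → 𝔸 := fun t => X + f₁ t • Y + f₂ t • Z with hR
  have hinv : ∀ t : ℝ, exp (t • A) * exp (-(t • A)) = 1 := fun t => exp_mul_exp_neg_real _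
  have hd1 : ∀ t : ℝ, HasDerivAt (fun t : ℝ => exp (t • A)) (A * exp (t • A)) t := fun t =>
    hasDerivAt_exp_smul_const' A t
  have hd2 : ∀ t : ℝ, HasDerivAt (fun t : ℝ => exp (-(t • A))) (exp (-(t • A)) * (-A)) t :=
    fun t => by
      simpa only [smul_neg] using hasDerivAt_exp_smul_const (-A) t
  have hdR : ∀ t, HasDerivAt R ((1 - c * f₂ t) • Y + f₁ t • Z) t := fun t => by
    have := (((h₁ t).smul_const Y).const_add X).add ((h₂ t).smul_const Z)
    exact this
  have hconst : ∀ t, exp (-(t • A)) * R t * exp (t • A) = X := by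
    have hd : ∀ t, HasDerivAt (fun t : ℝ => exp (-(t • A)) * R t * exp (t • A)) 0 t := fun t => by
      have := ((hd2 t).mul (hdR t)).mul (hd1 t)
      convert! this using 1
      have e : -(A * R t) + ((1 - c * f₂ t) • Y + f₁ t • Z) + R t * A = 0 := by
        have : A * R t - R t * A = Y + f₁ t • Z + f₂ t • (-c • Y) := by
          rw [← h3]
          simp only [hR, hZ, hY, mul_add, add_mul, mul_sub, sub_mul, mul_smul_comm,
            smul_mul_assoc, smul_sub]
          abel
        rw [show -(A * R t) + ((1 - c * f₂ t) • Y + f₁ t • Z) + R t * A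
          = -(A * R t - R t * A) + ((1 - c * f₂ t) • Y + f₁ t • Z) by abel, this]
        module
      simp only [Pi.mul_apply]
      calc (0 : 𝔸) = exp (-(t • A)) * (-(A * R t) + ((1 - c * f₂ t) • Y + f₁ t • Z)
            + R t * A) * exp (t • A) := by rw [e]; simp
        _ = _ := by simp only [mul_add, add_mul, mul_neg, neg_mul, mul_assoc]
    intro t
    have := is_const_of_deriv_eq_zero (fun t => (hd t).differentiableAt) (fun t => (hd t).deriv) t 0
    simp only [zero_smul, neg_zero, exp_zero, one_mul, mul_one, hR, h₁0, h₂0, add_zero] at this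
    exact this
  calc exp (t • A) * X * exp (-(t • A))
      = (exp (t • A) * exp (-(t • A))) * R t * (exp (t • A) * exp (-(t • A))) := by
        rw [← hconst t]; noncomm_ring
    _ = R t := by rw [hinv, one_mul, mul_one]

end Exp

/-- Scalar solutions of the equations in `exp_conj_eq`, with an exponential bound whose exponent is
less than one if `c > -1`. -/
lemma exists_conj_coeff {c : ℝ} (hc : -1 < c) :
    ∃ (f₁ f₂ : ℝ → ℝ) (κ K : ℝ), 0 < κ ∧ κ < 1 ∧ 0 ≤ K ∧
      (∀ t, HasDerivAt f₁ (1 - c * f₂ t) t) ∧ (∀ t, HasDerivAt f₂ (f₁ t) t) ∧ f₁ 0 = 0 ∧ f₂ 0 = 0 ∧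
      (∀ t, |f₁ t| ≤ K * Real.exp (κ * |t|)) ∧ ∀ t, |f₂ t| ≤ K * Real.exp (κ * |t|) := by
  rcases lt_trichotomy c 0 with h | rfl | h
  · obtain ⟨ζ, hζ, hζc⟩ : ∃ ζ : ℝ, 0 < ζ ∧ ζ ^ 2 = -c :=
      ⟨Real.sqrt (-c), Real.sqrt_pos.2 (by linarith), Real.sq_sqrt (by linarith)⟩
    have hζ1 : ζ < 1 := by nlinarith
    have hb : ∀ t, |Real.sinh (ζ * t)| ≤ Real.exp (ζ * |t|) ∧
        |Real.cosh (ζ * t) - 1| ≤ Real.exp (ζ * |t|) := fun t => by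
      have h1 : Real.exp (ζ * t) ≤ Real.exp (ζ * |t|) :=
        Real.exp_le_exp.2 (mul_le_mul_of_nonneg_left (le_abs_self t) hζ.le)
      have h2 : Real.exp (-(ζ * t)) ≤ Real.exp (ζ * |t|) :=
        Real.exp_le_exp.2 (by
          rw [← mul_neg]; exact mul_le_mul_of_nonneg_left (neg_le_abs t) hζ.le)
      have h3 := Real.exp_pos (ζ * t)
      have h4 := Real.exp_pos (-(ζ * t))
      have h5 := Real.one_le_cosh (ζ * t)
      rw [abs_le, abs_le, Real.sinh_eq]
      rw [Real.cosh_eq] at h5 ⊢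
      refine ⟨⟨?_, ?_⟩, ?_, ?_⟩ <;> linarith
    refine ⟨fun t => Real.sinh (ζ * t) / ζ, fun t => (Real.cosh (ζ * t) - 1) / ζ ^ 2, ζ,
      1 / ζ + 1 / ζ ^ 2, hζ, hζ1, by positivity, fun t => ?_, fun t => ?_, by simp, by simp,
      fun t => ?_, fun t => ?_⟩
    · have := ((hasDerivAt_id t).const_mul ζ).sinh.div_const ζ
      convert! this using 1
      simp only [id]
      field_simp
      rw [hζc]; ring
    · have := (((hasDerivAt_id t).const_mul ζ).cosh.sub_const 1).div_const (ζ ^ 2)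
      convert! this using 1
      simp only [id]
      field_simp
    · rw [abs_div, abs_of_pos hζ, div_eq_mul_one_div, mul_comm]
      refine mul_le_mul ?_ (hb t).1 (abs_nonneg _) (by positivity)
      have : 0 < 1 / ζ ^ 2 := by positivity
      linarith
    · rw [abs_div, abs_of_pos (by positivity : 0 < ζ ^ 2), div_eq_mul_one_div, mul_comm]
      refine mul_le_mul ?_ (hb t).2 (abs_nonneg _) (by positivity)
      have : 0 < 1 / ζ := by positivity
      linarith
  · refine ⟨fun t => t, fun t => t ^ 2 / 2, 1 / 2, 4, by norm_num, by norm_num, by norm_num,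
      fun t => by simpa using! hasDerivAt_id t, fun t => ?_, rfl, by norm_num, fun t => ?_,
      fun t => ?_⟩
    · have := (hasDerivAt_pow 2 t).div_const 2
      convert! this using 1
      norm_num
    · have := Real.add_one_le_exp (1 / 2 * |t|)
      linarith [abs_nonneg t]
    · have := Real.quadratic_le_exp_of_nonneg (x := 1 / 2 * |t|) (by positivity)
      rw [abs_of_nonneg (by positivity)]
      have := sq_abs t
      show t ^ 2 / 2 ≤ _
      nlinarith [abs_nonneg t]
  · obtain ⟨μ, hμ, hμc⟩ : ∃ μ : ℝ, 0 < μ ∧ μ ^ 2 = c :=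
      ⟨Real.sqrt c, Real.sqrt_pos.2 h, Real.sq_sqrt h.le⟩
    have he : ∀ t : ℝ, 1 ≤ Real.exp (1 / 2 * |t|) := fun t => Real.one_le_exp (by positivity)
    refine ⟨fun t => Real.sin (μ * t) / μ, fun t => (1 - Real.cos (μ * t)) / μ ^ 2, 1 / 2,
      1 / μ + 2 / μ ^ 2, by norm_num, by norm_num, by positivity, fun t => ?_, fun t => ?_,
      by simp, by simp, fun t => ?_, fun t => ?_⟩
    · have := ((hasDerivAt_id t).const_mul μ).sin.div_const μ
      convert! this using 1
      simp only [id]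
      field_simp
      rw [hμc]; ring
    · have := (((hasDerivAt_id t).const_mul μ).cos.const_sub 1).div_const (μ ^ 2)
      convert! this using 1
      simp only [id]
      field_simp
    · have h1 := Real.abs_sin_le_one (μ * t)
      have : |Real.sin (μ * t) / μ| ≤ 1 / μ + 2 / μ ^ 2 := by
        rw [abs_div, abs_of_pos hμ]
        have : |Real.sin (μ * t)| / μ ≤ 1 / μ := by gcongr
        have : 0 < 2 / μ ^ 2 := by positivity
        linarith
      exact this.trans (le_mul_of_one_le_right (by positivity) (he t))
    · have h1 : |1 - Real.cos (μ * t)| ≤ 2 := by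
        rw [abs_le]; constructor <;> linarith [Real.cos_le_one (μ * t), Real.neg_one_le_cos (μ * t)]
      have : |(1 - Real.cos (μ * t)) / μ ^ 2| ≤ 1 / μ + 2 / μ ^ 2 := by
        rw [abs_div, abs_of_pos (by positivity : 0 < μ ^ 2)]
        have : |1 - Real.cos (μ * t)| / μ ^ 2 ≤ 2 / μ ^ 2 := by gcongr
        have : 0 < 1 / μ := by positivity
        linarith
      exact this.trans (le_mul_of_one_le_right (by positivity) (he t))

open NormedSpace in
/-- The adjoint action of `exp (t v ∧ w)` on the Lie algebra grows with an exponent less than one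
if `v, w` are of the first kind. -/
lemma exists_exp_conj_le {v w : Mink n} (h : FirstKind v w) :
    ∃ κ K : ℝ, 0 < κ ∧ κ < 1 ∧ 0 ≤ K ∧ ∀ (t : ℝ) (X : MEnd n), madj X = -X →
      ‖exp (t • wedge v w) * X * exp (-(t • wedge v w))‖ ≤ K * Real.exp (κ * |t|) * ‖X‖ := by
  obtain ⟨f₁, f₂, κ, K, hκ, hκ1, hK, h1, h2, h10, h20, hf1, hf2⟩ :=
    exists_conj_coeff (neg_one_lt_gram h)
  set A := wedge v w
  refine ⟨κ, 1 + K * (2 * ‖A‖) + K * (2 * ‖A‖) ^ 2, hκ, hκ1, by positivity, fun t X hX => ?_⟩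
  rw [exp_conj_eq (ad_wedge_pow_three v w hX) h1 h2 h10 h20 t]
  have had : ∀ Y : MEnd n, ‖A * Y - Y * A‖ ≤ 2 * ‖A‖ * ‖Y‖ := fun Y => by
    refine (norm_sub_le _ _).trans ?_
    have := norm_mul_le A Y
    have := norm_mul_le Y A
    linarith
  have e1 : 1 ≤ Real.exp (κ * |t|) := Real.one_le_exp (by positivity)
  have hY := had X
  have hZ : ‖A * (A * X - X * A) - (A * X - X * A) * A‖ ≤ (2 * ‖A‖) ^ 2 * ‖X‖ :=
    (had _).trans (by
      rw [sq, mul_assoc (2 * ‖A‖)]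
      exact mul_le_mul_of_nonneg_left hY (by positivity))
  calc _ ≤ ‖X‖ + |f₁ t| * ‖A * X - X * A‖
        + |f₂ t| * ‖A * (A * X - X * A) - (A * X - X * A) * A‖ := by
        refine (norm_add₃_le).trans ?_
        rw [norm_smul, norm_smul, Real.norm_eq_abs, Real.norm_eq_abs]
    _ ≤ Real.exp (κ * |t|) * ‖X‖ + (K * Real.exp (κ * |t|)) * (2 * ‖A‖ * ‖X‖)
        + (K * Real.exp (κ * |t|)) * ((2 * ‖A‖) ^ 2 * ‖X‖) := by
        gcongr
        · exact le_mul_of_one_le_left (norm_nonneg _) e1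
        · exact hf1 t
        · exact hf2 t
    _ = _ := by ring

end Growth

/-! ### Flat connections on convex sets -/

section Frobenius

variable {𝔸 : Type*} [NormedRing 𝔸] [NormedAlgebra ℝ 𝔸]

/-- The iterated integrals of `M`, whose sum solves the linear equation `Y' = Y M`. -/
def iterInt (M : ℝ → 𝔸) : ℕ → ℝ → 𝔸
  | 0 => fun _ => 1
  | k + 1 => fun t => ∫ τ in (0 : ℝ)..t, iterInt M k τ * M τ

lemma continuous_iterInt {M : ℝ → 𝔸} (hM : Continuous M) (k : ℕ) : Continuous (iterInt M k) := by
  induction k with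
  | zero => exact continuous_const
  | succ k ih =>
    exact intervalIntegral.continuous_primitive (fun a b => (ih.mul hM).intervalIntegrable a b) 0

lemma norm_iterInt_le {M : ℝ → 𝔸} (hM : Continuous M) {C : ℝ} (hC : ∀ t, ‖M t‖ ≤ C) (k : ℕ)
    (t : ℝ) : ‖iterInt M k t‖ ≤ ‖(1 : 𝔸)‖ * (C ^ k * |t| ^ k / k.factorial) := by
  have hC0 : 0 ≤ C := (norm_nonneg _).trans (hC 0)
  induction k generalizing t with
  | zero => simp [iterInt]
  | succ k ih =>
    have hcont := continuous_iterInt hM k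
    calc ‖iterInt M (k + 1) t‖ ≤ ∫ τ in uIoc 0 t, ‖iterInt M k τ * M τ‖ :=
          intervalIntegral.norm_integral_le_integral_norm_uIoc
      _ ≤ ∫ τ in uIoc 0 t, (‖(1 : 𝔸)‖ * C ^ (k + 1) / k.factorial) * |τ - 0| ^ k := by
          refine MeasureTheory.setIntegral_mono ?_ ?_ fun τ => ?_
          · exact ((hcont.mul hM).norm.intervalIntegrable 0 t).def'
          · exact ((Continuous.intervalIntegrable (by fun_prop) 0 t).def')
          · calc ‖iterInt M k τ * M τ‖ ≤ ‖iterInt M k τ‖ * ‖M τ‖ := norm_mul_le _ _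
              _ ≤ (‖(1 : 𝔸)‖ * (C ^ k * |τ| ^ k / k.factorial)) * C := by
                  gcongr
                  · exact ih τ
                  · exact hC τ
              _ = _ := by rw [sub_zero]; ring
      _ = ‖(1 : 𝔸)‖ * (C ^ (k + 1) * |t| ^ (k + 1) / (k + 1).factorial) := by
          rw [MeasureTheory.integral_const_mul, integral_pow_abs_sub_uIoc, sub_zero,
            Nat.factorial_succ]
          push_cast
          field_simp

variable [CompleteSpace 𝔸]

/-- Linear equations `Y' = Y M` with bounded continuous coefficients have solutions on `[0, 1]`. -/
lemma exists_linear_ode {M : ℝ → 𝔸} (hM : Continuous M) {C : ℝ} (hC : ∀ t, ‖M t‖ ≤ C) :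
    ∃ Y : ℝ → 𝔸, Y 0 = 1 ∧ ∀ t ∈ Icc (0 : ℝ) 1, HasDerivAt Y (Y t * M t) t := by
  have hC0 : 0 ≤ C := (norm_nonneg _).trans (hC 0)
  set S : Set ℝ := Ioo (-1) 2
  have hS : ∀ t ∈ S, |t| ≤ 2 := fun t ht => abs_le.2 ⟨by linarith [ht.1], ht.2.le⟩
  let g' : ℕ → ℝ → 𝔸 := fun k t => match k with
    | 0 => 0
    | k + 1 => iterInt M k t * M t
  let u : ℕ → ℝ := fun k => match k with
    | 0 => 0
    | k + 1 => ‖(1 : 𝔸)‖ * ((C * 2) ^ k / k.factorial) * C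
  have hu : Summable u := by
    rw [← summable_nat_add_iff 1]
    exact ((Real.summable_pow_div_factorial (C * 2)).mul_left _).mul_right _
  have hg : ∀ k, ∀ t ∈ S, HasDerivAt (iterInt M k) (g' k t) t := fun k t _ => by
    cases k with
    | zero => exact hasDerivAt_const t 1
    | succ k =>
      have hc := (continuous_iterInt hM k).mul hM
      exact intervalIntegral.integral_hasDerivAt_right (hc.intervalIntegrable _ _)
        (hc.stronglyMeasurableAtFilter _ _) hc.continuousAt
  have hbound : ∀ k, ∀ t ∈ S, ‖iterInt M k t‖ ≤ ‖(1 : 𝔸)‖ * ((C * 2) ^ k / k.factorial) :=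
    fun k t ht => by
      refine (norm_iterInt_le hM hC k t).trans ?_
      rw [mul_pow]
      have := hS t ht
      gcongr
  have hg' : ∀ k, ∀ t ∈ S, ‖g' k t‖ ≤ u k := fun k t ht => by
    cases k with
    | zero => simp [g', u]
    | succ k =>
      refine (norm_mul_le _ _).trans ?_
      exact mul_le_mul (hbound k t ht) (hC t) (norm_nonneg _) (by positivity)
  have hsum : ∀ t ∈ S, Summable fun k => iterInt M k t := fun t ht =>
    Summable.of_norm_bounded ((Real.summable_pow_div_factorial (C * 2)).mul_left _)
      fun k => hbound k t ht
  have h0 : (0 : ℝ) ∈ S := ⟨by norm_num, by norm_num⟩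
  refine ⟨fun t => ∑' k, iterInt M k t, ?_, fun t ht => ?_⟩
  · simp only
    rw [tsum_eq_single 0]
    · rfl
    · intro k hk
      obtain ⟨k, rfl⟩ := Nat.exists_eq_succ_of_ne_zero hk
      simp [iterInt]
  · have htS : t ∈ S := ⟨by linarith [ht.1], by linarith [ht.2]⟩
    have := hasDerivAt_tsum_of_isPreconnected hu isOpen_Ioo isPreconnected_Ioo hg hg' h0
      (hsum 0 h0) htS
    convert! this using 1
    have hs : Summable fun k => g' k t := Summable.of_norm_bounded hu fun k => hg' k t htS
    rw [hs.tsum_eq_zero_add]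
    simp only [g', zero_add]
    rw [(hsum t htS).tsum_mul_right]

variable {X : Type*} [NormedAddCommGroup X] [NormedSpace ℝ X]

/-- **Flat connections on convex sets have primitives.** Let `θ` be a continuously differentiable
`𝔸`-valued one-form on a convex set, with derivative `Dθ` and `d + θ` flat in the interior. Then
there is `Γ` with `dΓ = Γ θ` and `Γ p = 1`.

`Γ q` is obtained by solving the equation along the segment from `p` to `q`. If `Y` and `Y'` are the
solutions along the segments `c` and `c'` that lead to `q` and to `q + k`, then flatness says that
`Y' t - Y t (1 + t θ_{c t} k)` solves the equation of `Y'` up to an error `o(k)`. -/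
theorem exists_primitive_of_flat {V : Set X} (hV : Convex ℝ V) {θ : X → X →L[ℝ] 𝔸}
    {Dθ : X → X →L[ℝ] X →L[ℝ] 𝔸} (hθ : ∀ q ∈ V, HasFDerivWithinAt θ (Dθ q) V q)
    (hD : ContinuousOn Dθ V) {p : X} (hp : p ∈ interior V)
    (hflat : ∀ Z ∈ interior V, ∀ h k,
      Dθ Z h k - Dθ Z k h + (θ Z h * θ Z k - θ Z k * θ Z h) = 0) :
    ∃ Γ : X → 𝔸, Γ p = 1 ∧
      ∀ q ∈ V, HasFDerivWithinAt Γ ((ContinuousLinearMap.mul ℝ 𝔸 (Γ q)).comp (θ q)) V q := by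
  have hpV : p ∈ V := interior_subset hp
  have hθc : ContinuousOn θ V := fun q hq => (hθ q hq).continuousWithinAt
  let c : X → ℝ → X := fun q t => p + t • (q - p)
  have hcV : ∀ q ∈ V, ∀ t ∈ Icc (0 : ℝ) 1, c q t ∈ V := fun q hq t ht =>
    hV.add_smul_sub_mem hpV hq ht
  have hccont : ∀ q, Continuous (c q) := fun q => by fun_prop
  -- the solutions along segments
  have hY : ∀ q ∈ V, ∃ Y : ℝ → 𝔸, Y 0 = 1 ∧
      ∀ t ∈ Icc (0 : ℝ) 1, HasDerivAt Y (Y t * θ (c q t) (q - p)) t := by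
    intro q hq
    have hcont : ContinuousOn (fun t => θ (c q t) (q - p)) (Icc 0 1) :=
      (hθc.comp (hccont q).continuousOn fun t ht => hcV q hq t ht).clm_apply continuousOn_const
    obtain ⟨C, hC⟩ := isCompact_Icc.exists_bound_of_continuousOn hcont
    set M : ℝ → 𝔸 := IccExtend (zero_le_one' ℝ) ((Icc (0 : ℝ) 1).domRestrict
      fun t => θ (c q t) (q - p))
    have hM : Continuous M := (continuousOn_iff_continuous_domRestrict.1 hcont).Icc_extend'
    obtain ⟨Y, hY0, hY⟩ := exists_linear_ode hM (C := C) fun t => by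
      exact hC _ (projIcc (0 : ℝ) 1 zero_le_one t).2
    refine ⟨Y, hY0, fun t ht => ?_⟩
    have := hY t ht
    rwa [show M t = θ (c q t) (q - p) from IccExtend_of_mem _ _ ht] at this
  choose! Y hY0 hY using hY
  have hYc : ∀ q ∈ V, ContinuousOn (Y q) (Icc 0 1) := fun q hq t ht =>
    (hY q hq t ht).continuousAt.continuousWithinAt
  refine ⟨fun q => Y q 1, ?_, fun q hq => ?_⟩
  · have := constant_of_has_deriv_right_zero (hYc p hpV) (fun t ht => by
      simpa using (hY p hpV t (Ico_subset_Icc_self ht)).hasDerivWithinAt) 1 (by simp)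
    exact this.trans (hY0 p hpV)
  -- bounds along the segment to `q`
  obtain ⟨b, hb⟩ := isCompact_Icc.exists_bound_of_continuousOn (hYc q hq)
  obtain ⟨T, hT⟩ := isCompact_Icc.exists_bound_of_continuousOn
    (hθc.comp (hccont q).continuousOn fun t ht => hcV q hq t ht)
  have hDc : ContinuousOn (fun t => Dθ (c q t)) (Icc 0 1) :=
    hD.comp (hccont q).continuousOn fun t ht => hcV q hq t ht
  obtain ⟨B, hB⟩ := isCompact_Icc.exists_bound_of_continuousOn
    (E := X →L[ℝ] X →L[ℝ] 𝔸) (f := fun t => Dθ (c q t)) hDc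
  have h01 : (0 : ℝ) ∈ Icc (0 : ℝ) 1 := by simp
  have hb0 : 0 ≤ b := (norm_nonneg _).trans (hb 0 h01)
  have hT0 : 0 ≤ T := (norm_nonneg _).trans (hT 0 h01)
  have hB0 : 0 ≤ B := (norm_nonneg _).trans (hB 0 h01)
  simp only [Function.comp_apply] at hT hB
  set h := q - p with hh
  set H := ‖h‖
  have hH0 : 0 ≤ H := norm_nonneg h
  -- `C₀` and `K` are the constants in the bounds of the error term and of `θ` on the segment to
  -- `q + k`, and `E` is the factor in Grönwall's inequality
  set C₀ := b * (H + (B + 1) + T * ((B + 1) * H + (T + B + 1)))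
  have hC₀ : 0 ≤ C₀ := by positivity
  set K := (T + B + 1) * (H + 1)
  have hK : 0 < K := by positivity
  set E := (Real.exp K - 1) / K
  have hE : 0 ≤ E := div_nonneg (by linarith [Real.add_one_le_exp K]) hK.le
  refine HasFDerivAtFilter.of_isLittleO (Asymptotics.isLittleO_iff.2 fun ε hε => ?_)
  rw [prod_pure, eventually_map]
  -- the accuracy needed for the Taylor expansion of `θ`
  obtain ⟨η, hη, hη1, hηε⟩ : ∃ η : ℝ, 0 < η ∧ η ≤ 1 ∧ C₀ * η * E ≤ ε := by
    refine ⟨min 1 (ε / (C₀ * E + 1)), by positivity, min_le_left _ _, ?_⟩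
    calc C₀ * min 1 (ε / (C₀ * E + 1)) * E = (C₀ * E) * min 1 (ε / (C₀ * E + 1)) := by ring
      _ ≤ (C₀ * E + 1) * (ε / (C₀ * E + 1)) := by
          gcongr
          · linarith
          · exact min_le_right _ _
      _ = ε := by field_simp
  have hDunif : ∃ δ > 0, ∀ q' ∈ Metric.ball q δ ∩ V, ∀ t ∈ Icc (0 : ℝ) 1,
      ‖Dθ (c q' t) - Dθ (c q t)‖ ≤ η := by
    have hcont : ContinuousOn (Function.uncurry fun q' t => Dθ (c q' t)) (V ×ˢ Icc (0 : ℝ) 1) :=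
      hD.comp (f := fun z : X × ℝ => c z.1 z.2)
        (Continuous.continuousOn (by fun_prop)) fun z hz => hcV z.1 hz.1 z.2 hz.2
    obtain ⟨v, hv, hvu⟩ := isCompact_Icc.mem_uniformity_of_prod
      (E := X →L[ℝ] X →L[ℝ] 𝔸) (f := fun q' t => Dθ (c q' t)) hcont hq
      (Metric.dist_mem_uniformity hη)
    obtain ⟨δ, hδ, hδv⟩ := Metric.mem_nhdsWithin_iff.1 hv
    refine ⟨δ, hδ, fun q' hq' t ht => ?_⟩
    exact (dist_eq_norm (Dθ (c q' t)) (Dθ (c q t))).symm.le.trans (hvu q' (hδv hq') t ht).le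
  obtain ⟨δ, hδ, hDδ⟩ := hDunif
  have hTaylor : ∀ q' ∈ Metric.ball q δ ∩ V, ∀ t ∈ Icc (0 : ℝ) 1,
      ‖θ (c q' t) - θ (c q t) - t • Dθ (c q t) (q' - q)‖ ≤ η * ‖q' - q‖ := by
    intro q' hq' t ht
    have hd : ∀ r ∈ Metric.ball q δ ∩ V, HasFDerivWithinAt (fun r => θ (c r t))
        ((Dθ (c r t)).comp (t • ContinuousLinearMap.id ℝ X)) (Metric.ball q δ ∩ V) r := by
      intro r hr
      have hc : HasFDerivWithinAt (fun r => c r t) (t • ContinuousLinearMap.id ℝ X)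
          (Metric.ball q δ ∩ V) r :=
        ((((hasFDerivAt_id r).sub_const p).const_smul t).const_add p).hasFDerivWithinAt
      exact (hθ (c r t) (hcV r hr.2 t ht)).comp r hc fun z hz => hcV z hz.2 t ht
    have := ((convex_ball q δ).inter hV).norm_image_sub_le_of_norm_hasFDerivWithin_le'
      (φ := (Dθ (c q t)).comp (t • ContinuousLinearMap.id ℝ X)) (C := η) hd (fun r hr => by
        rw [← ContinuousLinearMap.sub_comp]
        refine (ContinuousLinearMap.opNorm_comp_le _ _).trans ?_
        have h1 : ‖t • ContinuousLinearMap.id ℝ X‖ ≤ 1 := by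
          rw [norm_smul, Real.norm_eq_abs, abs_of_nonneg ht.1]
          exact mul_le_one₀ ht.2 (norm_nonneg _) ContinuousLinearMap.norm_id_le
        calc _ ≤ η * 1 := mul_le_mul (hDδ r hr t ht) h1 (norm_nonneg _) hη.le
          _ = η := mul_one η) ⟨Metric.mem_ball_self hδ, hq⟩ hq'
    simpa using this
  have hnear : Metric.ball q (min δ η) ∩ V ∈ 𝓝[V] q :=
    inter_comm V _ ▸ inter_mem_nhdsWithin V (Metric.ball_mem_nhds q (lt_min hδ hη))
  filter_upwards [hnear] with q' hq'
  have hq'V : q' ∈ V := hq'.2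
  have hq'δ : q' ∈ Metric.ball q δ ∩ V :=
    ⟨Metric.ball_subset_ball (min_le_left _ _) hq'.1, hq'.2⟩
  set k := q' - q with hk
  have hkη : ‖k‖ ≤ η := by
    have := hq'.1
    rw [Metric.mem_ball, dist_eq_norm] at this
    exact (this.le.trans (min_le_right _ _))
  have hk1 : ‖k‖ ≤ 1 := hkη.trans hη1
  have hhk : q' - p = h + k := by rw [hh, hk]; abel
  have hdiff : ∀ t ∈ Icc (0 : ℝ) 1, ‖θ (c q' t) - θ (c q t)‖ ≤ (B + 1) * ‖k‖ := fun t ht => by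
    have e : θ (c q' t) - θ (c q t)
        = (θ (c q' t) - θ (c q t) - t • Dθ (c q t) k) + t • Dθ (c q t) k := by abel
    rw [e]
    refine (norm_add_le _ _).trans ?_
    have h1 := hTaylor q' hq'δ t ht
    have h2 : ‖t • Dθ (c q t) k‖ ≤ B * ‖k‖ := by
      rw [norm_smul, Real.norm_eq_abs, abs_of_nonneg ht.1]
      refine (mul_le_of_le_one_left (norm_nonneg _) ht.2).trans ?_
      exact (Dθ (c q t)).le_of_opNorm_le (hB t ht) k
    have h3 : η * ‖k‖ ≤ 1 * ‖k‖ := by gcongr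
    linarith
  have hθ' : ∀ t ∈ Icc (0 : ℝ) 1, ‖θ (c q' t)‖ ≤ T + B + 1 := fun t ht => by
    have h1 := hdiff t ht
    have h2 := hT t ht
    have h3 : ‖θ (c q' t)‖ ≤ ‖θ (c q' t) - θ (c q t)‖ + ‖θ (c q t)‖ := by
      simpa using norm_add_le (θ (c q' t) - θ (c q t)) (θ (c q t))
    have h4 : (B + 1) * ‖k‖ ≤ (B + 1) * 1 := by gcongr
    linarith
  set X' : ℝ → 𝔸 := fun t => Y q' t - Y q t * (1 + t • θ (c q t) k) with hX'
  -- the error term in the equation for `X'`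
  set R : ℝ → 𝔸 := fun t => Y q t * ((θ (c q' t) - θ (c q t) - t • Dθ (c q t) k) h
      + (θ (c q' t) - θ (c q t)) k
      + t • (θ (c q t) k * ((θ (c q' t) - θ (c q t)) h + θ (c q' t) k))) with hR
  have hRle : ∀ t ∈ Icc (0 : ℝ) 1, ‖R t‖ ≤ C₀ * η * ‖k‖ := by
    intro t ht
    have h1 : ‖(θ (c q' t) - θ (c q t) - t • Dθ (c q t) k) h‖ ≤ η * ‖k‖ * H :=
      ContinuousLinearMap.le_of_opNorm_le _ (hTaylor q' hq'δ t ht) h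
    have h2 : ‖(θ (c q' t) - θ (c q t)) k‖ ≤ (B + 1) * ‖k‖ * η :=
      (ContinuousLinearMap.le_of_opNorm_le _ (hdiff t ht) k).trans (by gcongr)
    have h3 : ‖(θ (c q' t) - θ (c q t)) h‖ ≤ (B + 1) * η * H :=
      (ContinuousLinearMap.le_of_opNorm_le _ (hdiff t ht) h).trans (by gcongr)
    have h4 : ‖θ (c q' t) k‖ ≤ (T + B + 1) * η :=
      (ContinuousLinearMap.le_of_opNorm_le _ (hθ' t ht) k).trans (by gcongr)
    have h5 : ‖θ (c q t) k‖ ≤ T * ‖k‖ := ContinuousLinearMap.le_of_opNorm_le _ (hT t ht) k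
    have h6 : ‖t • (θ (c q t) k * ((θ (c q' t) - θ (c q t)) h + θ (c q' t) k))‖
        ≤ T * ‖k‖ * ((B + 1) * η * H + (T + B + 1) * η) := by
      rw [norm_smul, Real.norm_eq_abs, abs_of_nonneg ht.1]
      refine (mul_le_of_le_one_left (norm_nonneg _) ht.2).trans ((norm_mul_le _ _).trans ?_)
      gcongr
      exact (norm_add_le _ _).trans (add_le_add h3 h4)
    calc ‖R t‖ ≤ b * (η * ‖k‖ * H + (B + 1) * ‖k‖ * η
          + T * ‖k‖ * ((B + 1) * η * H + (T + B + 1) * η)) := by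
          refine (norm_mul_le _ _).trans ?_
          gcongr
          · exact hb t ht
          · exact (norm_add₃_le).trans (by gcongr)
      _ = C₀ * η * ‖k‖ := by simp only [C₀]; ring
  have hXder : ∀ t ∈ Ico (0 : ℝ) 1,
      HasDerivWithinAt X' (X' t * θ (c q' t) (h + k) + R t) (Ici t) t := by
    intro t ht
    have htI := Ico_subset_Icc_self ht
    have hcd : HasDerivAt (c q) h t := by
      have := ((hasDerivAt_id t).smul_const (q - p)).const_add p
      simpa [c, hh] using! this
    have hθd : HasDerivWithinAt (fun t => θ (c q t)) (Dθ (c q t) h) (Icc 0 1) t :=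
      (hθ (c q t) (hcV q hq t htI)).comp_hasDerivWithinAt t hcd.hasDerivWithinAt
        fun τ hτ => hcV q hq τ hτ
    have hθd' : HasDerivWithinAt (fun t => θ (c q t) k) (Dθ (c q t) h k) (Ici t) t :=
      ((ContinuousLinearMap.apply ℝ 𝔸 k).hasFDerivAt.comp_hasDerivWithinAt t
        hθd).mono_of_mem_nhdsWithin (Icc_mem_nhdsGE_of_mem ht)
    have h1 := (hY q hq t htI).hasDerivWithinAt (s := Ici t)
    have h2 := (hY q' hq'V t htI).hasDerivWithinAt (s := Ici t)
    have h3 : HasDerivWithinAt (fun t => 1 + t • θ (c q t) k)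
        (t • Dθ (c q t) h k + (1 : ℝ) • θ (c q t) k) (Ici t) t :=
      ((hasDerivWithinAt_id t (Ici t)).smul hθd').const_add 1
    have h4 := h2.sub (h1.mul h3)
    refine h4.congr_deriv ?_
    have hfl := hflat (c q t) (by
      have := hV.combo_interior_self_mem_interior hp hq (a := 1 - t) (b := t)
        (by linarith [ht.2]) ht.1 (by ring)
      convert this using 1
      simp only [c]; module) h k
    have hfl' : Dθ (c q t) h k = Dθ (c q t) k h
        - (θ (c q t) h * θ (c q t) k - θ (c q t) k * θ (c q t) h) := by
      rw [← sub_eq_zero, ← hfl]; abel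
    rw [hhk, ← hh, hfl']
    simp only [hX', hR, map_add, sub_apply, smul_apply, one_smul, mul_add, mul_sub, sub_mul,
      add_mul, mul_one, smul_add, smul_sub, mul_smul_comm, smul_mul_assoc, ← mul_assoc]
    abel
  have hXc : ContinuousOn X' (Icc 0 1) := by
    have hθk : ContinuousOn (fun t => θ (c q t) k) (Icc 0 1) :=
      (hθc.comp (hccont q).continuousOn fun t ht => hcV q hq t ht).clm_apply continuousOn_const
    exact (hYc q' hq'V).sub ((hYc q hq).mul
      (continuousOn_const.add (continuousOn_id.smul hθk)))
  have hgr := norm_le_gronwallBound_of_norm_deriv_right_le (K := K) (ε := C₀ * η * ‖k‖) (δ := 0)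
    hXc hXder (by simp [hX', hY0 q hq, hY0 q' hq'V]) (fun t ht => by
      have htI := Ico_subset_Icc_self ht
      refine (norm_add_le _ _).trans (add_le_add ?_ (hRle t htI))
      rw [mul_comm K]
      refine (norm_mul_le _ _).trans (mul_le_mul_of_nonneg_left ?_ (norm_nonneg _))
      refine (ContinuousLinearMap.le_of_opNorm_le _ (hθ' t htI) _).trans ?_
      simp only [K]
      gcongr
      exact (norm_add_le _ _).trans (by gcongr)) 1 (by simp)
  rw [gronwallBound_of_K_ne_0 hK.ne'] at hgr
  have hc1 : c q 1 = q := by simp [c]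
  calc _ = ‖X' 1‖ := by
        congr 1
        simp [hX', hc1, mul_add, hk, sub_sub]
    _ ≤ (C₀ * η * E) * ‖k‖ := by
        refine hgr.trans (le_of_eq ?_)
        simp only [E, sub_zero, mul_one, zero_mul, zero_add]
        ring
    _ ≤ ε * ‖k‖ := by gcongr

end Frobenius

/-! ### Logarithms on half-planes -/

section Log

/-- A left half-plane. -/
def leftHalf (c : ℝ) : Set ℂ := {u | u.re ≤ c}

lemma mem_leftHalf {c : ℝ} {u : ℂ} : u ∈ leftHalf c ↔ u.re ≤ c := Iff.rfl

lemma convex_leftHalf (c : ℝ) : Convex ℝ (leftHalf c) := convex_halfSpace_re_le c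

lemma interior_leftHalf (c : ℝ) : interior (leftHalf c) = {u : ℂ | u.re < c} :=
  Complex.interior_setOfPred_re_le c

lemma uniqueDiffOn_leftHalf (c : ℝ) : UniqueDiffOn ℝ (leftHalf c) := by
  refine uniqueDiffOn_convex (convex_leftHalf c) ⟨((c - 1 : ℝ) : ℂ), ?_⟩
  rw [interior_leftHalf]
  show ((c - 1 : ℝ) : ℂ).re < c
  rw [Complex.ofReal_re]; linarith

/-- Nowhere vanishing continuous functions on a half-plane have continuous logarithms. -/
lemma exists_log {c : ℝ} {G : ℂ → ℂ} (hG : ContinuousOn G (leftHalf c))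
    (h0 : ∀ u ∈ leftHalf c, G u ≠ 0) :
    ∃ ℓ : ℂ → ℂ, ContinuousOn ℓ (leftHalf c) ∧ ∀ u ∈ leftHalf c, Complex.exp (ℓ u) = G u := by
  -- extend `G` to the plane by a retraction onto the half-plane
  let ρ : ℂ → ℂ := fun u => (min u.re c : ℝ) + u.im * Complex.I
  have hρ : Continuous ρ := by fun_prop
  have hρV : ∀ u, ρ u ∈ leftHalf c := fun u => by simp [ρ, mem_leftHalf]
  have hρid : ∀ u ∈ leftHalf c, ρ u = u := fun u hu => by
    simp only [ρ, min_eq_left (mem_leftHalf.1 hu), Complex.re_add_im]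
  have hGρ : Continuous (G ∘ ρ) := hG.comp_continuous hρ hρV
  obtain ⟨ℓ, ⟨-, hℓ⟩, -⟩ := Complex.isCoveringMapOn_exp.existsUnique_continuousMap_lifts
    (⟨G ∘ ρ, hGρ⟩ : C(ℂ, ℂ)) (a₀ := 0) (Complex.exp_log (h0 _ (hρV 0)))
    (fun u => h0 _ (hρV u))
  refine ⟨ℓ, ℓ.continuous.continuousOn, fun u hu => ?_⟩
  have := congrFun hℓ u
  simp only [Function.comp_apply, ContinuousMap.coe_mk, hρid u hu] at this
  exact this

/-- Continuous logarithms of differentiable functions are differentiable. -/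
lemma hasFDerivWithinAt_of_exp {E : Type*} [NormedAddCommGroup E] [NormedSpace ℝ E] {S : Set E}
    {ℓ G : E → ℂ} {G' : E →L[ℝ] ℂ} {x : E} (hℓ : ContinuousWithinAt ℓ S x) (hx : x ∈ S)
    (hexp : ∀ u ∈ S, Complex.exp (ℓ u) = G u) (hG : HasFDerivWithinAt G G' S x) :
    HasFDerivWithinAt ℓ ((G x)⁻¹ • G') S x := by
  have hx0 : G x ≠ 0 := by rw [← hexp x hx]; exact Complex.exp_ne_zero _
  have h1 : HasFDerivWithinAt (fun u => Complex.log (G u / G x)) ((G x)⁻¹ • G') S x := by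
    have h2 : HasFDerivWithinAt (fun u => G u / G x) ((G x)⁻¹ • G') S x := by
      have := hG.mul_const (G x)⁻¹
      simpa only [div_eq_mul_inv] using! this
    have h3 : HasDerivAt Complex.log 1 (G x / G x) := by
      rw [div_self hx0]
      simpa using Complex.hasDerivAt_log (Complex.one_mem_slitPlane)
    have h4 := (h3.hasFDerivAt.restrictScalars ℝ).comp_hasFDerivWithinAt x h2
    convert! h4 using 1
    ext y
    simp
  refine (h1.const_add (ℓ x)).congr_of_eventuallyEq ?_ (by simp [div_self hx0])
  have hev : ∀ᶠ u in 𝓝[S] x, ‖ℓ u - ℓ x‖ < Real.pi := by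
    have := Metric.tendsto_nhds.1 hℓ Real.pi Real.pi_pos
    simpa only [dist_eq_norm] using this
  filter_upwards [hev, self_mem_nhdsWithin] with u hu huS
  have him := abs_le.1 (Complex.abs_im_le_norm (ℓ u - ℓ x))
  rw [← hexp u huS, ← hexp x hx, ← Complex.exp_sub, Complex.log_exp (by linarith) (by linarith)]
  ring

/-- Two continuous logarithms of the same function on a preconnected set differ by a constant. -/
lemma eq_add_of_exp_eq {E : Type*} [TopologicalSpace E] {S : Set E} (hS : IsPreconnected S)
    {ℓ₁ ℓ₂ : E → ℂ} (h1 : ContinuousOn ℓ₁ S) (h2 : ContinuousOn ℓ₂ S)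
    (hexp : ∀ u ∈ S, Complex.exp (ℓ₁ u) = Complex.exp (ℓ₂ u)) :
    ∃ k : ℤ, ∀ u ∈ S, ℓ₁ u = ℓ₂ u + k * (2 * Real.pi * Complex.I) := by
  rcases S.eq_empty_or_nonempty with rfl | ⟨a, ha⟩
  · exact ⟨0, fun u hu => hu.elim⟩
  have h3 : ∀ u ∈ S, ∃ k : ℤ, ℓ₁ u = ℓ₂ u + k * (2 * Real.pi * Complex.I) := fun u hu =>
    Complex.exp_eq_exp_iff_exists_int.1 (hexp u hu)
  set d : E → ℝ := fun u => (ℓ₁ u - ℓ₂ u).im / (2 * Real.pi)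
  have hd : ∀ u (k : ℤ), ℓ₁ u = ℓ₂ u + k * (2 * Real.pi * Complex.I) → d u = k := fun u k h => by
    have : ((k : ℂ) * (2 * Real.pi * Complex.I)).im = k * (2 * Real.pi) := by simp
    simp only [d, h, add_sub_cancel_left, this]
    field_simp
  obtain ⟨k, hk⟩ := h3 a ha
  refine ⟨k, fun u hu => ?_⟩
  obtain ⟨k', hk'⟩ := h3 u hu
  have hc : ContinuousOn d S :=
    (Complex.continuous_im.comp_continuousOn (h1.sub h2)).div_const _
  have hT : IsDiscrete (range ((↑) : ℤ → ℝ)) :=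
    ⟨Int.isClosedEmbedding_coe_real.isEmbedding.toHomeomorph.symm.isEmbedding.discreteTopology⟩
  have := hS.constant_of_mapsTo hT hc (fun z hz => by
    obtain ⟨j, hj⟩ := h3 z hz
    exact ⟨j, (hd z j hj).symm⟩) ha hu
  rw [hd a k hk, hd u k' hk'] at this
  rw [hk', Int.cast_injective this]

end Log

/-! ### Parametrization of the universal cover by a half-plane -/

section Cover

lemma comp_eq_id_symm {A B : ℂ →L[ℝ] ℂ} (h : A.comp B = ContinuousLinearMap.id ℝ ℂ) :
    B.comp A = ContinuousLinearMap.id ℝ ℂ := by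
  have h1 : (A : ℂ →ₗ[ℝ] ℂ) * (B : ℂ →ₗ[ℝ] ℂ) = 1 := by
    apply LinearMap.ext
    intro x
    exact congrArg (fun T : ℂ →L[ℝ] ℂ => T x) h
  have h2 := mul_eq_one_comm.1 h1
  ext1 y
  exact congrArg (fun T : ℂ →ₗ[ℝ] ℂ => T y) h2

lemma range_eq_top_of_comp_eq_id {A B : ℂ →L[ℝ] ℂ} (h : A.comp B = ContinuousLinearMap.id ℝ ℂ) :
    A.range = ⊤ := by
  refine LinearMap.range_eq_top.2 fun x => ⟨B x, ?_⟩
  exact congrArg (fun T : ℂ →L[ℝ] ℂ => T x) h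

lemma uniqueDiffOn_closedBall : UniqueDiffOn ℝ (Metric.closedBall (0 : ℂ) 1) := by
  refine uniqueDiffOn_convex (convex_closedBall 0 1) ⟨0, ?_⟩
  rw [interior_closedBall 0 one_ne_zero]
  exact Metric.mem_ball_self one_pos

/-- The disc automorphism that maps `0` to `c` maps the closed disc to itself. -/
lemma moebius_mapsTo {c : ℂ} (hc : ‖c‖ < 1) {Z : ℂ} (hZ : Z ∈ Metric.closedBall (0 : ℂ) 1) :
    1 + (starRingEnd ℂ) c * Z ≠ 0 ∧
      (Z + c) / (1 + (starRingEnd ℂ) c * Z) ∈ Metric.closedBall (0 : ℂ) 1 := by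
  rw [mem_closedBall_zero_iff] at hZ ⊢
  have h1 : ‖(starRingEnd ℂ) c * Z‖ < 1 := by
    rw [norm_mul, RCLike.norm_conj]
    nlinarith [norm_nonneg c, norm_nonneg Z]
  have h0 : 1 + (starRingEnd ℂ) c * Z ≠ 0 := fun h => by
    have : (starRingEnd ℂ) c * Z = -1 := by linear_combination h
    rw [this, norm_neg, norm_one] at h1
    exact lt_irrefl _ h1
  refine ⟨h0, ?_⟩
  rw [norm_div, div_le_one (norm_pos_iff.2 h0), ← abs_of_nonneg (norm_nonneg (Z + c)),
    ← abs_of_nonneg (norm_nonneg (1 + _)), ← sq_le_sq, Complex.sq_norm, Complex.sq_norm]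
  have hZ2 : Z.re * Z.re + Z.im * Z.im ≤ 1 := by
    have := Complex.sq_norm Z
    rw [Complex.normSq_apply] at this
    nlinarith [norm_nonneg Z]
  have hc2 : c.re * c.re + c.im * c.im ≤ 1 := by
    have := Complex.sq_norm c
    rw [Complex.normSq_apply] at this
    nlinarith [norm_nonneg c]
  rw [Complex.normSq_apply, Complex.normSq_apply]
  simp only [Complex.add_re, Complex.add_im, Complex.mul_re, Complex.mul_im, Complex.one_re,
    Complex.one_im, Complex.conj_re, Complex.conj_im]
  nlinarith [mul_nonneg (sub_nonneg.2 hZ2) (sub_nonneg.2 hc2)]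

/-- A closed disc with an interior point `s` has a diffeomorphism with the closed unit disc that
maps `s` to `0`. -/
lemma IsClosedDisc.exists_centered {Δ : Set ℂ} (hΔ : IsClosedDisc Δ) {s : ℂ}
    (hs : s ∈ interior Δ) :
    ∃ F G : ℂ → ℂ, ContDiffOn ℝ ∞ F (Metric.closedBall 0 1) ∧ ContDiffOn ℝ ∞ G Δ ∧
      MapsTo F (Metric.closedBall 0 1) Δ ∧ MapsTo G Δ (Metric.closedBall 0 1) ∧
      LeftInvOn G F (Metric.closedBall 0 1) ∧ RightInvOn G F Δ ∧ F 0 = s := by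
  obtain ⟨f, g, hf, hg, hfm, hgm, hl, hr⟩ := hΔ
  have hsΔ : s ∈ Δ := interior_subset hs
  have hΔs : Δ ∈ 𝓝 s := mem_interior_iff_mem_nhds.1 hs
  set c := g s with hc
  have hc1 : ‖c‖ < 1 := by
    have hgs : HasStrictFDerivAt g (fderiv ℝ g s) s :=
      (hg.contDiffAt hΔs).hasStrictFDerivAt (by simp)
    have hfc : HasFDerivWithinAt f (fderivWithin ℝ f (Metric.closedBall 0 1) c)
        (Metric.closedBall 0 1) c :=
      ((hf c (hgm hsΔ)).differentiableWithinAt (by simp)).hasFDerivWithinAt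
    have hcomp : HasFDerivAt (f ∘ g)
        ((fderivWithin ℝ f (Metric.closedBall 0 1) c).comp (fderiv ℝ g s)) s :=
      (hfc.comp s hgs.hasFDerivAt.hasFDerivWithinAt hgm).hasFDerivAt hΔs
    have hid : HasFDerivAt (f ∘ g) (ContinuousLinearMap.id ℝ ℂ) s :=
      (hasFDerivAt_id s).congr_of_eventuallyEq (by
        filter_upwards [hΔs] with Z hZ using hr hZ)
    have hsurj := range_eq_top_of_comp_eq_id (comp_eq_id_symm (hcomp.unique hid))
    have hmap := hgs.map_nhds_eq_of_surj hsurj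
    have : Metric.closedBall (0 : ℂ) 1 ∈ 𝓝 c := by
      rw [hc, ← hmap]
      exact mem_map.2 (mem_of_superset hΔs hgm)
    have := mem_interior_iff_mem_nhds.2 this
    rwa [interior_closedBall 0 one_ne_zero, mem_ball_zero_iff] at this
  set m : ℂ → ℂ → ℂ := fun c Z => (Z + c) / (1 + (starRingEnd ℂ) c * Z)
  have hm : ∀ c : ℂ, ‖c‖ < 1 → MapsTo (m c) (Metric.closedBall 0 1) (Metric.closedBall 0 1) :=
    fun c hc Z hZ => (moebius_mapsTo hc hZ).2
  have hmsmooth : ∀ c : ℂ, ‖c‖ < 1 → ContDiffOn ℝ ∞ (m c) (Metric.closedBall 0 1) :=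
    fun c hc Z hZ => by
      have h := (moebius_mapsTo hc hZ).1
      have h1 : ContDiffAt ℂ ∞ (m c) Z := by
        refine ContDiffAt.div (by fun_prop) (by fun_prop) h
      exact (h1.restrict_scalars ℝ).contDiffWithinAt
  have hminv : ∀ c : ℂ, ‖c‖ < 1 → ∀ Z ∈ Metric.closedBall (0 : ℂ) 1, m (-c) (m c Z) = Z := by
    intro c hc Z hZ
    have h := (moebius_mapsTo hc hZ).1
    have h1 := (moebius_mapsTo (c := -c) (by simpa using hc) (hm c hc hZ)).1
    simp only [m] at h1 ⊢
    rw [div_eq_iff h1, map_neg]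
    generalize (starRingEnd ℂ) c = d at h ⊢
    apply mul_right_cancel₀ h
    rw [add_mul, mul_assoc, add_mul, mul_assoc, div_mul_cancel₀ _ h]
    ring
  have hc1' : ‖-c‖ < 1 := by simpa using hc1
  refine ⟨f ∘ m c, m (-c) ∘ g, hf.comp (hmsmooth c hc1) (hm c hc1),
    (hmsmooth _ hc1').comp hg hgm, hfm.comp (hm c hc1), (hm _ hc1').comp hgm,
    fun Z hZ => ?_, fun Z hZ => ?_, ?_⟩
  · simp only [Function.comp_apply]
    rw [hl (hm c hc1 hZ), hminv c hc1 Z hZ]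
  · simp only [Function.comp_apply]
    have := hminv (-c) hc1' (g Z) (hgm hZ)
    rw [neg_neg] at this
    rw [this, hr hZ]
  · have : m c 0 = c := by simp [m]
    rw [Function.comp_apply, this, hc, hr hsΔ]

/-- A parametrization of the universal cover of `Δ \ {s}` by the half-plane `re u ≤ 0`: the map `E`
to `Δ \ {s}`, its lift `Φ` to the universal cover, and the inverse `Ψ` of `Φ`. -/
structure CoverParam (Δ : Set ℂ) (s : ℂ) where
  /-- the map to `Δ \ {s}` -/
  E : ℂ → ℂ
  /-- the map to the universal cover -/
  Φ : ℂ → ℂ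
  /-- the inverse of `Φ` -/
  Ψ : ℂ → ℂ
  smooth : ContDiffOn ℝ ∞ E (leftHalf 0)
  mapsTo_E : MapsTo E (leftHalf 0) (Δ \ {s})
  mapsTo_interior : MapsTo E (interior (leftHalf 0)) (interior (Δ \ {s}))
  mapsTo_Φ : MapsTo Φ (leftHalf 0) (cover Δ s)
  mapsTo_Ψ : MapsTo Ψ (cover Δ s) (leftHalf 0)
  continuousOn_Ψ : ContinuousOn Ψ (cover Δ s)
  differentiable_Φ : ∀ u ∈ leftHalf 0, DifferentiableWithinAt ℝ Φ (leftHalf 0) u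
  covMap_Φ : ∀ u ∈ leftHalf 0, covMap s (Φ u) = E u
  Φ_Ψ : ∀ w ∈ cover Δ s, Φ (Ψ w) = w
  Ψ_Φ : ∀ u ∈ leftHalf 0, Ψ (Φ u) = u
  deriv_Ψ : ∀ w ∈ cover Δ s, ∃ Ψ' : ℂ →L[ℝ] ℂ, HasFDerivWithinAt Ψ Ψ' (cover Δ s) w ∧
    (fderivWithin ℝ E (leftHalf 0) (Ψ w)).comp Ψ' = fderiv ℝ (covMap s) w

lemma hasDerivAt_covMap (s w : ℂ) : HasDerivAt (covMap s) (Complex.exp w) w :=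
  (Complex.hasDerivAt_exp w).const_add s

lemma fderiv_covMap_apply (s w h : ℂ) : fderiv ℝ (covMap s) w h = h * Complex.exp w := by
  rw [((hasDerivAt_covMap s w).hasFDerivAt.restrictScalars ℝ).fderiv]
  simp

lemma hasFDerivAt_covMap (s w : ℂ) : HasFDerivAt (covMap s) (fderiv ℝ (covMap s) w) w :=
  ((hasDerivAt_covMap s w).hasFDerivAt.restrictScalars ℝ).differentiableAt.hasFDerivAt

lemma continuous_covMap (s : ℂ) : Continuous (covMap s) :=
  continuous_const.add Complex.continuous_exp

lemma mem_cover {Δ : Set ℂ} {s w : ℂ} : w ∈ cover Δ s ↔ covMap s w ∈ Δ := by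
  simp [cover, covMap, Complex.exp_ne_zero]

lemma covMap_add_two_pi (s w : ℂ) (k : ℤ) :
    covMap s (w + k * (2 * Real.pi * Complex.I)) = covMap s w := by
  simp [covMap, Complex.exp_add, Complex.exp_int_mul_two_pi_mul_I]

/-- A half-plane of points of small radius is contained in the universal cover. -/
lemma exists_leftHalf_subset_cover {Δ : Set ℂ} {s : ℂ} (hs : s ∈ interior Δ) :
    ∃ R : ℝ, leftHalf R ⊆ cover Δ s := by
  obtain ⟨ε, hε, hεΔ⟩ := Metric.nhds_basis_closedBall.mem_iff.1 (mem_interior_iff_mem_nhds.1 hs)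
  refine ⟨Real.log ε, fun w hw => mem_cover.2 (hεΔ ?_)⟩
  rw [Metric.mem_closedBall, dist_eq_norm, covMap, add_sub_cancel_left, Complex.norm_exp,
    ← Real.le_log_iff_exp_le hε]
  exact hw

/-- A function whose increment under the translation by `2πi` is `2πi d` has increment `2πi d m`
under the translation by `2πi m`. -/
lemma int_translate {f : ℂ → ℂ} {c : ℝ} {d : ℤ}
    (h : ∀ u ∈ leftHalf c, f (u + 2 * Real.pi * Complex.I) = f u + d * (2 * Real.pi * Complex.I))
    (m : ℤ) : ∀ u ∈ leftHalf c,
      f (u + m * (2 * Real.pi * Complex.I)) = f u + (d * m : ℤ) * (2 * Real.pi * Complex.I) := by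
  have hmem : ∀ (j : ℤ), ∀ u ∈ leftHalf c, u + j * (2 * Real.pi * Complex.I) ∈ leftHalf c :=
    fun j u hu => by
      rw [mem_leftHalf] at hu ⊢
      simpa using hu
  induction m using Int.induction_on with
  | zero => intro u hu; simp
  | succ m ih =>
    intro u hu
    have h1 := h _ (hmem m u hu)
    rw [ih u hu] at h1
    push_cast at h1 ⊢
    rw [add_mul (m : ℂ), one_mul, ← add_assoc, h1]
    ring
  | pred m ih =>
    intro u hu
    have h1 := h _ (hmem (-m - 1) u hu)
    have e : u + ((-m - 1 : ℤ) : ℂ) * (2 * Real.pi * Complex.I) + 2 * Real.pi * Complex.I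
        = u + ((-m : ℤ) : ℂ) * (2 * Real.pi * Complex.I) := by push_cast; ring
    rw [e, ih u hu] at h1
    push_cast at h1 ⊢
    linear_combination -h1

/-- The universal cover of a punctured disc is parametrized by a half-plane. -/
theorem nonempty_coverParam {Δ : Set ℂ} (hΔ : IsClosedDisc Δ) {s : ℂ} (hs : s ∈ interior Δ) :
    Nonempty (CoverParam Δ s) := by
  obtain ⟨F, G, hF, hG, hFm, hGm, hl, hr, hF0⟩ := hΔ.exists_centered hs
  set B := Metric.closedBall (0 : ℂ) 1
  set V := leftHalf 0
  set τ : ℂ := 2 * Real.pi * Complex.I with hτ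
  have hτ0 : τ ≠ 0 := by simp [hτ, Real.pi_ne_zero]
  have h0B : (0 : ℂ) ∈ B := Metric.mem_closedBall_self zero_le_one
  have hexpB : ∀ u, Complex.exp u ∈ B ↔ u ∈ V := fun u => by
    rw [mem_closedBall_zero_iff, Complex.norm_exp, Real.exp_le_one_iff]; rfl
  have hFs : ∀ Z ∈ B, Z ≠ 0 → F Z ≠ s := fun Z hZ hZ0 h => by
    rw [← hF0] at h
    exact hZ0 (hl.injOn hZ h0B h)
  have hG0 : ∀ Z ∈ Δ, Z ≠ s → G Z ≠ 0 := fun Z hZ hZs h => hZs (by rw [← hr hZ, h, hF0])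
  set E : ℂ → ℂ := fun u => F (Complex.exp u) with hE
  have hEsm : ContDiffOn ℝ ∞ E V :=
    hF.comp ((Complex.contDiff_exp (𝕜 := ℂ)).restrict_scalars ℝ).contDiffOn
      fun u hu => (hexpB u).2 hu
  have hEm : MapsTo E V (Δ \ {s}) := fun u hu =>
    ⟨hFm ((hexpB u).2 hu), hFs _ ((hexpB u).2 hu) (Complex.exp_ne_zero u)⟩
  -- the derivatives of `F` and `G` are inverse to each other
  have hF' : ∀ Z ∈ B, HasFDerivWithinAt F (fderivWithin ℝ F B Z) B Z := fun Z hZ =>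
    ((hF Z hZ).differentiableWithinAt (by simp)).hasFDerivWithinAt
  have hG' : ∀ Z ∈ Δ, HasFDerivWithinAt G (fderivWithin ℝ G Δ Z) Δ Z := fun Z hZ =>
    ((hG Z hZ).differentiableWithinAt (by simp)).hasFDerivWithinAt
  have hGF : ∀ Z ∈ B, (fderivWithin ℝ G Δ (F Z)).comp (fderivWithin ℝ F B Z)
      = ContinuousLinearMap.id ℝ ℂ := fun Z hZ => by
    have h1 := (hG' (F Z) (hFm hZ)).comp Z (hF' Z hZ) hFm
    have h2 : HasFDerivWithinAt (G ∘ F) (ContinuousLinearMap.id ℝ ℂ) B Z :=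
      (hasFDerivWithinAt_id Z B).congr (fun x hx => hl hx) (hl hZ)
    exact (uniqueDiffOn_closedBall Z hZ).eq h1 h2
  have hFG : ∀ Z ∈ B, (fderivWithin ℝ F B Z).comp (fderivWithin ℝ G Δ (F Z))
      = ContinuousLinearMap.id ℝ ℂ := fun Z hZ => comp_eq_id_symm (hGF Z hZ)
  have hEint : MapsTo E (interior V) (interior (Δ \ {s})) := by
    intro u hu
    rw [interior_leftHalf] at hu
    have hu' : Complex.exp u ∈ Metric.ball (0 : ℂ) 1 := by
      rw [mem_ball_zero_iff, Complex.norm_exp, Real.exp_lt_one_iff]; exact hu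
    have hB : B ∈ 𝓝 (Complex.exp u) :=
      mem_of_superset (Metric.isOpen_ball.mem_nhds hu') Metric.ball_subset_closedBall
    have huB : Complex.exp u ∈ B := mem_of_mem_nhds hB
    have hst : HasStrictFDerivAt F (fderivWithin ℝ F B (Complex.exp u)) (Complex.exp u) := by
      rw [fderivWithin_of_mem_nhds hB]
      exact (hF.contDiffAt hB).hasStrictFDerivAt (by simp)
    have hmap := hst.map_nhds_eq_of_surj (range_eq_top_of_comp_eq_id (hFG _ huB))
    have h1 : Δ ∈ 𝓝 (E u) := by
      rw [hE]; simp only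
      rw [← hmap]
      exact mem_map.2 (mem_of_superset hB hFm)
    have h2 : ({s} : Set ℂ)ᶜ ∈ 𝓝 (E u) :=
      isOpen_compl_singleton.mem_nhds (hEm ((hexpB u).1 huB)).2
    exact mem_interior_iff_mem_nhds.2 (inter_mem h1 h2)
  have hVconn : IsPreconnected V := (convex_leftHalf 0).isPreconnected
  have hVτ : ∀ (j : ℤ), ∀ u ∈ V, u + j * τ ∈ V := fun j u hu => by
    rw [mem_leftHalf] at hu ⊢
    simpa [hτ] using hu
  -- the lift `Φ`
  have hEs : ContinuousOn (fun u => E u - s) V := hEsm.continuousOn.sub continuousOn_const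
  obtain ⟨Φ, hΦc, hΦ⟩ := exists_log hEs fun u hu => sub_ne_zero.2 (hEm hu).2
  have hcov : ∀ u ∈ V, covMap s (Φ u) = E u := fun u hu => by
    rw [covMap, hΦ u hu]; ring
  have hEper : ∀ u, E (u + τ) = E u := fun u => by
    simp only [hE, hτ, Complex.exp_add, Complex.exp_two_pi_mul_I, mul_one]
  obtain ⟨d, hd⟩ := eq_add_of_exp_eq hVconn (ℓ₁ := fun u => Φ (u + τ)) (ℓ₂ := Φ)
    (hΦc.comp (Continuous.continuousOn (by fun_prop)) fun u hu => by
      simpa using hVτ 1 u hu) hΦc (fun u hu => by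
      have := hVτ 1 u hu
      rw [Int.cast_one, one_mul] at this
      rw [hΦ _ this, hΦ u hu, hEper])
  -- a lift in the opposite direction near the puncture shows that `Φ` has degree `±1`
  obtain ⟨R, hR⟩ := exists_leftHalf_subset_cover hs
  have hGcov : ContinuousOn (fun w => G (covMap s w)) (cover Δ s) :=
    hG.continuousOn.comp (continuous_covMap s).continuousOn fun w hw => hw.1
  have hGcov0 : ∀ w ∈ cover Δ s, G (covMap s w) ≠ 0 := fun w hw => hG0 _ hw.1 hw.2
  obtain ⟨Ψ₀, hΨ₀c, hΨ₀⟩ := exists_log (hGcov.mono hR) fun w hw => hGcov0 w (hR hw)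
  have hHconn : IsPreconnected (leftHalf R) := (convex_leftHalf R).isPreconnected
  have hΨ₀V : MapsTo Ψ₀ (leftHalf R) V := fun w hw => by
    rw [← hexpB, hΨ₀ w hw]
    exact hGm (hR hw).1
  have hτR : ∀ w ∈ leftHalf R, w + τ ∈ leftHalf R := fun w hw => by
    rw [mem_leftHalf] at hw ⊢
    simpa [hτ] using hw
  have hper : ∀ w, covMap s (w + τ) = covMap s w := fun w => by
    simpa using covMap_add_two_pi s w 1
  obtain ⟨e, he⟩ := eq_add_of_exp_eq hHconn (ℓ₁ := fun w => Ψ₀ (w + τ)) (ℓ₂ := Ψ₀)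
    (hΨ₀c.comp (Continuous.continuousOn (by fun_prop)) hτR) hΨ₀c (fun w hw => by
      rw [hΨ₀ _ (hτR w hw), hΨ₀ w hw, hper])
  obtain ⟨k, hk⟩ := eq_add_of_exp_eq hHconn (ℓ₁ := fun w => Φ (Ψ₀ w)) (ℓ₂ := id)
    (hΦc.comp hΨ₀c hΨ₀V) continuousOn_id (fun w hw => by
      simp only [id]
      rw [hΦ _ (hΨ₀V hw)]
      simp only [hE]
      rw [hΨ₀ w hw, hr (hR hw).1, covMap, add_sub_cancel_left])
  have hdm := int_translate hd
  have hde : d * e = 1 := by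
    set a : ℂ := (R : ℂ)
    have ha : a ∈ leftHalf R := by simp [a, mem_leftHalf]
    have h1 := hk _ (hτR a ha)
    rw [he a ha, hdm e _ (hΨ₀V ha), hk a ha] at h1
    simp only [id] at h1
    have h2 : ((d * e : ℤ) : ℂ) * τ = 1 * τ := by linear_combination h1
    exact_mod_cast mul_right_cancel₀ hτ0 h2
  have hd0 : d ≠ 0 := by rintro rfl; simp at hde
  have hΦinj : InjOn Φ V := by
    intro u hu u' hu' h
    have h1 : E u = E u' := by rw [← hcov u hu, ← hcov u' hu', h]
    obtain ⟨m, hm⟩ := Complex.exp_eq_exp_iff_exists_int.1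
      (hl.injOn ((hexpB u).2 hu) ((hexpB u').2 hu') h1)
    have h2 := hdm m u' hu'
    rw [← hm, h] at h2
    have h3 : ((d * m : ℤ) : ℂ) * τ = 0 := by linear_combination -h2
    have h4 : d * m = 0 := by exact_mod_cast (mul_eq_zero.1 h3).resolve_right hτ0
    have h5 : m = 0 := (mul_eq_zero.1 h4).resolve_left hd0
    rw [hm, h5]; simp
  have hΨex : ∀ w ∈ cover Δ s, ∃ u ∈ V, Complex.exp u = G (covMap s w) ∧ Φ u = w := by
    intro w hw
    set u₁ := Complex.log (G (covMap s w))
    have hu₁ : Complex.exp u₁ = G (covMap s w) := Complex.exp_log (hGcov0 w hw)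
    have hu₁V : u₁ ∈ V := by rw [← hexpB, hu₁]; exact hGm hw.1
    obtain ⟨j, hj⟩ := Complex.exp_eq_exp_iff_exists_int.1
      (show Complex.exp (Φ u₁) = Complex.exp w by
        rw [hΦ u₁ hu₁V]
        simp only [hE]
        rw [hu₁, hr hw.1, covMap, add_sub_cancel_left])
    refine ⟨u₁ + (-(e * j) : ℤ) * τ, hVτ _ _ hu₁V, ?_, ?_⟩
    · rw [Complex.exp_add, hu₁, hτ, Complex.exp_int_mul_two_pi_mul_I, mul_one]
    · rw [hdm _ _ hu₁V, hj, show d * -(e * j) = -j by rw [mul_neg, ← mul_assoc, hde, one_mul]]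
      push_cast; ring
  choose! Ψ hΨV hΨexp hΦΨ using hΨex
  have hΨc : ContinuousOn Ψ (cover Δ s) := by
    intro w₀ hw₀
    set g₀ := G (covMap s w₀) with hg₀
    have hg₀0 : g₀ ≠ 0 := hGcov0 w₀ hw₀
    set v : ℂ → ℂ := fun w => Ψ w₀ + Complex.log (G (covMap s w) / g₀)
    have hvc : ContinuousWithinAt v (cover Δ s) w₀ := by
      refine continuousWithinAt_const.add (((hGcov w₀ hw₀).div_const g₀).clog ?_)
      rw [← hg₀, div_self hg₀0]
      exact Complex.one_mem_slitPlane
    have hv₀ : v w₀ = Ψ w₀ := by simp [v, ← hg₀, div_self hg₀0]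
    have hvexp : ∀ w ∈ cover Δ s, Complex.exp (v w) = G (covMap s w) := fun w hw => by
      simp only [v]
      rw [Complex.exp_add, hΨexp w₀ hw₀, Complex.exp_log (div_ne_zero (hGcov0 w hw) hg₀0),
        mul_div_cancel₀ _ hg₀0]
    have hvV : ∀ w ∈ cover Δ s, v w ∈ V := fun w hw => by
      rw [← hexpB, hvexp w hw]; exact hGm hw.1
    have hΦv : ContinuousWithinAt (fun w => Φ (v w)) (cover Δ s) w₀ :=
      (hΦc (v w₀) (hvV w₀ hw₀)).comp hvc hvV
    have hsub : Tendsto (fun w => Φ (v w) - w) (𝓝[cover Δ s] w₀) (𝓝 0) := by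
      have := hΦv.sub (continuousWithinAt_id (x := w₀) (s := cover Δ s))
      simpa [ContinuousWithinAt, hv₀, hΦΨ w₀ hw₀] using! this
    have hev : ∀ᶠ w in 𝓝[cover Δ s] w₀, ‖Φ (v w) - w‖ < 2 * Real.pi := by
      have := Metric.tendsto_nhds.1 hsub (2 * Real.pi) (by positivity)
      simpa using this
    refine hvc.congr_of_eventuallyEq ?_ hv₀.symm
    filter_upwards [hev, self_mem_nhdsWithin] with w hw hwW
    have h1 : Complex.exp (Φ (v w)) = Complex.exp w := by
      rw [hΦ _ (hvV w hwW)]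
      simp only [hE]
      rw [hvexp w hwW, hr hwW.1, covMap, add_sub_cancel_left]
    obtain ⟨j, hj⟩ := Complex.exp_eq_exp_iff_exists_int.1 h1
    have hj0 : j = 0 := by
      rw [hj, add_sub_cancel_left, norm_mul, Complex.norm_intCast] at hw
      have h2 : ‖(2 * Real.pi * Complex.I : ℂ)‖ = 2 * Real.pi := by
        simp [abs_of_pos Real.pi_pos]
      rw [h2] at hw
      have h3 : |(j : ℝ)| < 1 := by
        by_contra! h
        nlinarith [Real.pi_pos]
      exact Int.abs_lt_one_iff.1 (by exact_mod_cast h3)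
    refine hΦinj (hΨV w hwW) (hvV w hwW) ?_
    rw [hΦΨ w hwW, hj, hj0]; simp
  have hΦW : MapsTo Φ V (cover Δ s) := fun u hu => mem_cover.2 (by
    rw [hcov u hu]; exact (hEm hu).1)
  refine ⟨⟨E, Φ, Ψ, hEsm, hEm, hEint, hΦW, hΨV, hΨc, fun u hu => ?_, hcov, hΦΨ,
    fun u hu => hΦinj (hΨV _ (hΦW hu)) hu (hΦΨ _ (hΦW hu)), fun w hw => ?_⟩⟩
  · have hE' : HasFDerivWithinAt (fun u => E u - s) (fderivWithin ℝ E V u) V u :=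
      (((hEsm u hu).differentiableWithinAt (by simp)).hasFDerivWithinAt).sub_const s
    exact (hasFDerivWithinAt_of_exp (hΦc u hu) hu hΦ hE').differentiableWithinAt
  · have hcm : HasFDerivWithinAt (covMap s) (fderiv ℝ (covMap s) w) (cover Δ s) w :=
      (hasFDerivAt_covMap s w).hasFDerivWithinAt
    have hGc := (hG' _ hw.1).comp w hcm fun z hz => hz.1
    have hΨ' := hasFDerivWithinAt_of_exp (hΨc w hw) hw hΨexp hGc
    refine ⟨_, hΨ', ?_⟩
    have hexpd : HasFDerivWithinAt Complex.exp
        ((ContinuousLinearMap.mul ℝ ℂ) (Complex.exp (Ψ w))) V (Ψ w) := by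
      have := (Complex.hasDerivAt_exp (Ψ w)).hasFDerivAt.restrictScalars ℝ
      refine (this.congr_fderiv ?_).hasFDerivWithinAt
      ext y
      simp [mul_comm]
    have hEd : HasFDerivWithinAt E ((fderivWithin ℝ F B (Complex.exp (Ψ w))).comp
        ((ContinuousLinearMap.mul ℝ ℂ) (Complex.exp (Ψ w)))) V (Ψ w) :=
      (hF' _ ((hexpB _).2 (hΨV w hw))).comp (Ψ w) hexpd fun u hu => (hexpB u).2 hu
    rw [hEd.fderivWithin (uniqueDiffOn_leftHalf 0 _ (hΨV w hw)), hΨexp w hw]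
    have hinv := hFG (G (covMap s w)) (hGm hw.1)
    rw [hr hw.1] at hinv
    refine ContinuousLinearMap.ext fun h => ?_
    have := congrArg (fun T : ℂ →L[ℝ] ℂ => T (fderiv ℝ (covMap s) w h)) hinv
    simpa [mul_inv_cancel_left₀ (hGcov0 w hw)] using this

end Cover

/-! ### Existence and uniqueness of primitives -/

section Primitives

variable {n : ℕ}

-- The negation of continuous linear maps and that of the ring `MEnd n` agree by definition only.
lemma mend_neg_mul (A B : MEnd n) : -A * B = -(A * B) := neg_mul A B

lemma mend_mul_neg (A B : MEnd n) : A * -B = -(A * B) := mul_neg A B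

variable {X : Type} [NormedAddCommGroup X] [NormedSpace ℝ X]

/-- The domains considered below: connected sets on which functions with vanishing derivative are
constant. -/
structure IsGoodDomain (n : ℕ) (U : Set X) : Prop where
  preconnected : IsPreconnected U
  const : ∀ f : X → MEnd n, (∀ q ∈ U, HasFDerivWithinAt f (0 : X →L[ℝ] MEnd n) U q) →
    ∀ p ∈ U, ∀ q ∈ U, f q = f p

lemma Convex.isGoodDomain {U : Set X} (hU : Convex ℝ U) : IsGoodDomain n U where
  preconnected := hU.isPreconnected
  const f hf p hp q hq := by
    have := hU.norm_image_sub_le_of_norm_hasFDerivWithin_le (C := 0) hf (by simp) hp hq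
    rw [zero_mul] at this
    exact sub_eq_zero.1 (norm_le_zero_iff.1 this)

lemma CoverParam.isGoodDomain {Δ : Set ℂ} {s : ℂ} (P : CoverParam Δ s) :
    IsGoodDomain n (cover Δ s) where
  preconnected := by
    have : cover Δ s = P.Φ '' leftHalf 0 :=
      Subset.antisymm (fun w hw => ⟨P.Ψ w, P.mapsTo_Ψ hw, P.Φ_Ψ w hw⟩) P.mapsTo_Φ.image_subset
    rw [this]
    exact (convex_leftHalf 0).isPreconnected.image _ fun u hu =>
      (P.differentiable_Φ u hu).continuousWithinAt
  const f hf p hp q hq := by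
    have := (Convex.isGoodDomain (n := n) (convex_leftHalf 0)).const (f ∘ P.Φ) (fun u hu => by
      have := (hf (P.Φ u) (P.mapsTo_Φ hu)).comp u (P.differentiable_Φ u hu).hasFDerivWithinAt
        P.mapsTo_Φ
      rwa [ContinuousLinearMap.zero_comp] at this) (P.Ψ p) (P.mapsTo_Ψ hp) (P.Ψ q) (P.mapsTo_Ψ hq)
    simpa only [Function.comp_apply, P.Φ_Ψ p hp, P.Φ_Ψ q hq] using this

/-- The equation `dΓ = Γ θ` at a point. -/
def PrimEq (U : Set X) (θ : Form n X) (Γ : X → MEnd n) (q : X) : Prop :=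
  HasFDerivWithinAt Γ ((ContinuousLinearMap.mul ℝ (MEnd n) (Γ q)).comp (θ q)) U q

/-- The conjugation `T ↦ A T B`. -/
def conjL (A B : MEnd n) : MEnd n →L[ℝ] MEnd n :=
  (ContinuousLinearMap.mul ℝ (MEnd n) A).comp ((ContinuousLinearMap.mul ℝ (MEnd n)).flip B)

lemma conjL_apply (A B T : MEnd n) : conjL A B T = A * T * B := (mul_assoc A T B).symm

/-- If `dG = G θ` and `dG' = G' θ'` with `θ'` skew, then `d(G G'*) = G (θ - θ') G'*`. -/
lemma PrimEq.mul_madj {U : Set X} {θ θ' : Form n X} {G G' : X → MEnd n} {q : X}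
    (hG : PrimEq U θ G q) (hG' : PrimEq U θ' G' q) (hθ' : ∀ h, madj (θ' q h) = -θ' q h) :
    HasFDerivWithinAt (fun z => G z * madj (G' z))
      ((conjL (G q) (madj (G' q))).comp (θ q - θ' q)) U q := by
  have h1 : HasFDerivWithinAt (fun z => madj (G' z)) _ U q :=
    (madj (n := n)).hasFDerivAt.comp_hasFDerivWithinAt q hG'
  have h2 := HasFDerivWithinAt.mul' hG h1
  refine h2.congr_fderiv ?_
  refine ContinuousLinearMap.ext fun h => ?_
  show G q * madj (G' q * θ' q h) + G q * θ q h * madj (G' q)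
    = conjL (G q) (madj (G' q)) (θ q h - θ' q h)
  rw [conjL_apply, madj_mul, hθ' h, mend_neg_mul, mend_mul_neg, mul_sub, sub_mul, ← mul_assoc,
    neg_add_eq_sub]

variable {U : Set X} {θ : Form n X}

/-- Primitives are unique, and they preserve the Minkowski inner product. -/
lemma IsGoodDomain.mul_madj_eq_one (hU : IsGoodDomain n U)
    (hθ : ∀ q ∈ U, ∀ h, madj (θ q h) = -θ q h) {p : X} (hp : p ∈ U) {G G' : X → MEnd n}
    (hG : ∀ q ∈ U, PrimEq U θ G q) (hG' : ∀ q ∈ U, PrimEq U θ G' q) (h1 : G p * madj (G' p) = 1) :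
    ∀ q ∈ U, G q * madj (G' q) = 1 := by
  intro q hq
  have := hU.const (fun z => G z * madj (G' z)) (fun z hz => by
    refine ((hG z hz).mul_madj (hG' z hz) (hθ z hz)).congr_fderiv ?_
    refine ContinuousLinearMap.ext fun h => ?_
    show conjL (G z) (madj (G' z)) (θ z h - θ z h) = 0
    rw [sub_self, map_zero]) p hp q hq
  exact this.trans h1

lemma IsGoodDomain.isPrimitive (hU : IsGoodDomain n U)
    (hθ : ∀ q ∈ U, ∀ h, madj (θ q h) = -θ q h) {p : X} (hp : p ∈ U) {G : X → MEnd n}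
    (hG : ∀ q ∈ U, PrimEq U θ G q) (h1 : G p = 1) : IsPrimitive U θ p G := by
  have hpres : ∀ q ∈ U, madj (G q) * G q = 1 := fun q hq =>
    mul_eq_one_symm (hU.mul_madj_eq_one hθ hp hG hG (by rw [h1, madj_one, mul_one]) q hq)
  refine ⟨fun q hq => ⟨preserves_iff.2 (hpres q hq), ?_⟩, hG, h1⟩
  -- the time component is continuous and does not vanish
  have hc : ContinuousOn (fun z => G z (Pi.single 0 1) 0) U := fun z hz =>
    (continuous_apply (0 : Fin (n + 2))).continuousAt.comp_continuousWithinAt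
      ((hG z hz).continuousWithinAt.clm_apply continuousWithinAt_const)
  by_contra! hneg
  have hpos : 0 < G p (Pi.single 0 1) 0 := by rw [h1]; simp
  obtain ⟨z, hz, hz0⟩ := hU.preconnected.intermediate_value hq hp hc ⟨hneg, hpos.le⟩
  have := one_le_sq_of_preserves (hpres z hz)
  simp only at hz0
  rw [hz0] at this
  norm_num at this

lemma PrimEq.const_mul {G : X → MEnd n} {q : X} (hG : PrimEq U θ G q) (A : MEnd n) :
    PrimEq U θ (fun z => A * G z) q := by
  have h : HasFDerivWithinAt (fun z => A * G z) _ U q :=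
    (ContinuousLinearMap.mul ℝ (MEnd n) A).hasFDerivAt.comp_hasFDerivWithinAt q hG
  refine h.congr_fderiv ?_
  refine ContinuousLinearMap.ext fun k => ?_
  exact (mul_assoc A (G q) (θ q k)).symm

lemma IsGoodDomain.hasUniquePrimitives (hU : IsGoodDomain n U)
    (hθ : ∀ q ∈ U, ∀ h, madj (θ q h) = -θ q h) {p : X} (hp : p ∈ U) {G : X → MEnd n}
    (hG : ∀ q ∈ U, PrimEq U θ G q) (h1 : G p = 1) : HasUniquePrimitives U θ := by
  intro r hr
  have hpres := fun q hq => mul_eq_one_symm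
    (hU.mul_madj_eq_one hθ hp hG hG (by rw [h1, madj_one, mul_one]) q hq)
  have hprim : IsPrimitive U θ r (fun z => madj (G r) * G z) :=
    hU.isPrimitive hθ hr (fun q hq => (hG q hq).const_mul _) (hpres r hr)
  refine ⟨_, hprim, fun Γ' hΓ' q hq => ?_⟩
  have h2 := hU.mul_madj_eq_one hθ hr hΓ'.deriv hprim.deriv (by
    rw [hΓ'.base, hprim.base, madj_one, mul_one]) q hq
  have h3 := preserves_iff.1 (hprim.mem q hq).1
  calc Γ' q = Γ' q * (madj (madj (G r) * G q) * (madj (G r) * G q)) := by rw [h3, mul_one]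
    _ = madj (G r) * G q := by rw [← mul_assoc, h2, one_mul]

lemma HasUniquePrimitives.isPrimitive (h : HasUniquePrimitives U θ) {p : X} (hp : p ∈ U) :
    IsPrimitive U θ p (prim U θ p) := by
  obtain ⟨Γ, hΓ, -⟩ := h p hp
  have hex : ∃ Γ, IsPrimitive U θ p Γ := ⟨Γ, hΓ⟩
  have : prim U θ p = Classical.choose hex := by
    funext q
    simp only [prim, dif_pos hex]
  rw [this]
  exact Classical.choose_spec hex

lemma HasUniquePrimitives.prim_eq (h : HasUniquePrimitives U θ) {p : X} (hp : p ∈ U)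
    {Γ : X → MEnd n} (hΓ : IsPrimitive U θ p Γ) {q : X} (hq : q ∈ U) : prim U θ p q = Γ q := by
  obtain ⟨Γ₀, -, hΓ₀⟩ := h p hp
  rw [hΓ₀ _ (h.isPrimitive hp) hq, hΓ₀ _ hΓ hq]

lemma HasUniquePrimitives.madj_mul_self (h : HasUniquePrimitives U θ) {p q : X} (hp : p ∈ U)
    (hq : q ∈ U) : madj (prim U θ p q) * prim U θ p q = 1 :=
  preserves_iff.1 ((h.isPrimitive hp).mem q hq).1

lemma HasUniquePrimitives.prim_self (h : HasUniquePrimitives U θ) {p : X} (hp : p ∈ U) :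
    prim U θ p p = 1 := (h.isPrimitive hp).base

end Primitives

section Transitivity

variable {n : ℕ} {X : Type} [NormedAddCommGroup X] [NormedSpace ℝ X] {U : Set X} {θ : Form n X}

lemma IsGoodDomain.prim_mul (hU : IsGoodDomain n U) (hθ : ∀ q ∈ U, ∀ h, madj (θ q h) = -θ q h)
    (h : HasUniquePrimitives U θ) {p q r : X} (hp : p ∈ U) (hq : q ∈ U) (hr : r ∈ U) :
    prim U θ p q * prim U θ q r = prim U θ p r := by
  have h1 : IsPrimitive U θ q (fun z => madj (prim U θ p q) * prim U θ p z) :=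
    hU.isPrimitive hθ hq (fun z hz => PrimEq.const_mul ((h.isPrimitive hp).deriv z hz) _)
      (h.madj_mul_self hp hq)
  rw [h.prim_eq hq h1 hr, ← mul_assoc, mul_eq_one_symm (h.madj_mul_self hp hq), one_mul]

lemma IsGoodDomain.madj_prim (hU : IsGoodDomain n U) (hθ : ∀ q ∈ U, ∀ h, madj (θ q h) = -θ q h)
    (h : HasUniquePrimitives U θ) {p q : X} (hp : p ∈ U) (hq : q ∈ U) :
    madj (prim U θ p q) = prim U θ q p := by
  have h1 := h.madj_mul_self hp hq
  have h2 := hU.prim_mul hθ h hp hq hp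
  rw [h.prim_self hp] at h2
  calc madj (prim U θ p q) = madj (prim U θ p q) * (prim U θ p q * prim U θ q p) := by
        rw [h2, mul_one]
    _ = prim U θ q p := by rw [← mul_assoc, h1, one_mul]

end Transitivity

/-! ### Primitives of flat forms on the universal cover -/

section Existence

variable {n : ℕ} {Δ : Set ℂ} {s : ℂ}

/-- The pullback of a flat form under a smooth map is flat. -/
lemma flat_comp {ψ : Form n ℂ} {E : ℂ → ℂ} {u : ℂ} (hE : ContDiffAt ℝ ∞ E u)
    (hψ : DifferentiableAt ℝ ψ (E u))
    (hflat : ∀ h k, fderiv ℝ ψ (E u) h k - fderiv ℝ ψ (E u) k h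
      + (ψ (E u) h * ψ (E u) k - ψ (E u) k * ψ (E u) h) = 0) (h k : ℂ) :
    fderiv ℝ (fun u => (ψ (E u)).comp (fderiv ℝ E u)) u h k
      - fderiv ℝ (fun u => (ψ (E u)).comp (fderiv ℝ E u)) u k h
      + ((ψ (E u)).comp (fderiv ℝ E u) h * (ψ (E u)).comp (fderiv ℝ E u) k
        - (ψ (E u)).comp (fderiv ℝ E u) k * (ψ (E u)).comp (fderiv ℝ E u) h) = 0 := by
  have hE1 : HasFDerivAt E (fderiv ℝ E u) u := (hE.differentiableAt (by simp)).hasFDerivAt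
  have hE2 : HasFDerivAt (fderiv ℝ E) (fderiv ℝ (fderiv ℝ E) u) u :=
    ((hE.fderiv_right (m := 1) (by norm_cast)).differentiableAt (by simp)).hasFDerivAt
  have h1 : HasFDerivAt (fun u => ψ (E u)) ((fderiv ℝ ψ (E u)).comp (fderiv ℝ E u)) u :=
    HasFDerivAt.comp (G := ℂ →L[ℝ] MEnd n) (g := ψ) u hψ.hasFDerivAt hE1
  have h2 := h1.clm_comp hE2
  have hsymm := (hE.isSymmSndFDerivAt (by
    rw [minSmoothness_of_isRCLikeNormedField]; norm_cast)) h k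
  rw [h2.fderiv]
  have h3 := hflat (fderiv ℝ E u h) (fderiv ℝ E u k)
  simp only [add_apply, ContinuousLinearMap.comp_apply, ContinuousLinearMap.compL_apply,
    ContinuousLinearMap.flip_apply, hsymm]
  rw [← h3]
  abel

lemma CoverParam.exists_primitive (P : CoverParam Δ s) {ψ : Form n ℂ}
    (hsm : ContDiffOn ℝ ∞ ψ (Δ \ {s})) (hflat : IsFlat (Δ \ {s}) ψ) :
    ∃ p ∈ cover Δ s, ∃ Γ : ℂ → MEnd n, Γ p = 1 ∧
      ∀ q ∈ cover Δ s, PrimEq (cover Δ s) (pullCover s ψ) Γ q := by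
  set V := leftHalf 0
  have hVu : UniqueDiffOn ℝ V := uniqueDiffOn_leftHalf 0
  set θ : ℂ → ℂ →L[ℝ] MEnd n := fun u => (ψ (P.E u)).comp (fderivWithin ℝ P.E V u) with hθdef
  have hθ : ContDiffOn ℝ 1 θ V := by
    have h1 : ContDiffOn ℝ 1 (fun u => ψ (P.E u)) V :=
      (hsm.comp P.smooth P.mapsTo_E).of_le (by norm_cast)
    exact h1.clm_comp (P.smooth.fderivWithin hVu (by norm_cast))
  have hp : (-1 : ℂ) ∈ interior V := by
    rw [interior_leftHalf]; show (-1 : ℂ).re < 0; simp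
  obtain ⟨Γ, hΓ1, hΓ⟩ := exists_primitive_of_flat (convex_leftHalf 0) (θ := θ)
    (Dθ := fderivWithin ℝ θ V)
    (fun q hq => ((hθ q hq).differentiableWithinAt (by simp)).hasFDerivWithinAt)
    (hθ.continuousOn_fderivWithin hVu le_rfl) hp (by
      intro u hu h k
      have hVn : V ∈ 𝓝 u := mem_interior_iff_mem_nhds.1 hu
      have hθe : θ =ᶠ[𝓝 u] fun u => (ψ (P.E u)).comp (fderiv ℝ P.E u) := by
        filter_upwards [isOpen_interior.mem_nhds hu] with u' hu'
        simp only [hθdef]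
        rw [fderivWithin_of_mem_nhds (mem_interior_iff_mem_nhds.1 hu')]
      rw [fderivWithin_of_mem_nhds hVn, hθe.fderiv_eq, hθe.eq_of_nhds]
      have hint := P.mapsTo_interior hu
      exact flat_comp (P.smooth.contDiffAt hVn)
        ((hsm.contDiffAt (mem_interior_iff_mem_nhds.1 hint)).differentiableAt (by simp))
        (hflat _ hint) h k)
  refine ⟨P.Φ (-1), P.mapsTo_Φ (interior_subset hp), Γ ∘ P.Ψ, ?_, fun w hw => ?_⟩
  · rw [Function.comp_apply, P.Ψ_Φ _ (interior_subset hp), hΓ1]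
  · obtain ⟨Ψ', hΨ', hcomp⟩ := P.deriv_Ψ w hw
    refine ((hΓ _ (P.mapsTo_Ψ hw)).comp w hΨ' P.mapsTo_Ψ).congr_fderiv ?_
    rw [pullCover, ← hcomp, Function.comp_apply, ContinuousLinearMap.comp_assoc]
    congr 1
    rw [hθdef]
    simp only
    rw [ContinuousLinearMap.comp_assoc, ← P.covMap_Φ _ (P.mapsTo_Ψ hw), P.Φ_Ψ w hw]

end Existence

/-! ### The logarithm of the adapted coordinate -/

section PoleLog

variable {Δ : Set ℂ} {s : ℂ}

lemma cover_sub_mem {w : ℂ} (hw : w ∈ cover Δ s) : w - 2 * Real.pi * Complex.I ∈ cover Δ s := by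
  have := covMap_add_two_pi s w (-1)
  rw [mem_cover] at hw ⊢
  rwa [show w - 2 * Real.pi * Complex.I = w + (-1 : ℤ) * (2 * Real.pi * Complex.I) by
    push_cast; ring, this]

/-- On the universal cover, the pullback of `-α` has a primitive `μ`, a logarithm of the adapted
coordinate. It differs from `w` by a bounded function near the puncture, and it has the same
quasi-period as `w`. -/
lemma CoverParam.exists_poleLog (P : CoverParam Δ s) (hs : s ∈ interior Δ) {a : ℂ → ℂ}
    (ha : IsPoleDifferential Δ s a) :
    ∃ μ : ℂ → ℂ, (∀ w ∈ cover Δ s, ∃ μ' : ℂ →L[ℝ] ℂ, HasFDerivWithinAt μ μ' (cover Δ s) w ∧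
        ∀ h, μ' h = -(a (covMap s w) * fderiv ℝ (covMap s) w h)) ∧
      (∀ w ∈ cover Δ s, μ (w - 2 * Real.pi * Complex.I) = μ w - 2 * Real.pi * Complex.I) ∧
      ∃ (R : ℝ) (b : ℂ), leftHalf R ⊆ cover Δ s ∧ ∀ w ∈ leftHalf R, ‖μ w - w - b‖ ≤ 1 := by
  obtain ⟨z, hz, hinj, hzs, hz', haz⟩ := ha.adapted
  have hsΔ : s ∈ Δ := interior_subset hs
  have hz0 : ∀ Z ∈ Δ \ {s}, z Z ≠ 0 := fun Z hZ h => hZ.2 (hinj hZ.1 hsΔ (h.trans hzs.symm))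
  obtain ⟨ℓ, hℓc, hℓ⟩ := exists_log (c := 0) (G := fun u => z (P.E u))
    (hz.continuousOn.comp P.smooth.continuousOn fun u hu => (P.mapsTo_E hu).1)
    fun u hu => hz0 _ (P.mapsTo_E hu)
  set μ : ℂ → ℂ := fun w => ℓ (P.Ψ w)
  have hμc : ContinuousOn μ (cover Δ s) := hℓc.comp P.continuousOn_Ψ P.mapsTo_Ψ
  have hμ : ∀ w ∈ cover Δ s, Complex.exp (μ w) = z (covMap s w) := fun w hw => by
    rw [hℓ _ (P.mapsTo_Ψ hw), ← P.covMap_Φ _ (P.mapsTo_Ψ hw), P.Φ_Ψ w hw]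
  have hper : ∀ w, covMap s (w - 2 * Real.pi * Complex.I) = covMap s w := fun w => by
    have := covMap_add_two_pi s w (-1)
    rwa [show w - 2 * Real.pi * Complex.I = w + (-1 : ℤ) * (2 * Real.pi * Complex.I) by
      push_cast; ring]
  -- near the puncture, compare with `w`
  have hcmp : ∃ (R : ℝ) (b : ℂ) (g : ℂ → ℂ), leftHalf R ⊆ cover Δ s ∧
      ∀ w ∈ leftHalf R, μ w = w + b + g (covMap s w) ∧ ‖g (covMap s w)‖ ≤ 1 := by
    obtain ⟨R₁, hR₁⟩ := exists_leftHalf_subset_cover hs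
    set z' := derivWithin z Δ s
    have hz'0 : z' ≠ 0 := hz' s hsΔ
    have hder : HasDerivAt z z' s :=
      (((hz s hsΔ).differentiableWithinAt (by simp)).hasDerivWithinAt).hasDerivAt
        (mem_interior_iff_mem_nhds.1 hs)
    have hslope := hasDerivAt_iff_tendsto_slope.1 hder
    have hev : ∀ᶠ Z in 𝓝[≠] s, ‖slope z s Z / z' - 1‖ < 1 / 2 := by
      have := Metric.tendsto_nhds.1 (hslope.div_const z') (1 / 2) (by norm_num)
      simpa only [div_self hz'0, dist_eq_norm] using this
    obtain ⟨δ, hδ, hδs⟩ := Metric.mem_nhdsWithin_iff.1 hev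
    set R := min R₁ (Real.log δ - 1)
    have hRR₁ : leftHalf R ⊆ leftHalf R₁ := fun w hw =>
      (mem_leftHalf.1 hw).trans (min_le_left _ _)
    have hnear : ∀ w ∈ leftHalf R, ‖slope z s (covMap s w) / z' - 1‖ < 1 / 2 := fun w hw => by
      refine hδs ⟨?_, ?_⟩
      · rw [Metric.mem_ball, dist_eq_norm, covMap, add_sub_cancel_left, Complex.norm_exp,
          ← Real.lt_log_iff_exp_lt hδ]
        have h1 : w.re ≤ R := hw
        have h2 : R ≤ Real.log δ - 1 := min_le_right _ _
        linarith
      · simp [covMap, Complex.exp_ne_zero]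
    have hslit : ∀ w ∈ leftHalf R, slope z s (covMap s w) / z' ∈ Complex.slitPlane := fun w hw => by
      left
      have h1 := (abs_le.1 (Complex.abs_re_le_norm (slope z s (covMap s w) / z' - 1))).1
      have h2 := hnear w hw
      rw [Complex.sub_re, Complex.one_re] at h1
      linarith
    have hsl : ∀ w, slope z s (covMap s w) = z (covMap s w) / Complex.exp w := fun w => by
      simp [slope_def_field, covMap, hzs]
    obtain ⟨k, hk⟩ := eq_add_of_exp_eq (convex_leftHalf R).isPreconnected (ℓ₁ := μ)
      (ℓ₂ := fun w => w + Complex.log z' + Complex.log (slope z s (covMap s w) / z'))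
      (hμc.mono (hRR₁.trans hR₁))
      ((Continuous.continuousOn (by fun_prop)).add (ContinuousOn.clog (by
        simp only [hsl]
        refine ContinuousOn.div_const (ContinuousOn.div (hz.continuousOn.comp
          (continuous_covMap s).continuousOn fun w hw => (hR₁ (hRR₁ hw)).1)
          Complex.continuous_exp.continuousOn fun w _ => Complex.exp_ne_zero w) _) hslit))
      (fun w hw => by
        have hne : slope z s (covMap s w) / z' ≠ 0 := Complex.slitPlane_ne_zero (hslit w hw)
        rw [hμ w (hR₁ (hRR₁ hw)), Complex.exp_add, Complex.exp_add, Complex.exp_log hz'0,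
          Complex.exp_log hne, hsl]
        have := Complex.exp_ne_zero w
        field_simp)
    refine ⟨R, Complex.log z' + k * (2 * Real.pi * Complex.I),
      fun Z => Complex.log (slope z s Z / z'), hRR₁.trans hR₁, fun w hw => ⟨?_, ?_⟩⟩
    · rw [hk w hw]; ring
    · have h1 := Complex.norm_log_one_add_half_le_self (hnear w hw).le
      rw [add_sub_cancel] at h1
      have h2 := hnear w hw
      linarith
  obtain ⟨R, b, g, hR, hg⟩ := hcmp
  refine ⟨μ, fun w hw => ?_, ?_, R, b, hR, fun w hw => ?_⟩
  · have hcm : HasFDerivWithinAt (covMap s) (fderiv ℝ (covMap s) w) (cover Δ s) w :=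
      (hasFDerivAt_covMap s w).hasFDerivWithinAt
    have hzd := (((hz _ hw.1).differentiableWithinAt (by simp)).hasDerivWithinAt).hasFDerivWithinAt
    have h1 := (hzd.restrictScalars ℝ).comp w hcm fun v hv => hv.1
    refine ⟨_, hasFDerivWithinAt_of_exp (hμc w hw) hw hμ h1, fun h => ?_⟩
    rw [haz _ hw]
    simp [div_eq_mul_inv]
    ring
  · have htr : ContinuousOn (fun w => μ (w - 2 * Real.pi * Complex.I)) (cover Δ s) :=
      hμc.comp (Continuous.continuousOn (by fun_prop)) fun w hw => cover_sub_mem hw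
    obtain ⟨k, hk⟩ := eq_add_of_exp_eq (P.isGoodDomain (n := 0)).preconnected
      (ℓ₁ := fun w => μ (w - 2 * Real.pi * Complex.I)) (ℓ₂ := μ) htr hμc (fun w hw => by
        rw [hμ _ (cover_sub_mem hw), hμ w hw, hper])
    have hRm : (R : ℂ) ∈ leftHalf R := by simp [mem_leftHalf]
    have hRm' : (R : ℂ) - 2 * Real.pi * Complex.I ∈ leftHalf R := by simp [mem_leftHalf]
    have h1 := hk _ (hR hRm)
    rw [(hg _ hRm').1, (hg _ hRm).1, hper] at h1
    intro w hw
    rw [hk w hw]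
    linear_combination -h1
  · rw [(hg w hw).1, show w + b + g (covMap s w) - w - b = g (covMap s w) by ring]
    exact (hg w hw).2

end PoleLog

/-! ### Linear equations with exponentially decaying coefficients -/

section Ray

variable {𝔸 : Type*} [NormedRing 𝔸] [NormedAlgebra ℝ 𝔸]

/-- Solutions of `G' = G M` with `‖M x‖ < C e^{δ x}` change little on `(-∞, x₀]`. -/
lemma norm_sub_le_of_decay {G M : ℝ → 𝔸} {x₀ C δ g : ℝ} (hδ : 0 < δ) (hC : 0 < C) (hg : 0 < g)
    (hG : ∀ x ≤ x₀, HasDerivWithinAt G (G x * M x) (Iic x₀) x)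
    (hM : ∀ x ≤ x₀, ‖M x‖ < C * Real.exp (δ * x)) (hG₀ : ‖G x₀‖ ≤ g) {x : ℝ} (hx : x ≤ x₀) :
    ‖G x - G x₀‖ ≤ g * (Real.exp (C / δ * Real.exp (δ * x₀)) - 1) := by
  set f : ℝ → 𝔸 := fun t => G (x₀ - t) - G x₀
  set N : ℝ → ℝ := fun t => Real.exp (C / δ * (Real.exp (δ * x₀) - Real.exp (δ * (x₀ - t))))
  have hN : ∀ t, HasDerivAt N (N t * (C * Real.exp (δ * (x₀ - t)))) t := fun t => by
    have h1 : HasDerivAt (fun t : ℝ => δ * (x₀ - t)) (δ * -1) t :=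
      (((hasDerivAt_id t).const_sub x₀)).const_mul δ
    have h2 := ((h1.exp.const_sub (Real.exp (δ * x₀))).const_mul (C / δ)).exp
    convert! h2 using 1
    simp only [N]
    field_simp
  have hfd : ∀ t ∈ Ici (0 : ℝ),
      HasDerivWithinAt f (-(G (x₀ - t) * M (x₀ - t))) (Ici 0) t := fun t ht => by
    have h1 : HasDerivWithinAt (fun t : ℝ => x₀ - t) (-1) (Ici 0) t :=
      ((hasDerivAt_id t).const_sub x₀).hasDerivWithinAt
    have h2 := (hG (x₀ - t) (by linarith [mem_Ici.1 ht])).scomp t h1 fun r hr => by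
      have := mem_Ici.1 hr
      show x₀ - r ≤ x₀
      linarith
    simpa [f] using! h2.sub_const (G x₀)
  have key := image_norm_le_of_norm_deriv_right_lt_deriv_boundary (f := f)
    (f' := fun t => -(G (x₀ - t) * M (x₀ - t))) (a := 0) (b := x₀ - x)
    (B := fun t => g * (N t - 1)) (B' := fun t => g * (N t * (C * Real.exp (δ * (x₀ - t)))))
    (fun t ht => ((hfd t ht.1).continuousWithinAt).mono fun r hr => hr.1)
    (fun t ht => (hfd t ht.1).mono (Ici_subset_Ici.2 ht.1))
    (by simp [f, N]) (fun t => ((hN t).sub_const 1).const_mul g)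
    (fun t ht hft => by
      have h1 : ‖G (x₀ - t)‖ ≤ g * N t := by
        have : ‖G (x₀ - t)‖ ≤ ‖f t‖ + ‖G x₀‖ := by
          simpa [f] using norm_add_le (G (x₀ - t) - G x₀) (G x₀)
        rw [hft] at this
        linarith
      have h2 := hM (x₀ - t) (by linarith [ht.1])
      rw [norm_neg]
      have hNt : 0 < g * N t := mul_pos hg (Real.exp_pos _)
      calc ‖G (x₀ - t) * M (x₀ - t)‖ ≤ ‖G (x₀ - t)‖ * ‖M (x₀ - t)‖ := norm_mul_le _ _
        _ ≤ (g * N t) * ‖M (x₀ - t)‖ := by gcongr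
        _ < (g * N t) * (C * Real.exp (δ * (x₀ - t))) := by gcongr
        _ = _ := by ring)
    (x := x₀ - x) ⟨by linarith, le_rfl⟩
  simp only [f, sub_sub_cancel] at key
  refine key.trans ?_
  have : N (x₀ - x) ≤ Real.exp (C / δ * Real.exp (δ * x₀)) := by
    refine Real.exp_le_exp.2 ?_
    have h1 := Real.exp_pos (δ * (x₀ - (x₀ - x)))
    have h2 : 0 ≤ C / δ := by positivity
    nlinarith
  gcongr

end Ray

section Strip

variable {n : ℕ}

/-- The filter of points of a horizontal strip whose real part tends to `-∞`. -/
def stripFilter (K : ℝ) : Filter ℂ := comap Complex.re atBot ⊓ 𝓟 {q | |q.im| ≤ K}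

lemma tendsto_stripFilter_of_norm_le {G : ℂ → MEnd n} {L : MEnd n} {K R : ℝ} {τ : ℝ → ℝ}
    (hτ : Tendsto τ atBot (𝓝 0)) (h : ∀ q : ℂ, q.re ≤ R → |q.im| ≤ K → ‖G q - L‖ ≤ τ q.re) :
    Tendsto G (stripFilter K) (𝓝 L) := by
  rw [tendsto_iff_norm_sub_tendsto_zero]
  refine squeeze_zero' (Eventually.of_forall fun q => norm_nonneg _) ?_
    (hτ.comp (tendsto_comap.mono_left inf_le_left))
  have h1 : ∀ᶠ q in stripFilter K, q.re ≤ R :=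
    (tendsto_comap.mono_left inf_le_left).eventually (eventually_le_atBot R)
  have h2 : ∀ᶠ q in stripFilter K, |q.im| ≤ K := mem_inf_of_right (mem_principal_self _)
  filter_upwards [h1, h2] with q hq1 hq2 using h q hq1 hq2

lemma tendsto_exp_atBot_zero {C δ : ℝ} (hδ : 0 < δ) :
    Tendsto (fun x => C * Real.exp (δ * x)) atBot (𝓝 0) := by
  have := (Real.tendsto_exp_atBot.comp (tendsto_id.const_mul_atBot hδ)).const_mul C
  simpa using! this

lemma tendsto_exp_exp_sub_one {g C δ : ℝ} (hδ : 0 < δ) :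
    Tendsto (fun x => g * (Real.exp (C * Real.exp (δ * x)) - 1)) atBot (𝓝 0) := by
  have h1 := (Real.continuous_exp.tendsto 0).comp (tendsto_exp_atBot_zero (C := C) hδ)
  have h2 := (h1.sub_const 1).const_mul g
  simpa using! h2

/-- Along horizontal rays, a solution of `dG = G η` solves a linear equation. -/
lemma PrimEq.hasDerivWithinAt_ray {S : Set ℂ} {R : ℝ} (hR : leftHalf R ⊆ S) {η : Form n ℂ}
    {G : ℂ → MEnd n} (hG : ∀ q ∈ S, PrimEq S η G q) {p : ℂ} (hp : p.re ≤ R) {x : ℝ}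
    (hx : x ≤ p.re) :
    HasDerivWithinAt (fun x : ℝ => G (x + p.im * Complex.I))
      (G (x + p.im * Complex.I) * η (x + p.im * Complex.I) 1) (Iic p.re) x := by
  have hmem : ∀ x ≤ p.re, (x + p.im * Complex.I : ℂ) ∈ leftHalf R := fun x hx => by
    rw [mem_leftHalf]; simpa using hx.trans hp
  have hc : HasDerivWithinAt (fun x : ℝ => (x + p.im * Complex.I : ℂ)) 1 (Iic p.re) x :=
    ((Complex.ofRealCLM.hasDerivAt (x := x)).add_const _).hasDerivWithinAt
  exact HasFDerivWithinAt.comp_hasDerivWithinAt x (hG _ (hR (hmem x hx))) hc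
    fun y hy => hR (hmem y hy)

/-- A solution of `dG = G η`, with `η` exponentially decaying on horizontal strips, has a limit as
the real part tends to `-∞` along such strips. -/
lemma exists_strip_limit {S : Set ℂ} {R δ : ℝ} (hδ : 0 < δ) (hR : leftHalf R ⊆ S) {η : Form n ℂ}
    {G : ℂ → MEnd n} (hG : ∀ q ∈ S, PrimEq S η G q)
    (hη : ∀ K, ∃ C, ∀ q : ℂ, q.re ≤ R → |q.im| ≤ K → ‖η q‖ ≤ C * Real.exp (δ * q.re)) :
    ∃ L, ∀ K, Tendsto G (stripFilter K) (𝓝 L) := by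
  have hη' : ∀ K, ∃ C > 0, ∀ q : ℂ, q.re ≤ R → |q.im| ≤ K → ‖η q‖ < C * Real.exp (δ * q.re) :=
    fun K => by
      obtain ⟨C, hC⟩ := hη K
      refine ⟨max C 0 + 1, by positivity, fun q h1 h2 => (hC q h1 h2).trans_lt ?_⟩
      have := le_max_left C 0
      gcongr
      linarith
  have hGc : ∀ q ∈ S, ContinuousWithinAt G S q := fun q hq =>
    HasFDerivWithinAt.continuousWithinAt (hG q hq)
  -- `G` is bounded on strips
  have hbdd : ∀ K, ∃ g > 0, ∀ q : ℂ, q.re ≤ R → |q.im| ≤ K → ‖G q‖ ≤ g := by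
    intro K
    obtain ⟨C, hC, hCη⟩ := hη' K
    have hcont : ContinuousOn (fun φ : ℝ => G (R + φ * Complex.I)) (Icc (-K) K) := by
      have : ContinuousOn G S := hGc
      refine this.comp (Continuous.continuousOn (by fun_prop)) fun φ _ => hR ?_
      simp [mem_leftHalf]
    obtain ⟨g₀, hg₀⟩ := isCompact_Icc.exists_bound_of_continuousOn hcont
    set g := max g₀ 0 + 1
    have hg : 0 < g := by positivity
    refine ⟨g * Real.exp (C / δ * Real.exp (δ * R)), by positivity, fun q hq1 hq2 => ?_⟩
    set p : ℂ := R + q.im * Complex.I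
    have hpre : p.re = R := by simp [p]
    have hpim : p.im = q.im := by simp [p]
    have hb : ‖G (p.re + p.im * Complex.I)‖ ≤ g := by
      rw [hpre, hpim]
      exact (hg₀ q.im (abs_le.1 hq2)).trans (by linarith [le_max_left g₀ 0])
    have h1 := norm_sub_le_of_decay (G := fun x : ℝ => G (x + p.im * Complex.I)) (x₀ := p.re)
      (M := fun x : ℝ => η (x + p.im * Complex.I) 1) hδ hC hg
      (fun x hx => PrimEq.hasDerivWithinAt_ray hR hG hpre.le hx) (fun x hx => by
        have h2 := hCη (x + p.im * Complex.I) (by simpa using hx.trans hpre.le)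
          (by simpa [hpim] using hq2)
        simp only [Complex.add_re, Complex.ofReal_re, Complex.mul_re, Complex.I_re, mul_zero,
          Complex.ofReal_im, Complex.I_im, mul_one, sub_self, add_zero] at h2
        exact ((η _).le_opNorm 1).trans_lt (by simpa using h2)) hb (x := q.re)
      (by rw [hpre]; exact hq1)
    have e : ((q.re : ℂ) + p.im * Complex.I) = q := by rw [hpim, Complex.re_add_im]
    simp only [e] at h1
    have h3 : ‖G q‖ ≤ ‖G q - G (p.re + p.im * Complex.I)‖ + ‖G (p.re + p.im * Complex.I)‖ := by
      simpa using norm_add_le (G q - G (p.re + p.im * Complex.I)) (G (p.re + p.im * Complex.I))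
    rw [hpre] at h1 h3 hb
    linarith
  -- the limit along the real axis
  obtain ⟨g₀, hg₀, hGg₀⟩ := hbdd 0
  obtain ⟨C₀, hC₀, hC₀η⟩ := hη' 0
  set τ₀ : ℝ → ℝ := fun x => g₀ * (Real.exp (C₀ / δ * Real.exp (δ * x)) - 1)
  have hτ₀ : Tendsto τ₀ atBot (𝓝 0) := tendsto_exp_exp_sub_one hδ
  have hray : ∀ x y : ℝ, x ≤ y → y ≤ R → ‖G x - G y‖ ≤ τ₀ y := by
    intro x y hxy hyR
    have h1 := norm_sub_le_of_decay (G := fun x : ℝ => G (x + (y : ℂ).im * Complex.I))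
      (x₀ := (y : ℂ).re) (M := fun x : ℝ => η (x + (y : ℂ).im * Complex.I) 1) hδ hC₀ hg₀
      (fun t ht => PrimEq.hasDerivWithinAt_ray hR hG (by simpa using hyR) ht) (fun t ht => by
        have h2 := hC₀η (t + (y : ℂ).im * Complex.I) (by simpa using ht.trans hyR) (by simp)
        simp only [Complex.ofReal_im, Complex.ofReal_zero, zero_mul, add_zero,
          Complex.ofReal_re] at h2 ⊢
        exact ((η _).le_opNorm 1).trans_lt (by simpa using h2))
      (hGg₀ _ (by simpa using hyR) (by simp)) (x := x) (by simpa using hxy)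
    simpa using h1
  obtain ⟨L, hL⟩ : ∃ L, Tendsto (fun x : ℝ => G x) atBot (𝓝 L) := by
    refine cauchy_map_iff_exists_tendsto.1 ?_
    rw [Metric.cauchy_iff]
    refine ⟨inferInstance, fun ε hε => ?_⟩
    have h1 : ∀ᶠ y in atBot, τ₀ y < ε / 2 := hτ₀.eventually (gt_mem_nhds (by positivity))
    obtain ⟨y, hy, hyR⟩ := (h1.and (eventually_le_atBot R)).exists
    refine ⟨(fun x : ℝ => G x) '' Iic y, image_mem_map (Iic_mem_atBot y), ?_⟩
    rintro _ ⟨x₁, hx₁, rfl⟩ _ ⟨x₂, hx₂, rfl⟩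
    have h2 := hray x₁ y hx₁ hyR
    have h3 := hray x₂ y hx₂ hyR
    rw [← dist_eq_norm] at h2 h3
    have := dist_triangle_right (G x₁) (G x₂) (G y)
    linarith
  have hLle : ∀ y ≤ R, ‖G y - L‖ ≤ τ₀ y := fun y hy => by
    have h1 : Tendsto (fun x : ℝ => ‖G x - G y‖) atBot (𝓝 ‖L - G y‖) :=
      (hL.sub_const (G y)).norm
    rw [norm_sub_rev]
    refine le_of_tendsto h1 ?_
    filter_upwards [eventually_le_atBot y] with x hx using hray x y hx hy
  refine ⟨L, fun K => ?_⟩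
  obtain ⟨g, hg, hGg⟩ := hbdd K
  obtain ⟨C, hC, hCη⟩ := hη' K
  have hτ : Tendsto (fun x => τ₀ x + (g * C * K) * Real.exp (δ * x)) atBot (𝓝 0) := by
    simpa using hτ₀.add (tendsto_exp_atBot_zero (C := g * C * K) hδ)
  refine tendsto_stripFilter_of_norm_le hτ (R := R) fun q hq1 hq2 => ?_
  -- the vertical segment from the real axis to `q`
  have hK : 0 ≤ K := (abs_nonneg _).trans hq2
  set T : Set ℂ := {z | z.re = q.re} ∩ {z | |z.im| ≤ K}
  have hT : Convex ℝ T := by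
    have e : T = (Complex.reLm ⁻¹' {q.re}) ∩ (Complex.imLm ⁻¹' (Icc (-K) K)) := by
      ext z; simp [T, abs_le]
    rw [e]
    exact ((convex_singleton _).linear_preimage _).inter ((convex_Icc _ _).linear_preimage _)
  have hTR : ∀ z ∈ T, z.re ≤ R := fun z hz => (hz.1 : z.re = q.re).le.trans hq1
  have hTS : T ⊆ S := fun z hz => hR (hTR z hz)
  have hqT : q ∈ T := ⟨rfl, hq2⟩
  have hq'T : (q.re : ℂ) ∈ T := ⟨by simp, by simpa using hK⟩
  have hvert := hT.norm_image_sub_le_of_norm_hasFDerivWithin_le (f := G)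
    (C := g * (C * Real.exp (δ * q.re)))
    (fun z hz => (hG z (hTS hz)).mono hTS) (fun z hz => by
      refine (ContinuousLinearMap.opNorm_comp_le _ _).trans ?_
      refine mul_le_mul ?_ ?_ (norm_nonneg _) hg.le
      · exact (ContinuousLinearMap.opNorm_mul_apply_le ℝ (MEnd n) (G z)).trans
          (hGg z (hTR z hz) hz.2)
      · have := (hCη z (hTR z hz) hz.2).le
        rwa [show z.re = q.re from hz.1] at this) hq'T hqT
  have hqq : ‖q - (q.re : ℂ)‖ ≤ K := by
    have : q - (q.re : ℂ) = q.im * Complex.I := by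
      apply Complex.ext <;> simp
    rw [this]
    simpa using hq2
  have h1 : ‖G q - L‖ ≤ ‖G q - G (q.re : ℂ)‖ + ‖G (q.re : ℂ) - L‖ :=
    norm_sub_le_norm_sub_add_norm_sub _ _ _
  have h2 := hLle q.re hq1
  have h3 : g * (C * Real.exp (δ * q.re)) * ‖q - (q.re : ℂ)‖
      ≤ g * (C * Real.exp (δ * q.re)) * K := by gcongr
  have h4 : g * (C * Real.exp (δ * q.re)) * K = (g * C * K) * Real.exp (δ * q.re) := by ring
  linarith

end Strip

/-! ### Primitives of pure pole forms -/

section ExpPair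

variable {𝔸 : Type*} [NormedRing 𝔸] [NormedAlgebra ℝ 𝔸]

open NormedSpace

/-- `exp (-(re c) A + (im c) B)`, for commuting `A` and `B`. -/
def expPair (A B : 𝔸) (c : ℂ) : 𝔸 := exp ((-c.re) • A) * exp (c.im • B)

lemma expPair_zero (A B : 𝔸) : expPair A B 0 = 1 := by
  simp [expPair, exp_zero]

lemma commute_exp_smul {A B : 𝔸} (h : Commute A B) (s t : ℝ) :
    Commute (exp (s • A)) (exp (t • B)) := by
  let _ : NormedAlgebra ℚ 𝔸 := NormedAlgebra.restrictScalars ℚ ℝ 𝔸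
  exact ((h.smul_left s).smul_right t).exp

lemma expPair_commute {A B : 𝔸} (h : Commute A B) (c : ℂ) (s t : ℝ) :
    Commute (expPair A B c) (s • A + t • B) := by
  let _ : NormedAlgebra ℚ 𝔸 := NormedAlgebra.restrictScalars ℚ ℝ 𝔸
  have hA : Commute (expPair A B c) A :=
    (((Commute.refl A).smul_left _).exp_left).mul_left ((h.symm.smul_left _).exp_left)
  have hB : Commute (expPair A B c) B :=
    ((h.smul_left _).exp_left).mul_left (((Commute.refl B).smul_left _).exp_left)
  exact (hA.smul_right s).add_right (hB.smul_right t)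

/-- Conjugation with `expPair A B c` is the composition of the conjugations with the exponentials of
multiples of `B` and `A`. -/
lemma expPair_conj {A B : 𝔸} (h : Commute A B) (c : ℂ) (X : 𝔸) :
    expPair A B c * X * expPair A B (-c)
      = exp ((-c.re) • A) * (exp (c.im • B) * X * exp (-(c.im • B))) * exp (-((-c.re) • A)) := by
  have h1 : expPair A B (-c) = exp (-(c.im • B)) * exp (-((-c.re) • A)) := by
    simp only [expPair, Complex.neg_re, Complex.neg_im, ← neg_smul]
    exact (commute_exp_smul h _ _).eq
  rw [h1, expPair]
  simp only [mul_assoc]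

variable [CompleteSpace 𝔸]

lemma hasFDerivAt_expPair {A B : 𝔸} (h : Commute A B) (c : ℂ) :
    HasFDerivAt (expPair A B) ((ContinuousLinearMap.mul ℝ 𝔸 (expPair A B c)).comp
      ((-Complex.reCLM).smulRight A + Complex.imCLM.smulRight B)) c := by
  have h1 : HasFDerivAt (fun c : ℂ => exp ((-c.re) • A)) _ c :=
    HasFDerivAt.comp (g := fun r : ℝ => exp (r • A)) (f := fun c : ℂ => -c.re) c
      (hasDerivAt_exp_smul_const A (-c.re)).hasFDerivAt (-Complex.reCLM).hasFDerivAt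
  have h2 : HasFDerivAt (fun c : ℂ => exp (c.im • B)) _ c :=
    HasFDerivAt.comp (g := fun r : ℝ => exp (r • B)) (f := fun c : ℂ => c.im) c
      (hasDerivAt_exp_smul_const B c.im).hasFDerivAt Complex.imCLM.hasFDerivAt
  refine (h1.mul' h2).congr_fderiv ?_
  refine ContinuousLinearMap.ext fun k => ?_
  let _ : NormedAlgebra ℚ 𝔸 := NormedAlgebra.restrictScalars ℚ ℝ 𝔸
  have hc : A * exp (c.im • B) = exp (c.im • B) * A := ((h.smul_right _).exp_right).eq
  show exp ((-c.re) • A) * (k.im • (exp (c.im • B) * B))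
      + ((-k.re) • (exp ((-c.re) • A) * A)) * exp (c.im • B)
    = expPair A B c * ((-k.re) • A + k.im • B)
  rw [expPair, mul_add, mul_smul_comm, mul_smul_comm, mul_smul_comm, smul_mul_assoc, mul_assoc,
    mul_assoc, mul_assoc, hc, add_comm]

end ExpPair

section PurePole

variable {n : ℕ}

open NormedSpace in
/-- Exponentials of skew endomorphisms are Lorentz transformations. -/
lemma madj_exp {B : MEnd n} (hB : madj B = -B) (t : ℝ) :
    madj (exp (t • B)) = exp (-(t • B)) := by
  have hG : ∀ q ∈ (univ : Set ℝ), PrimEq univ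
      (fun _ => (ContinuousLinearMap.id ℝ ℝ).smulRight B) (fun t : ℝ => exp (t • B)) q := by
    intro q _
    refine ((hasDerivAt_exp_smul_const B q).hasFDerivAt.congr_fderiv ?_).hasFDerivWithinAt
    refine ContinuousLinearMap.ext fun k => ?_
    show k • (exp (q • B) * B) = exp (q • B) * (k • B)
    rw [mul_smul_comm]
  have h1 := (Convex.isGoodDomain (n := n) (convex_univ (𝕜 := ℝ))).mul_madj_eq_one
    (fun q _ k => by
      show madj (k • B) = -(k • B)
      rw [map_smul, hB, smul_neg]) (mem_univ 0) hG hG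
    (by simp only [zero_smul, exp_zero, madj_one, mul_one]) t (mem_univ t)
  have h2 : exp (-(t • B)) * exp (t • B) = 1 := mul_eq_one_symm (exp_mul_exp_neg_real (t • B))
  calc madj (exp (t • B)) = (exp (-(t • B)) * exp (t • B)) * madj (exp (t • B)) := by
        rw [h2, one_mul]
    _ = exp (-(t • B)) := by rw [mul_assoc, h1, mul_one]

lemma madj_conj {T X : MEnd n} (hX : madj X = -X) :
    madj (T * X * madj T) = -(T * X * madj T) := by
  have hTT : madj (madj T) = T := madj_eq_iff.2 fun x y => by
    rw [mink_comm, mink_madj, mink_comm]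
  rw [madj_mul, madj_mul, hX, hTT, mend_neg_mul, mend_mul_neg, mul_assoc]

lemma mend_norm_exp_le (T : MEnd n) : ‖NormedSpace.exp T‖ ≤ Real.exp ‖T‖ := by
  have h1 := NormedSpace.norm_expSeries_summable' (𝕂 := ℝ) T
  have h2 : ∀ k : ℕ, ‖((k.factorial : ℝ)⁻¹) • T ^ k‖ ≤ (k.factorial : ℝ)⁻¹ • ‖T‖ ^ k := fun k => by
    rw [norm_smul, norm_inv, Real.norm_natCast, smul_eq_mul]
    gcongr
    exact norm_pow_le T k
  rw [NormedSpace.exp_eq_tsum ℝ, Real.exp_eq_exp_ℝ, NormedSpace.exp_eq_tsum ℝ]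
  exact (norm_tsum_le_tsum_norm h1).trans
    (h1.tsum_le_tsum h2 (NormedSpace.expSeries_summable' (𝕂 := ℝ) ‖T‖))

variable {Δ : Set ℂ} {s : ℂ} {v w x y : Mink n} {ξ ψ : Form n ℂ}

lemma IsPurePoleForm.wedge_mul_wedge (hξ : IsPurePoleForm Δ s v w x y ξ) :
    wedge v w * wedge x y = 0 ∧ wedge x y * wedge v w = 0 := by
  have hx : x ∈ Submodule.span ℝ {x, y} := Submodule.subset_span (by simp)
  have hy : y ∈ Submodule.span ℝ {x, y} := Submodule.subset_span (by simp)
  have hv : v ∈ Submodule.span ℝ {v, w} := Submodule.subset_span (by simp)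
  have hw : w ∈ Submodule.span ℝ {v, w} := Submodule.subset_span (by simp)
  have h1 := hξ.orthogonal x hx v hv
  have h2 := hξ.orthogonal y hy v hv
  have h3 := hξ.orthogonal x hx w hw
  have h4 := hξ.orthogonal y hy w hw
  exact ⟨PoleForm.wedge_mul_wedge (by rw [mink_comm, h1]) (by rw [mink_comm, h2])
    (by rw [mink_comm, h3]) (by rw [mink_comm, h4]), PoleForm.wedge_mul_wedge h1 h3 h2 h4⟩

lemma IsPurePoleForm.commute (hξ : IsPurePoleForm Δ s v w x y ξ) :
    Commute (wedge v w) (wedge x y) :=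
  hξ.wedge_mul_wedge.1.trans hξ.wedge_mul_wedge.2.symm

lemma IsPurePoleForm.madj_apply (hξ : IsPurePoleForm Δ s v w x y ξ) {Z : ℂ} (hZ : Z ∈ Δ \ {s})
    (h : ℂ) : madj (ξ Z h) = -ξ Z h := by
  obtain ⟨a, -, ha⟩ := hξ.form
  rw [ha Z hZ h, map_sub, map_smul, map_smul, madj_wedge, madj_wedge]
  module

lemma IsPoleForm.madj_apply (hψ : IsPoleForm Δ s ψ) {Z : ℂ} (hZ : Z ∈ Δ \ {s}) (h : ℂ) :
    madj (ψ Z h) = -ψ Z h := mem_lorentzAlgebra_iff.1 (hψ.mem Z hZ h)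

/-- `μ` is a primitive of `-α` on the universal cover, in terms of which the primitives of the pure
pole form are exponentials; see `CoverParam.exists_poleLog` for the remaining properties. -/
structure IsPoleLog (Δ : Set ℂ) (s : ℂ) (v w x y : Mink n) (ξ : Form n ℂ) (μ : ℂ → ℂ) : Prop where
  primEq : ∀ p, ∀ q ∈ cover Δ s, PrimEq (cover Δ s) (pullCover s ξ)
    (fun q => expPair (wedge v w) (wedge x y) (μ q - μ p)) q
  period : ∀ q ∈ cover Δ s, μ (q - 2 * Real.pi * Complex.I) = μ q - 2 * Real.pi * Complex.I
  asymp : ∃ (R : ℝ) (b : ℂ), leftHalf R ⊆ cover Δ s ∧ ∀ w ∈ leftHalf R, ‖μ w - w - b‖ ≤ 1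

lemma CoverParam.exists_isPoleLog (P : CoverParam Δ s) (hs : s ∈ interior Δ)
    (hξ : IsPurePoleForm Δ s v w x y ξ) : ∃ μ, IsPoleLog Δ s v w x y ξ μ := by
  obtain ⟨a, ha, haξ⟩ := hξ.form
  obtain ⟨μ, hμ, hper, has⟩ := P.exists_poleLog hs ha
  refine ⟨μ, fun p q hq => ?_, hper, has⟩
  obtain ⟨μ', hμ', hμ'a⟩ := hμ q hq
  have h1 := (hasFDerivAt_expPair hξ.commute (μ q - μ p)).comp_hasFDerivWithinAt q
    (hμ'.sub_const (μ p))
  refine h1.congr_fderiv ?_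
  refine ContinuousLinearMap.ext fun h => ?_
  show expPair _ _ (μ q - μ p) * ((-(μ' h).re) • wedge v w + (μ' h).im • wedge x y)
    = expPair _ _ (μ q - μ p) * ξ (covMap s q) (fderiv ℝ (covMap s) q h)
  rw [haξ _ hq, hμ'a]
  congr 1
  rw [Complex.neg_re, Complex.neg_im]
  module

end PurePole

section Gauge

variable {n : ℕ} {Δ : Set ℂ} {s : ℂ} {v w x y : Mink n} {ξ ψ : Form n ℂ} {μ : ℂ → ℂ}

/-- `coverPrim Δ s θ p q` is the value at `q` of the primitive, normalized at `p`, of the pullback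
of `θ` to the universal cover. -/
abbrev coverPrim (Δ : Set ℂ) (s : ℂ) (θ : Form n ℂ) (p q : ℂ) : MEnd n :=
  prim (cover Δ s) (pullCover s θ) p q

lemma pullCover_apply (θ : Form n ℂ) (q h : ℂ) :
    pullCover s θ q h = θ (covMap s q) (h * Complex.exp q) := by
  rw [← fderiv_covMap_apply s q h]; rfl

lemma madj_pullCover {θ : Form n ℂ} (hθ : ∀ Z ∈ Δ \ {s}, ∀ h, madj (θ Z h) = -θ Z h) :
    ∀ q ∈ cover Δ s, ∀ h, madj (pullCover s θ q h) = -pullCover s θ q h :=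
  fun _ hq h => hθ _ hq (fderiv ℝ (covMap s) _ h)

lemma CoverParam.hasUniquePrimitives_pullCover (P : CoverParam Δ s) (hψ : IsPoleForm Δ s ψ) :
    HasUniquePrimitives (cover Δ s) (pullCover s ψ) := by
  obtain ⟨p, hp, Γ, hΓ1, hΓ⟩ := P.exists_primitive hψ.smooth hψ.flat
  exact P.isGoodDomain.hasUniquePrimitives (madj_pullCover fun Z hZ h => hψ.madj_apply hZ h) hp hΓ
    hΓ1

lemma IsPoleLog.hasUniquePrimitives (hμ : IsPoleLog Δ s v w x y ξ μ) (P : CoverParam Δ s)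
    (hξ : IsPurePoleForm Δ s v w x y ξ) :
    HasUniquePrimitives (cover Δ s) (pullCover s ξ) := by
  have hp : P.Φ 0 ∈ cover Δ s := P.mapsTo_Φ (by simp [mem_leftHalf])
  exact P.isGoodDomain.hasUniquePrimitives (madj_pullCover fun Z hZ h => hξ.madj_apply hZ h) hp
    (hμ.primEq (P.Φ 0)) (by simp only [sub_self, expPair_zero])

lemma IsPoleLog.prim_eq (hμ : IsPoleLog Δ s v w x y ξ μ) (P : CoverParam Δ s)
    (hξ : IsPurePoleForm Δ s v w x y ξ) {p q : ℂ} (hp : p ∈ cover Δ s) (hq : q ∈ cover Δ s) :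
    coverPrim Δ s ξ p q = expPair (wedge v w) (wedge x y) (μ q - μ p) :=
  (hμ.hasUniquePrimitives P hξ).prim_eq hp (P.isGoodDomain.isPrimitive
    (madj_pullCover fun Z hZ h => hξ.madj_apply hZ h) hp (hμ.primEq p)
    (by simp only [sub_self, expPair_zero])) hq

/-- Primitives of a pure pole form commute with it, so that the gauge transform is obtained by
conjugating the bounded form `ψ - ξ`. -/
lemma IsPoleLog.gaugeTransform_apply (hμ : IsPoleLog Δ s v w x y ξ μ) (P : CoverParam Δ s)
    (hξ : IsPurePoleForm Δ s v w x y ξ) {p q : ℂ} (hp : p ∈ cover Δ s)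
    (hq : q ∈ cover Δ s) (h : ℂ) :
    gaugeTransform Δ s ξ ψ p q h = coverPrim Δ s ξ p q *
      (pullCover s ψ q h - pullCover s ξ q h) * coverPrim Δ s ξ q p := by
  have e1 : gaugeTransform Δ s ξ ψ p q h = coverPrim Δ s ξ p q *
      (pullCover s ψ q h * coverPrim Δ s ξ q p) - pullCover s ξ q h := rfl
  have hcomm : coverPrim Δ s ξ p q * pullCover s ξ q h
      = pullCover s ξ q h * coverPrim Δ s ξ p q := by
    obtain ⟨a, -, ha⟩ := hξ.form
    have e2 : pullCover s ξ q h = ξ (covMap s q) (fderiv ℝ (covMap s) q h) := rfl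
    have e3 : ∀ r t : ℝ, r • wedge v w - t • wedge x y = r • wedge v w + (-t) • wedge x y :=
      fun r t => by module
    rw [e2, ha _ hq, hμ.prim_eq P hξ hp hq, e3]
    exact expPair_commute hξ.commute _ _ _
  have hinv : coverPrim Δ s ξ p q * coverPrim Δ s ξ q p = 1 := by
    rw [P.isGoodDomain.prim_mul (madj_pullCover fun Z hZ h => hξ.madj_apply hZ h)
      (hμ.hasUniquePrimitives P hξ) hp hq hp, (hμ.hasUniquePrimitives P hξ).prim_self hp]
  rw [e1, mul_sub, sub_mul, hcomm, mul_assoc (pullCover s ξ q h), hinv, mul_one, mul_assoc]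

end Gauge

/-! ### The gauge transform -/

section GaugePrimitives

variable {n : ℕ} {Δ : Set ℂ} {s : ℂ} {v w x y : Mink n} {ξ ψ : Form n ℂ} {μ : ℂ → ℂ}

lemma IsPoleLog.madj_coverPrim (hμ : IsPoleLog Δ s v w x y ξ μ) (P : CoverParam Δ s)
    (hξ : IsPurePoleForm Δ s v w x y ξ) {p q : ℂ} (hp : p ∈ cover Δ s) (hq : q ∈ cover Δ s) :
    madj (coverPrim Δ s ξ p q) = coverPrim Δ s ξ q p :=
  P.isGoodDomain.madj_prim (madj_pullCover fun _ hZ h => hξ.madj_apply hZ h)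
    (hμ.hasUniquePrimitives P hξ) hp hq

lemma IsPoleLog.madj_gaugeTransform (hμ : IsPoleLog Δ s v w x y ξ μ) (P : CoverParam Δ s)
    (hξ : IsPurePoleForm Δ s v w x y ξ) (hψ : IsPoleForm Δ s ψ) {p q : ℂ} (hp : p ∈ cover Δ s)
    (hq : q ∈ cover Δ s) (h : ℂ) :
    madj (gaugeTransform Δ s ξ ψ p q h) = -gaugeTransform Δ s ξ ψ p q h := by
  rw [hμ.gaugeTransform_apply P hξ hp hq, ← hμ.madj_coverPrim P hξ hp hq]
  refine madj_conj ?_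
  rw [map_sub, madj_pullCover (fun _ hZ h => hψ.madj_apply hZ h) q hq,
    madj_pullCover (fun _ hZ h => hξ.madj_apply hZ h) q hq]
  abel

lemma IsPoleLog.primEq_gaugeTransform (hμ : IsPoleLog Δ s v w x y ξ μ) (P : CoverParam Δ s)
    (hξ : IsPurePoleForm Δ s v w x y ξ) (hψ : IsPoleForm Δ s ψ) {p q : ℂ} (hp : p ∈ cover Δ s)
    (hq : q ∈ cover Δ s) : PrimEq (cover Δ s) (gaugeTransform Δ s ξ ψ p)
      (fun q => coverPrim Δ s ψ p q * madj (coverPrim Δ s ξ p q)) q := by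
  have hu := hμ.hasUniquePrimitives P hξ
  have hu' := P.hasUniquePrimitives_pullCover hψ
  have h1 := PrimEq.mul_madj ((hu'.isPrimitive hp).deriv q hq) ((hu.isPrimitive hp).deriv q hq)
    (madj_pullCover (fun _ hZ h => hξ.madj_apply hZ h) q hq)
  refine h1.congr_fderiv ?_
  refine ContinuousLinearMap.ext fun h => ?_
  show conjL (coverPrim Δ s ψ p q) (madj (coverPrim Δ s ξ p q))
      (pullCover s ψ q h - pullCover s ξ q h)
    = coverPrim Δ s ψ p q * madj (coverPrim Δ s ξ p q) * gaugeTransform Δ s ξ ψ p q h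
  rw [conjL_apply, hμ.gaugeTransform_apply P hξ hp hq, hμ.madj_coverPrim P hξ hp hq]
  have h2 : coverPrim Δ s ξ q p * coverPrim Δ s ξ p q = 1 := by
    rw [← hμ.madj_coverPrim P hξ hp hq]
    exact hu.madj_mul_self hp hq
  rw [mul_assoc (coverPrim Δ s ψ p q) (coverPrim Δ s ξ q p), ← mul_assoc (coverPrim Δ s ξ q p),
    ← mul_assoc (coverPrim Δ s ξ q p), h2, one_mul, mul_assoc]

lemma IsPoleLog.gauge_base (hμ : IsPoleLog Δ s v w x y ξ μ) (P : CoverParam Δ s)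
    (hξ : IsPurePoleForm Δ s v w x y ξ) (hψ : IsPoleForm Δ s ψ) {p : ℂ} (hp : p ∈ cover Δ s) :
    coverPrim Δ s ψ p p * madj (coverPrim Δ s ξ p p) = 1 := by
  rw [coverPrim, coverPrim, (hμ.hasUniquePrimitives P hξ).prim_self hp,
    (P.hasUniquePrimitives_pullCover hψ).prim_self hp, madj_one, mul_one]

lemma IsPoleLog.hasUniquePrimitives_gaugeTransform (hμ : IsPoleLog Δ s v w x y ξ μ)
    (P : CoverParam Δ s) (hξ : IsPurePoleForm Δ s v w x y ξ) (hψ : IsPoleForm Δ s ψ) {p : ℂ}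
    (hp : p ∈ cover Δ s) : HasUniquePrimitives (cover Δ s) (gaugeTransform Δ s ξ ψ p) :=
  P.isGoodDomain.hasUniquePrimitives (fun _ hq h => hμ.madj_gaugeTransform P hξ hψ hp hq h) hp
    (fun _ hq => hμ.primEq_gaugeTransform P hξ hψ hp hq) (hμ.gauge_base P hξ hψ hp)

/-- The gauge transform is the logarithmic derivative of the quotient of the primitives of `ψ` and
of `ξ`. -/
lemma IsPoleLog.prim_gaugeTransform (hμ : IsPoleLog Δ s v w x y ξ μ)
    (P : CoverParam Δ s) (hξ : IsPurePoleForm Δ s v w x y ξ) (hψ : IsPoleForm Δ s ψ) {p q : ℂ}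
    (hp : p ∈ cover Δ s) (hq : q ∈ cover Δ s) :
    prim (cover Δ s) (gaugeTransform Δ s ξ ψ p) p q
      = coverPrim Δ s ψ p q * coverPrim Δ s ξ q p := by
  rw [← hμ.madj_coverPrim P hξ hp hq]
  exact (hμ.hasUniquePrimitives_gaugeTransform P hξ hψ hp).prim_eq hp
    (P.isGoodDomain.isPrimitive (fun _ hq h => hμ.madj_gaugeTransform P hξ hψ hp hq h) hp
      (fun _ hq => hμ.primEq_gaugeTransform P hξ hψ hp hq) (hμ.gauge_base P hξ hψ hp)) hq

end GaugePrimitives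

section GaugeBound

variable {n : ℕ} {Δ : Set ℂ} {s : ℂ} {v w x y : Mink n} {ξ ψ : Form n ℂ} {μ : ℂ → ℂ}

/-- Conjugation with `expPair (v ∧ w) (x ∧ y) c` on skew endomorphisms grows at most like
`e^{κ |re c| + N |im c|}`, where `κ < 1` by the first kind condition. -/
lemma exists_expPair_conj_le (hξ : IsPurePoleForm Δ s v w x y ξ) (hfirst : FirstKind v w) :
    ∃ κ N K : ℝ, 0 < κ ∧ κ < 1 ∧ 0 ≤ N ∧ 0 ≤ K ∧ ∀ (c : ℂ) (X : MEnd n), madj X = -X →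
      ‖expPair (wedge v w) (wedge x y) c * X * expPair (wedge v w) (wedge x y) (-c)‖
        ≤ K * Real.exp (κ * |c.re| + N * |c.im|) * ‖X‖ := by
  obtain ⟨κ, K, hκ, hκ1, hK, hexp⟩ := exists_exp_conj_le hfirst
  refine ⟨κ, 2 * ‖wedge x y‖, K, hκ, hκ1, by positivity, hK, fun c X hX => ?_⟩
  set T := NormedSpace.exp (c.im • wedge x y)
  set T' := NormedSpace.exp (-(c.im • wedge x y))
  have hTT' : madj T = T' := madj_exp (madj_wedge x y) _
  have hY : madj (T * X * T') = -(T * X * T') := by rw [← hTT']; exact madj_conj hX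
  have hT : ‖T‖ ≤ Real.exp (|c.im| * ‖wedge x y‖) := by
    refine (mend_norm_exp_le _).trans_eq ?_
    rw [norm_smul, Real.norm_eq_abs]
  have hT' : ‖T'‖ ≤ Real.exp (|c.im| * ‖wedge x y‖) := by
    refine (mend_norm_exp_le _).trans_eq ?_
    rw [norm_neg, norm_smul, Real.norm_eq_abs]
  have h1 : ‖T * X * T'‖ ≤ Real.exp (2 * ‖wedge x y‖ * |c.im|) * ‖X‖ := by
    calc ‖T * X * T'‖ ≤ ‖T‖ * ‖X‖ * ‖T'‖ :=
          (norm_mul_le _ _).trans (mul_le_mul_of_nonneg_right (norm_mul_le _ _) (norm_nonneg _))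
      _ ≤ Real.exp (|c.im| * ‖wedge x y‖) * ‖X‖ * Real.exp (|c.im| * ‖wedge x y‖) := by gcongr
      _ = (Real.exp (|c.im| * ‖wedge x y‖) * Real.exp (|c.im| * ‖wedge x y‖)) * ‖X‖ := by ring
      _ = _ := by rw [← Real.exp_add]; ring_nf
  rw [expPair_conj hξ.commute]
  refine (hexp (-c.re) _ hY).trans ?_
  rw [abs_neg, Real.exp_add]
  calc K * Real.exp (κ * |c.re|) * ‖T * X * T'‖
      ≤ K * Real.exp (κ * |c.re|) * (Real.exp (2 * ‖wedge x y‖ * |c.im|) * ‖X‖) := by gcongr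
    _ = _ := by ring

/-- The growth of the gauge transform near the puncture. As `ψ - ξ` is bounded, its pullback is
`O(e^{re q})`, and this dominates the growth of the conjugation. -/
lemma IsPoleLog.exists_gaugeTransform_le (hμ : IsPoleLog Δ s v w x y ξ μ) (P : CoverParam Δ s)
    (hξ : IsPurePoleForm Δ s v w x y ξ) (hfirst : FirstKind v w) (hψ : IsPoleForm Δ s ψ)
    (hbdd : IsBoundedForm Δ s (ψ - ξ)) :
    ∃ (R κ N M : ℝ) (D : ℂ → ℝ), leftHalf R ⊆ cover Δ s ∧ 0 < κ ∧ κ < 1 ∧ 0 ≤ N ∧ 0 ≤ M ∧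
      (∀ p, 0 ≤ D p) ∧ (∀ p ∈ leftHalf R, D p ≤ M) ∧ ∀ p ∈ cover Δ s, ∀ q ∈ leftHalf R,
        ‖gaugeTransform Δ s ξ ψ p q‖
          ≤ D p * Real.exp (κ * |q.re - p.re| + N * |q.im - p.im| + q.re) := by
  obtain ⟨κ, N, K, hκ, hκ1, hN, hK, hexp⟩ := exists_expPair_conj_le hξ hfirst
  obtain ⟨R, b, hR, hb⟩ := hμ.asymp
  obtain ⟨B, hB⟩ := hbdd
  set d : ℂ → ℝ := fun p => 1 + ‖μ p - p - b‖
  refine ⟨R, κ, N, K * max B 0 * Real.exp ((κ + N) * 2),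
    fun p => K * max B 0 * Real.exp ((κ + N) * d p), hR, hκ, hκ1, hN, by positivity,
    fun p => by positivity, fun p hp => ?_, fun p hp q hq => ?_⟩
  · have : d p ≤ 2 := by have := hb p hp; simp only [d]; linarith
    have : 0 < κ + N := by linarith
    show K * max B 0 * Real.exp ((κ + N) * d p) ≤ K * max B 0 * Real.exp ((κ + N) * 2)
    gcongr
  have hqc := hR hq
  set c := μ q - μ p
  have hc : ‖c - (q - p)‖ ≤ d p := by
    have : c - (q - p) = (μ q - q - b) - (μ p - p - b) := by simp only [c]; ring
    rw [this]
    exact (norm_sub_le _ _).trans (by simp only [d]; gcongr; exact hb q hq)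
  have hre : |c.re| ≤ |q.re - p.re| + d p := by
    have h1 := (Complex.abs_re_le_norm (c - (q - p))).trans hc
    rw [Complex.sub_re, Complex.sub_re q] at h1
    have h2 := abs_sub_abs_le_abs_sub c.re (q.re - p.re)
    linarith
  have him : |c.im| ≤ |q.im - p.im| + d p := by
    have h1 := (Complex.abs_im_le_norm (c - (q - p))).trans hc
    rw [Complex.sub_im, Complex.sub_im q] at h1
    have h2 := abs_sub_abs_le_abs_sub c.im (q.im - p.im)
    linarith
  refine ContinuousLinearMap.opNorm_le_bound _ (by positivity) fun h => ?_
  set X := pullCover s ψ q h - pullCover s ξ q h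
  have hX : madj X = -X := by
    simp only [X]
    rw [map_sub, madj_pullCover (fun _ hZ h => hψ.madj_apply hZ h) q hqc,
      madj_pullCover (fun _ hZ h => hξ.madj_apply hZ h) q hqc]
    abel
  have hXn : ‖X‖ ≤ max B 0 * (Real.exp q.re * ‖h‖) := by
    have h1 : X = (ψ - ξ) (covMap s q) (h * Complex.exp q) := by
      simp only [X]
      rw [pullCover_apply, pullCover_apply]
      rfl
    rw [h1]
    refine (ContinuousLinearMap.le_opNorm _ _).trans ?_
    rw [norm_mul, Complex.norm_exp, mul_comm ‖h‖]
    gcongr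
    exact (hB _ hqc).trans (le_max_left _ _)
  rw [hμ.gaugeTransform_apply P hξ hp hqc, hμ.prim_eq P hξ hp hqc, hμ.prim_eq P hξ hqc hp,
    show μ p - μ q = -c by simp only [c]; ring]
  refine (hexp c X hX).trans ?_
  have hle : κ * |c.re| + N * |c.im|
      ≤ (κ + N) * d p + (κ * |q.re - p.re| + N * |q.im - p.im|) := by
    have h1 := mul_le_mul_of_nonneg_left hre hκ.le
    have h2 := mul_le_mul_of_nonneg_left him hN
    linarith
  calc K * Real.exp (κ * |c.re| + N * |c.im|) * ‖X‖
      ≤ K * Real.exp ((κ + N) * d p + (κ * |q.re - p.re| + N * |q.im - p.im|))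
        * (max B 0 * (Real.exp q.re * ‖h‖)) := by gcongr
    _ = _ := by rw [Real.exp_add, Real.exp_add _ q.re]; ring

end GaugeBound

/-! ### The limit map -/

section Limit

variable {n : ℕ} {Δ : Set ℂ} {s : ℂ} {v w x y : Mink n} {ξ ψ : Form n ℂ}

lemma tendsto_horizontal (φ : ℝ) :
    Tendsto (fun x : ℝ => (x + φ * Complex.I : ℂ)) atBot (stripFilter |φ|) := by
  refine tendsto_inf.2 ⟨tendsto_comap_iff.2 ?_, tendsto_principal.2 (Eventually.of_forall ?_)⟩
  · refine tendsto_id.congr fun x => ?_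
    simp
  · intro x
    simp

lemma tendsto_re_toS : Tendsto (fun q : cover Δ s => (q : ℂ).re) (toS Δ s) atBot := by
  refine tendsto_atBot.2 fun M => ?_
  set A : Set (BranchedCover Δ s) :=
    insert (branchPoint Δ s) (toBranched '' {q : cover Δ s | ‖Complex.exp (q : ℂ)‖ < Real.exp M})
  have hpre : toBranched ⁻¹' A = {q : cover Δ s | ‖Complex.exp (q : ℂ)‖ < Real.exp M} := by
    ext q
    constructor
    · rintro (h | ⟨q', hq', h⟩)
      · cases h
      · cases h
        exact hq'
    · intro h
      exact Or.inr ⟨q, h, rfl⟩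
  have hA : IsOpen A := by
    refine ⟨?_, fun _ => ⟨Real.exp M, Real.exp_pos M, fun q hq => Or.inr ⟨q, hq, rfl⟩⟩⟩
    rw [hpre]
    exact isOpen_lt (by fun_prop) continuous_const
  have hmem : toBranched ⁻¹' A ∈ toS Δ s :=
    preimage_mem_comap (hA.mem_nhds (mem_insert _ _))
  filter_upwards [hmem] with q hq
  rw [hpre] at hq
  have hq' : ‖Complex.exp (q : ℂ)‖ < Real.exp M := hq
  rw [Complex.norm_exp, Real.exp_lt_exp] at hq'
  exact hq'.le

lemma IsApproach.tendsto_stripFilter {C : Set (cover Δ s)} (hC : IsApproach C) :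
    ∃ K, Tendsto (fun q : cover Δ s => (q : ℂ)) (toS Δ s ⊓ 𝓟 C) (stripFilter K) := by
  obtain ⟨K, hK⟩ := hC.angle
  refine ⟨K, tendsto_inf.2 ⟨tendsto_comap_iff.2 (tendsto_re_toS.mono_left inf_le_left), ?_⟩⟩
  exact tendsto_principal.2 (mem_inf_of_right hK)

/-- The limits of the primitives of the gauge transforms at the puncture, and their behaviour when
the base point approaches the puncture. -/
lemma exists_gauge_limit (P : CoverParam Δ s) (hs : s ∈ interior Δ)
    (hξ : IsPurePoleForm Δ s v w x y ξ) (hfirst : FirstKind v w)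
    (hψ : IsPoleForm Δ s ψ) (hbdd : IsBoundedForm Δ s (ψ - ξ)) :
    ∃ L : cover Δ s → MEnd n, (∀ p, L p ∈ orthochronous n) ∧
      (∀ (p : cover Δ s) (K : ℝ), Tendsto (prim (cover Δ s) (gaugeTransform Δ s ξ ψ p) p)
        (stripFilter K) (𝓝 (L p))) ∧
      Tendsto L (toS Δ s) (𝓝 1) := by
  obtain ⟨μ, hμ⟩ := P.exists_isPoleLog hs hξ
  obtain ⟨R, κ, N, M, D, hR, hκ, hκ1, hN, hM, hD, hDM, hle⟩ :=
    hμ.exists_gaugeTransform_le P hξ hfirst hψ hbdd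
  have hδ : 0 < 1 - κ := by linarith
  have hprim : ∀ p : cover Δ s, IsPrimitive (cover Δ s) (gaugeTransform Δ s ξ ψ p) p
      (prim (cover Δ s) (gaugeTransform Δ s ξ ψ p) p) := fun p =>
    (hμ.hasUniquePrimitives_gaugeTransform P hξ hψ p.2).isPrimitive p.2
  have hlim : ∀ p : cover Δ s, ∃ L, ∀ K, Tendsto (prim (cover Δ s) (gaugeTransform Δ s ξ ψ p) p)
      (stripFilter K) (𝓝 L) := fun p => by
    refine exists_strip_limit hδ hR (hprim p).deriv fun K =>
      ⟨D p * Real.exp (κ * (R + |R - (p : ℂ).re|) + N * (K + |(p : ℂ).im|)), fun q hq1 hq2 => ?_⟩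
    refine (hle p p.2 q hq1).trans ?_
    rw [mul_assoc, ← Real.exp_add]
    have h1 : |q.re - (p : ℂ).re| ≤ R - q.re + |R - (p : ℂ).re| := by
      have := abs_sub_le q.re R (p : ℂ).re
      rwa [abs_sub_comm q.re R, abs_of_nonneg (show 0 ≤ R - q.re by linarith)] at this
    have h2 : |q.im - (p : ℂ).im| ≤ K + |(p : ℂ).im| :=
      (abs_sub _ _).trans (by gcongr)
    have h3 := mul_le_mul_of_nonneg_left h1 hκ.le
    have h4 := mul_le_mul_of_nonneg_left h2 hN
    refine mul_le_mul_of_nonneg_left (Real.exp_le_exp.2 ?_) (hD p)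
    linarith
  choose L hL using hlim
  refine ⟨L, fun p => ?_, hL, ?_⟩
  · refine isClosed_orthochronous.mem_of_tendsto ((hL p _).comp (tendsto_horizontal 0)) ?_
    filter_upwards [eventually_le_atBot R] with x hx
    exact (hprim p).mem _ (hR (by rw [mem_leftHalf]; simpa using hx))
  · -- along the horizontal ray from `p`, the gauge transform is `O(e^{κ re p + (1 - κ) re q})`
    have hnear : ∀ p : cover Δ s, (p : ℂ).re ≤ R → ‖L p - 1‖ ≤ (‖(1 : MEnd n)‖ + 1) *
        (Real.exp ((M + 1) / (1 - κ) * Real.exp (1 * (p : ℂ).re)) - 1) := fun p hpR => by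
      have hlim := ((hL p _).comp (tendsto_horizontal (p : ℂ).im)).sub_const 1 |>.norm
      refine le_of_tendsto hlim ?_
      filter_upwards [eventually_le_atBot (p : ℂ).re] with t ht
      have h1 := norm_sub_le_of_decay
        (G := fun t : ℝ =>
          prim (cover Δ s) (gaugeTransform Δ s ξ ψ p) p (t + (p : ℂ).im * Complex.I))
        (M := fun t : ℝ => gaugeTransform Δ s ξ ψ p (t + (p : ℂ).im * Complex.I) 1)
        (x₀ := (p : ℂ).re) (C := (M + 1) * Real.exp (κ * (p : ℂ).re)) (g := ‖(1 : MEnd n)‖ + 1)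
        hδ (by positivity) (by positivity)
        (fun t ht => PrimEq.hasDerivWithinAt_ray hR (hprim p).deriv hpR ht) (fun t ht => by
          have hmem : (t + (p : ℂ).im * Complex.I) ∈ leftHalf R := by
            rw [mem_leftHalf]; simpa using ht.trans hpR
          have h2 := hle p p.2 _ hmem
          have hre : (t + (p : ℂ).im * Complex.I).re = t := by simp
          have him : (t + (p : ℂ).im * Complex.I).im = (p : ℂ).im := by simp
          rw [hre, him, sub_self, abs_zero, mul_zero, add_zero, abs_of_nonpos (by linarith)] at h2
          calc _ ≤ ‖gaugeTransform Δ s ξ ψ p (t + (p : ℂ).im * Complex.I)‖ * ‖(1 : ℂ)‖ :=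
                ContinuousLinearMap.le_opNorm _ _
            _ ≤ D p * Real.exp (κ * -(t - (p : ℂ).re) + t) := by rw [norm_one, mul_one]; exact h2
            _ < (M + 1) * Real.exp (κ * -(t - (p : ℂ).re) + t) := by
                gcongr
                linarith [hDM p hpR]
            _ = (M + 1) * Real.exp (κ * (p : ℂ).re) * Real.exp ((1 - κ) * t) := by
                rw [mul_assoc, ← Real.exp_add]
                ring_nf) (by
          rw [Complex.re_add_im, (hprim p).base]
          linarith) ht
      simp only [Complex.re_add_im, (hprim p).base] at h1
      refine h1.trans_eq ?_
      have : (M + 1) * Real.exp (κ * (p : ℂ).re) / (1 - κ) * Real.exp ((1 - κ) * (p : ℂ).re)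
          = (M + 1) / (1 - κ) * Real.exp (1 * (p : ℂ).re) := by
        rw [show 1 * (p : ℂ).re = κ * (p : ℂ).re + (1 - κ) * (p : ℂ).re by ring, Real.exp_add]
        ring
      rw [this]
    rw [tendsto_iff_norm_sub_tendsto_zero]
    refine squeeze_zero' (Eventually.of_forall fun q => norm_nonneg _) ?_
      ((tendsto_exp_exp_sub_one (g := ‖(1 : MEnd n)‖ + 1) (C := (M + 1) / (1 - κ))
        one_pos).comp tendsto_re_toS)
    filter_upwards [tendsto_re_toS.eventually (eventually_le_atBot R)] with p hp using hnear p hp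

end Limit

/-! ### Monodromy -/

section Monodromy

variable {n : ℕ} {Δ : Set ℂ} {s : ℂ}

/-- A loop of winding number `-1` lifts to a curve that ends at the translate of its initial point
by `-2πi`. -/
lemma IsMonodromyLoop.exists_lift {P p : ℂ} {γ : ℝ → ℂ} (hγ : IsMonodromyLoop Δ s P γ)
    (hp : covMap s p = P) : ∃ γ' : ℝ → ℂ, γ' 0 = p ∧
      γ' (2 * Real.pi) = p - 2 * Real.pi * Complex.I ∧
      ∀ t ∈ Icc 0 (2 * Real.pi), covMap s (γ' t) = γ t ∧
        HasDerivWithinAt γ' (derivWithin γ (Icc 0 (2 * Real.pi)) t / (γ t - s))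
          (Icc 0 (2 * Real.pi)) t := by
  have hpi : (0 : ℝ) < 2 * Real.pi := by positivity
  set I := Icc 0 (2 * Real.pi)
  set g : ℝ → ℂ := fun t => derivWithin γ I t / (γ t - s)
  have hne : ∀ t ∈ I, γ t - s ≠ 0 := fun t ht => sub_ne_zero.2 (hγ.mapsTo ht).2
  have hu : UniqueDiffOn ℝ I := uniqueDiffOn_Icc hpi
  have hg : ContinuousOn g I :=
    (hγ.contDiff.continuousOn_derivWithin hu le_rfl).div
      (hγ.contDiff.continuousOn.sub continuousOn_const) hne
  set G : ℝ → ℂ := IccExtend hpi.le (I.domRestrict g)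
  have hG : Continuous G := (continuousOn_iff_continuous_domRestrict.1 hg).Icc_extend'
  have hGg : ∀ t ∈ I, G t = g t := fun t ht => IccExtend_of_mem hpi.le (I.domRestrict g) ht
  set γ' : ℝ → ℂ := fun t => p + ∫ r in (0 : ℝ)..t, G r
  have hγ' : ∀ t, HasDerivAt γ' (G t) t := fun t =>
    (intervalIntegral.integral_hasDerivAt_right (hG.intervalIntegrable _ _)
      (hG.stronglyMeasurableAtFilter _ _) hG.continuousAt).const_add p
  have h0 : γ' 0 = p := by simp [γ']
  refine ⟨γ', h0, ?_, fun t ht => ⟨?_, ?_⟩⟩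
  · have h1 : ∫ r in (0 : ℝ)..(2 * Real.pi), G r = ∫ r in (0 : ℝ)..(2 * Real.pi), g r :=
      intervalIntegral.integral_congr fun r hr => hGg r (by rwa [uIcc_of_le hpi.le] at hr)
    have h2 := hγ.winding
    have h3 : (2 * Real.pi * Complex.I : ℂ) ≠ 0 := Complex.two_pi_I_ne_zero
    rw [inv_mul_eq_iff_eq_mul₀ h3] at h2
    show p + _ = _
    rw [h1, h2]
    ring
  · -- the quotient of both sides is constant
    have hder : ∀ r ∈ I,
        HasDerivWithinAt (fun r => (γ r - s) * Complex.exp (-γ' r)) 0 I r := fun r hr => by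
      have h1 :=
        (((hγ.contDiff r hr).differentiableWithinAt (by simp)).hasDerivWithinAt).sub_const s
      have h2 := ((hγ' r).hasDerivWithinAt (s := I)).neg.cexp
      refine (h1.mul h2).congr_deriv ?_
      rw [hGg r hr]
      simp only [g]
      have := hne r hr
      field_simp
      ring
    have hconst := (convex_Icc 0 (2 * Real.pi)).norm_image_sub_le_of_norm_hasDerivWithin_le
      (C := 0) hder (by simp) (left_mem_Icc.2 hpi.le) ht
    rw [zero_mul] at hconst
    have h1 := sub_eq_zero.1 (norm_le_zero_iff.1 hconst)
    simp only [h0, hγ.start, ← hp, covMap, add_sub_cancel_left] at h1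
    rw [← Complex.exp_add, add_neg_cancel, Complex.exp_zero] at h1
    have h2 : γ t - s = Complex.exp (γ' t) := by
      calc γ t - s = (γ t - s) * Complex.exp (-γ' t) * Complex.exp (γ' t) := by
            rw [mul_assoc, ← Complex.exp_add, neg_add_cancel, Complex.exp_zero, mul_one]
        _ = _ := by rw [h1, one_mul]
    rw [covMap, ← h2]
    ring
  · have := (hγ' t).hasDerivWithinAt (s := I)
    rwa [hGg t ht] at this

lemma mem_cover_of_covMap_eq {P p : ℂ} {γ : ℝ → ℂ} (hγ : IsMonodromyLoop Δ s P γ)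
    (hp : covMap s p = P) : p ∈ cover Δ s := by
  show covMap s p ∈ Δ \ {s}
  rw [hp, ← hγ.start]
  exact hγ.mapsTo (left_mem_Icc.2 (by positivity))

/-- The monodromy of a form is the value of a primitive on the universal cover. -/
lemma IsMonodromyLoop.monodromy_eq {θ : Form n ℂ}
    (hθ : ∀ Z ∈ Δ \ {s}, ∀ h, madj (θ Z h) = -θ Z h)
    (hu : HasUniquePrimitives (cover Δ s) (pullCover s θ)) {P p : ℂ} {γ : ℝ → ℂ}
    (hγ : IsMonodromyLoop Δ s P γ) (hp : covMap s p = P) :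
    HasUniquePrimitives (Icc 0 (2 * Real.pi)) (pullCurve γ θ) ∧
      monodromy θ γ = coverPrim Δ s θ p (p - 2 * Real.pi * Complex.I) := by
  have hpi : (0 : ℝ) < 2 * Real.pi := by positivity
  obtain ⟨γ', h0, h2, hγ'⟩ := hγ.exists_lift hp
  set I := Icc 0 (2 * Real.pi)
  have h0I : (0 : ℝ) ∈ I := left_mem_Icc.2 hpi.le
  have hpc := mem_cover_of_covMap_eq hγ hp
  have hmaps : MapsTo γ' I (cover Δ s) := fun t ht => by
    show covMap s (γ' t) ∈ Δ \ {s}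
    rw [(hγ' t ht).1]
    exact hγ.mapsTo ht
  have hskew : ∀ t ∈ I, ∀ k, madj (pullCurve γ θ t k) = -pullCurve γ θ t k := fun t ht k =>
    hθ _ (hγ.mapsTo ht) (fderivWithin ℝ γ I t k)
  have hI : IsGoodDomain n I := Convex.isGoodDomain (convex_Icc 0 (2 * Real.pi))
  have hG : ∀ t ∈ I, PrimEq I (pullCurve γ θ) (fun t => coverPrim Δ s θ p (γ' t)) t :=
      fun t ht => by
    have h1 := HasFDerivWithinAt.comp t ((hu.isPrimitive hpc).deriv _ (hmaps ht))
      (hγ' t ht).2.hasFDerivWithinAt hmaps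
    refine h1.congr_fderiv ?_
    refine ContinuousLinearMap.ext fun k => ?_
    show coverPrim Δ s θ p (γ' t) * pullCover s θ (γ' t) (k • (derivWithin γ I t / (γ t - s)))
      = coverPrim Δ s θ p (γ' t) * θ (γ t) (fderivWithin ℝ γ I t k)
    have h3 : Complex.exp (γ' t) = γ t - s := by rw [← (hγ' t ht).1, covMap]; ring
    have h4 : γ t - s ≠ 0 := sub_ne_zero.2 (hγ.mapsTo ht).2
    have h5 : fderivWithin ℝ γ I t k = k • derivWithin γ I t := by
      rw [← fderivWithin_derivWithin, ← map_smul, smul_eq_mul, mul_one]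
    rw [pullCover_apply, (hγ' t ht).1, h3, h5, smul_mul_assoc, div_mul_cancel₀ _ h4]
  have hbase : coverPrim Δ s θ p (γ' 0) = 1 := by
    rw [h0]; exact hu.prim_self hpc
  have hI' := hI.hasUniquePrimitives hskew h0I hG hbase
  refine ⟨hI', ?_⟩
  rw [← h2]
  exact hI'.prim_eq h0I (hI.isPrimitive hskew h0I hG hbase) (right_mem_Icc.2 hpi.le)

/-- Primitives on the universal cover are invariant under the deck transformation. -/
lemma coverPrim_sub_two_pi {θ : Form n ℂ} (hu : HasUniquePrimitives (cover Δ s) (pullCover s θ))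
    {p q : ℂ} (hp : p ∈ cover Δ s) (hq : q ∈ cover Δ s) :
    coverPrim Δ s θ (p - 2 * Real.pi * Complex.I) (q - 2 * Real.pi * Complex.I)
      = coverPrim Δ s θ p q := by
  have hmaps : MapsTo (fun q => q - 2 * Real.pi * Complex.I) (cover Δ s) (cover Δ s) :=
    fun q hq => cover_sub_mem hq
  have hprim := hu.isPrimitive (cover_sub_mem hp)
  refine (hu.prim_eq hp (Γ := fun q => coverPrim Δ s θ (p - 2 * Real.pi * Complex.I)
    (q - 2 * Real.pi * Complex.I)) ⟨fun q hq => hprim.mem _ (hmaps hq), fun q hq => ?_,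
      hprim.base⟩ hq).symm
  have h1 : HasFDerivWithinAt (fun q : ℂ => q - 2 * Real.pi * Complex.I)
      (ContinuousLinearMap.id ℝ ℂ) (cover Δ s) q := (hasFDerivWithinAt_id q _).sub_const _
  refine (HasFDerivWithinAt.comp q (hprim.deriv _ (hmaps hq)) h1 hmaps).congr_fderiv ?_
  refine ContinuousLinearMap.ext fun h => ?_
  show _ * pullCover s θ (q - 2 * Real.pi * Complex.I) h = _ * pullCover s θ q h
  have h2 : covMap s (q - 2 * Real.pi * Complex.I) = covMap s q := by
    have := covMap_add_two_pi s q (-1)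
    rwa [show q - 2 * Real.pi * Complex.I = q + (-1 : ℤ) * (2 * Real.pi * Complex.I) by
      push_cast; ring]
  have h3 : Complex.exp (q - 2 * Real.pi * Complex.I) = Complex.exp q := by
    rw [covMap, covMap] at h2
    exact add_left_cancel h2
  rw [pullCover_apply, pullCover_apply, h2, h3]

lemma tendsto_ofReal_stripFilter :
    Tendsto (fun x : ℝ => (x : ℂ)) atBot (stripFilter 0) := by
  simpa using tendsto_horizontal 0

lemma tendsto_sub_two_pi_stripFilter :
    Tendsto (fun q : ℂ => q - 2 * Real.pi * Complex.I) (stripFilter 0)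
      (stripFilter (2 * Real.pi)) := by
  refine tendsto_inf.2 ⟨tendsto_comap_iff.2 ?_, tendsto_principal.2 (mem_inf_of_right ?_)⟩
  · refine (tendsto_comap.mono_left inf_le_left : Tendsto Complex.re (stripFilter 0) atBot).congr
      fun q => ?_
    simp
  · intro q hq
    have hq' : q.im = 0 := abs_nonpos_iff.1 hq
    show |(q - 2 * Real.pi * Complex.I).im| ≤ 2 * Real.pi
    simp [hq', abs_of_pos Real.pi_pos]

end Monodromy

section Main

variable {n : ℕ} {Δ : Set ℂ} {s : ℂ} {v w x y : Mink n} {ξ ψ : Form n ℂ} {μ : ℂ → ℂ}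

lemma IsPoleLog.coverPrim_period (hμ : IsPoleLog Δ s v w x y ξ μ) (P : CoverParam Δ s)
    (hξ : IsPurePoleForm Δ s v w x y ξ) {p : ℂ} (hp : p ∈ cover Δ s) :
    coverPrim Δ s ξ p (p - 2 * Real.pi * Complex.I)
      = NormedSpace.exp (-(2 * Real.pi) • wedge x y) := by
  rw [hμ.prim_eq P hξ hp (cover_sub_mem hp), hμ.period p hp,
    show μ p - 2 * Real.pi * Complex.I - μ p = -(2 * Real.pi * Complex.I) by ring, expPair]
  have h1 : (-(2 * Real.pi * Complex.I)).re = 0 := by simp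
  have h2 : (-(2 * Real.pi * Complex.I)).im = -(2 * Real.pi) := by simp
  rw [h1, h2, neg_zero, zero_smul, NormedSpace.exp_zero, one_mul]

/-- Translating the point of evaluation by `-2πi` multiplies the primitive of the gauge transform
by the monodromies. -/
lemma IsPoleLog.prim_gaugeTransform_sub_two_pi (hμ : IsPoleLog Δ s v w x y ξ μ)
    (P : CoverParam Δ s) (hξ : IsPurePoleForm Δ s v w x y ξ) (hψ : IsPoleForm Δ s ψ) {p q : ℂ}
    (hp : p ∈ cover Δ s) (hq : q ∈ cover Δ s) :
    prim (cover Δ s) (gaugeTransform Δ s ξ ψ p) p (q - 2 * Real.pi * Complex.I)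
        * coverPrim Δ s ξ p (p - 2 * Real.pi * Complex.I)
      = coverPrim Δ s ψ p (p - 2 * Real.pi * Complex.I)
        * prim (cover Δ s) (gaugeTransform Δ s ξ ψ p) p q := by
  have hu := hμ.hasUniquePrimitives P hξ
  have hu' := P.hasUniquePrimitives_pullCover hψ
  have hp' := cover_sub_mem hp
  have hq' := cover_sub_mem hq
  rw [hμ.prim_gaugeTransform P hξ hψ hp hq, hμ.prim_gaugeTransform P hξ hψ hp hq', mul_assoc,
    P.isGoodDomain.prim_mul (madj_pullCover fun _ hZ h => hξ.madj_apply hZ h) hu hq' hp hp',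
    ← show _ = coverPrim Δ s ψ p _ from P.isGoodDomain.prim_mul
      (madj_pullCover fun _ hZ h => hψ.madj_apply hZ h) hu' hp hp' hq', mul_assoc]
  congr 1
  exact congrArg₂ (· * ·) (coverPrim_sub_two_pi hu' hp hq) (coverPrim_sub_two_pi hu hq hp)

end Main

end PoleForm

end

open PoleForm

theorem proposition3p6 (n : ℕ) (Δ : Set ℂ) (hΔ : IsClosedDisc Δ) (s : ℂ) (hs : s ∈ interior Δ)
    (v w x y : Mink n) (ξ ψ : Form n ℂ)
    (hξ : IsPurePoleForm Δ s v w x y ξ) (hfirst : FirstKind v w)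
    (hψ : IsPoleForm Δ s ψ) (hbdd : IsBoundedForm Δ s (ψ - ξ)) :
    -- all primitives that occur below exist and are unique
    HasUniquePrimitives (cover Δ s) (pullCover s ψ) ∧
    HasUniquePrimitives (cover Δ s) (pullCover s ξ) ∧
    (∀ p ∈ cover Δ s, HasUniquePrimitives (cover Δ s) (gaugeTransform Δ s ξ ψ p)) ∧
    (∀ P ∈ Δ \ {s}, ∀ γ : ℝ → ℂ, IsMonodromyLoop Δ s P γ →
      HasUniquePrimitives (Icc 0 (2 * Real.pi)) (pullCurve γ ψ) ∧
      HasUniquePrimitives (Icc 0 (2 * Real.pi)) (pullCurve γ ξ)) ∧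
    -- factorization of the primitives of `ψ`
    (∀ p ∈ cover Δ s, ∀ q ∈ cover Δ s,
      prim (cover Δ s) (pullCover s ψ) p q =
        prim (cover Δ s) (gaugeTransform Δ s ξ ψ p) p q * prim (cover Δ s) (pullCover s ξ) p q) ∧
    -- change of the base point
    (∀ p ∈ cover Δ s, ∀ p' ∈ cover Δ s, ∀ q ∈ cover Δ s,
      prim (cover Δ s) (gaugeTransform Δ s ξ ψ p') p' q =
        prim (cover Δ s) (pullCover s ψ) p' p * prim (cover Δ s) (gaugeTransform Δ s ξ ψ p) p q *
          prim (cover Δ s) (pullCover s ξ) p p') ∧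
    -- the limit map
    ∃ L : cover Δ s → MEnd n,
      (∀ p, L p ∈ orthochronous n) ∧
      (∀ C : Set (cover Δ s), IsApproach C → ∀ p : cover Δ s,
        Tendsto (fun q : cover Δ s => prim (cover Δ s) (gaugeTransform Δ s ξ ψ p) (p : ℂ) (q : ℂ))
          (toS Δ s ⊓ 𝓟 C) (𝓝 (L p))) ∧
      (SpanDegenerate v w ∨ SpanSpacelike v w → Tendsto L (toS Δ s) (𝓝 1)) ∧
      -- the monodromy
      (∀ P ∈ Δ \ {s}, ∀ γ : ℝ → ℂ, IsMonodromyLoop Δ s P γ →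
        monodromy ξ γ = NormedSpace.exp (-(2 * Real.pi) • wedge x y) ∧
        ∀ p : cover Δ s, covMap s p = P →
          monodromy ψ γ = L p * monodromy ξ γ * Ring.inverse (L p)) := by
  obtain ⟨hP⟩ := nonempty_coverParam hΔ hs
  obtain ⟨μ, hμ⟩ := hP.exists_isPoleLog hs hξ
  have huξ := hμ.hasUniquePrimitives hP hξ
  have huψ := hP.hasUniquePrimitives_pullCover hψ
  have hskξ : ∀ Z ∈ Δ \ {s}, ∀ h, madj (ξ Z h) = -ξ Z h := fun _ hZ h => hξ.madj_apply hZ h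
  have hskψ : ∀ Z ∈ Δ \ {s}, ∀ h, madj (ψ Z h) = -ψ Z h := fun _ hZ h => hψ.madj_apply hZ h
  have hmulξ := fun {p q r : ℂ} => hP.isGoodDomain.prim_mul (madj_pullCover hskξ) huξ
    (p := p) (q := q) (r := r)
  have hmulψ := fun {p q r : ℂ} => hP.isGoodDomain.prim_mul (madj_pullCover hskψ) huψ
    (p := p) (q := q) (r := r)
  have hlog : ∀ P ∈ Δ \ {s}, ∃ p, covMap s p = P := fun P hP => ⟨Complex.log (P - s), by
    rw [covMap, Complex.exp_log (sub_ne_zero.2 hP.2), add_sub_cancel]⟩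
  -- `L p → 1` holds for all pure pole forms of the first kind
  obtain ⟨L, hLO, hL, hL1⟩ := exists_gauge_limit hP hs hξ hfirst hψ hbdd
  refine ⟨huψ, huξ, fun p hp => hμ.hasUniquePrimitives_gaugeTransform hP hξ hψ hp,
    fun P hPΔ γ hγ => ?_, fun p hp q hq => ?_, fun p hp p' hp' q hq => ?_, L, hLO,
    fun C hC p => ?_, fun _ => hL1, fun P hPΔ γ hγ => ⟨?_, fun p hp => ?_⟩⟩
  · obtain ⟨p, hp⟩ := hlog P hPΔ
    exact ⟨(hγ.monodromy_eq hskψ huψ hp).1, (hγ.monodromy_eq hskξ huξ hp).1⟩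
  · rw [hμ.prim_gaugeTransform hP hξ hψ hp hq, mul_assoc, hmulξ hq hp hq, huξ.prim_self hq, mul_one]
  · rw [hμ.prim_gaugeTransform hP hξ hψ hp hq, hμ.prim_gaugeTransform hP hξ hψ hp' hq,
      ← mul_assoc, hmulψ hp' hp hq, mul_assoc, hmulξ hq hp hp']
  · obtain ⟨K, hK⟩ := hC.tendsto_stripFilter
    exact (hL p K).comp hK
  · obtain ⟨p, hp⟩ := hlog P hPΔ
    rw [(hγ.monodromy_eq hskξ huξ hp).2]
    exact hμ.coverPrim_period hP hξ (mem_cover_of_covMap_eq hγ hp)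
  · rw [(hγ.monodromy_eq hskξ huξ hp).2, (hγ.monodromy_eq hskψ huψ hp).2]
    -- pass to the limit in the equivariance under the deck transformation
    have hlim : L p * coverPrim Δ s ξ p (p - 2 * Real.pi * Complex.I)
        = coverPrim Δ s ψ p (p - 2 * Real.pi * Complex.I) * L p := by
      have h1 := (((hL p _).comp tendsto_sub_two_pi_stripFilter).comp
        tendsto_ofReal_stripFilter).mul_const (coverPrim Δ s ξ p (p - 2 * Real.pi * Complex.I))
      have h2 := ((hL p _).comp tendsto_ofReal_stripFilter).const_mul
        (coverPrim Δ s ψ p (p - 2 * Real.pi * Complex.I))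
      refine tendsto_nhds_unique (h1.congr' ?_) h2
      obtain ⟨R, hR⟩ := exists_leftHalf_subset_cover hs
      filter_upwards [eventually_le_atBot R] with x hx
      exact hμ.prim_gaugeTransform_sub_two_pi hP hξ hψ p.2 (hR (by simpa [mem_leftHalf] using hx))
    have hL2 : madj (L p) * L p = 1 := preserves_iff.1 (hLO p).1
    have hinv : Ring.inverse (L p) = madj (L p) :=
      Ring.inverse_unit ⟨L p, madj (L p), mul_eq_one_symm hL2, hL2⟩
    rw [hlim, hinv, mul_assoc _ (L p), mul_eq_one_symm hL2, mul_one]
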